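/- **Setting.** Let $n$ be the number of virtual pages, $[n]$ the set of pages, and $k\ge 1$ the number of slots of the real memory. A deterministic online paging strategy maintains a set of at most $k$ pages, initially empty; after each request the requested page is in the set, no other page may be brought in, and the set depends only on the sequence of pages requested so far. A request of a page that is not in the set is a fault. A randomized online strategy is a probability distribution on deterministic ones. $\mathrm{OPT}(k,\sigma)$ is the least number of faults with which $\sigma$ can be served offline with $k$ slots. An *extended access graph* on $[n]$ is a finite undirected graph $G$ with a labeling $\ell$ of its vertices by pages. Its request sequences are the sequences $\ell(v_1),\dots,\ell(v_m)$ with $v_{i+1}=v_i$ or $v_iv_{i+1}\in E(G)$, where $v_1$ is arbitrary; strategies see only the pages. $\Delta(G)\in\mathbb N\cup\{\infty\}$ is the least length of a walk between two different vertices with the same label. For a strategy $S$ let $r_S(G,k)$ be the infimum of all $r$ such that $E[S(\sigma)]\le r\,\mathrm{OPT}(k,\sigma)$ for every request sequence $\sigma$ of $G$, where $S(\sigma)$ is the number of faults, and let $r_S^\infty(G,k)$ be the infimum of all $r$ such that, for some constant $b\geq 0$, $E[S(\sigma)]\le r\,\mathrm{OPT}(k,\sigma)+b$ for every such $\sigma$.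 Let $r(G,k)$ and $r^\infty(G,k)$ be the infima of these ratios over all deterministic strategies, and $r_{\mathsf{obl}}(G,k)$ and $r^\infty_{\mathsf{obl}}(G,k)$ those over all randomized strategies. An algorithm $A$ assigns to each $(n,k,G)$ a strategy; its ratio on $G$ is denoted by $r_A(G,k)$. It is *truly online* if, for any two extended access graphs on the same set of pages, every $k$ and every common request sequence $\sigma$, the two strategies have the same behavior (in the randomized case: the same distribution of behavior) on $\sigma$. $A$ is *very strongly competitive* on a class of pairs $(G,k)$ if there are $b_1,b_2\ge0$ with $r_A(G,k)\le b_1 r^\infty(G,k)+b_2$ (for randomized $A$: $\le b_1r^\infty_{\mathsf{obl}}(G,k)+b_2$) for all pairs of the class. **Theorem.** There are absolute constants $c,C>0$ with the following properties. 1. For all integers $0<f<k<n$ and every deterministic truly online algorithm $A$ there is an extended access graph $G$ on $[n]$ with $\Delta(G)\ge k-f+1$, $r_A(G,k)\ge f$ and $r(G,k)\le C\log k$. In particular, for $f=f(k)=\omega(\log k)$ (with $0<f(k)<k$) such graphs $G=G_{k,n}$ can be chosen for all $n>k$ so that $r_A(G_{k,n},k)=\omega(r(G_{k,n},k))$ as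 $k\to\infty$, uniformly in $n>k$. 2. For all integers $0<f<k<n$ and every randomized truly online algorithm $A$ there is an extended access graph $G$ on $[n]$ with $\Delta(G)\ge k-f-1$, $r_A(G,k)\ge c\log f$ and $r_{\mathsf{obl}}(G,k)\le C(\log k-\log f+\log\log f)$, where $\log\log 1$ is read as $0$. In particular, for $f=f(k)=k^{1-o(1)}$ (with $0<f(k)<k$) such graphs $G=G_{k,n}$ can be chosen for all $n>k$ so that $r_A(G_{k,n},k)=\omega(r_{\mathsf{obl}}(G_{k,n},k))$ as $k\to\infty$, uniformly in $n>k$. 3. Consequently, there is a function $g(k)=o(k)$ such that no truly online algorithm, deterministic or randomized, is very strongly competitive on any class that contains all pairs $(G,k)$ with $\Delta(G)\ge k-g(k)$. -/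

import Mathlib

open Filter MeasureTheory Asymptotics
open scoped ENNReal NNReal

namespace Paging

/-- An extended access graph on the set of pages `P`: a finite undirected graph whose vertices are
labeled by pages; several vertices may carry the same page. -/
structure ExtGraph (P : Type) where
  V : Type
  finite : Finite V
  graph : SimpleGraph V
  label : V → P

/-- The request sequences of `G`: the label sequences of finite sequences of vertices in which each
vertex is equal or adjacent to its predecessor. The first vertex is arbitrary. -/
def ExtGraph.requests {P : Type} (G : ExtGraph P) : Set (List P) :=
  {σ | ∃ vs : List G.V, vs.IsChain (fun u v => u = v ∨ G.graph.Adj u v) ∧ σ = vs.map G.label}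

/-- `Δ(G)`: the least number of edges of a walk between two different vertices that carry the same
page (`⊤` if there is no such walk). -/
noncomputable def ExtGraph.Delta {P : Type} (G : ExtGraph P) : ℕ∞ :=
  ⨅ (u : G.V) (v : G.V) (_ : u ≠ v) (_ : G.label u = G.label v) (w : G.graph.Walk u v),
    (w.length : ℕ∞)

/-- A deterministic online paging strategy with `k` page slots: `cache σ` is the content of the real
memory after the requests `σ` (in chronological order) have been served. The memory is empty at the
beginning, a requested page has to be brought in, and no other page may be brought in. -/
@[ext]
structure DetAlg (P : Type) [DecidableEq P] (k : ℕ) where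
  cache : List P → Finset P
  cache_nil : cache [] = ∅
  card_le : ∀ σ, (cache σ).card ≤ k
  mem_cache : ∀ σ p, p ∈ cache (σ ++ [p])
  cache_subset : ∀ σ p, cache (σ ++ [p]) ⊆ insert p (cache σ)

/-- The number of page faults on `σ`: the requests whose page is not in the memory. -/
def DetAlg.faults {P : Type} [DecidableEq P] {k : ℕ} (a : DetAlg P k) (σ : List P) : ℕ :=
  ∑ i : Fin σ.length, if σ[i] ∈ a.cache (σ.take i) then 0 else 1

/-- The behavior of a strategy on `σ`: the successive contents of the real memory. -/
def DetAlg.run {P : Type} [DecidableEq P] {k : ℕ} (a : DetAlg P k) (σ : List P) :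
    List (Finset P) :=
  σ.inits.map a.cache

/-- The `σ`-algebra on strategies generated by the events `cache σ = C`. -/
instance {P : Type} [DecidableEq P] {k : ℕ} : MeasurableSpace (DetAlg P k) :=
  ⨆ σ : List P, MeasurableSpace.comap (fun a : DetAlg P k => a.cache σ) ⊤

/-- A randomized online paging strategy: a probability distribution on deterministic ones. -/
abbrev RandAlg (P : Type) [DecidableEq P] (k : ℕ) := ProbabilityMeasure (DetAlg P k)

/-- `Serves k C σ m`: starting with memory content `C`, the sequence `σ` can be served with `k` page
slots (by an offline algorithm) at a cost of `m` page faults. -/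
inductive Serves {P : Type} [DecidableEq P] (k : ℕ) : Finset P → List P → ℕ → Prop
  | nil (C : Finset P) : Serves k C [] 0
  | cons (C C' : Finset P) (p : P) (σ : List P) (m : ℕ) (hp : p ∈ C') (hC : C' ⊆ insert p C)
      (hk : C'.card ≤ k) (h : Serves k C' σ m) :
      Serves k C (p :: σ) ((if p ∈ C then 0 else 1) + m)

/-- The offline optimum `OPT(k, σ)`, starting with no pages in memory. -/
noncomputable def opt {P : Type} [DecidableEq P] (k : ℕ) (σ : List P) : ℕ :=
  sInf {m | Serves k ∅ σ m}

/-- The cost function of a deterministic strategy. -/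
def detCost {P : Type} [DecidableEq P] {k : ℕ} (a : DetAlg P k) (σ : List P) : ℝ≥0∞ :=
  (a.faults σ : ℝ≥0∞)

/-- The expected cost of a randomized strategy on a fixed sequence (oblivious adversary). -/
noncomputable def randCost {P : Type} [DecidableEq P] {k : ℕ} (μ : RandAlg P k) (σ : List P) :
    ℝ≥0∞ :=
  ∫⁻ a, (a.faults σ : ℝ≥0∞) ∂(μ : Measure (DetAlg P k))

/-- The strict competitive ratio on `G` of a strategy with the given (expected) cost function. -/
noncomputable def ratio {P : Type} [DecidableEq P] (G : ExtGraph P) (k : ℕ)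
    (cost : List P → ℝ≥0∞) : ℝ≥0∞ :=
  sInf {r | ∀ σ ∈ G.requests, cost σ ≤ r * (opt k σ : ℝ≥0∞)}

/-- The asymptotic competitive ratio on `G` of a strategy with the given cost function. -/
noncomputable def asympRatio {P : Type} [DecidableEq P] (G : ExtGraph P) (k : ℕ)
    (cost : List P → ℝ≥0∞) : ℝ≥0∞ :=
  sInf {r | ∃ b : ℝ≥0, ∀ σ ∈ G.requests, cost σ ≤ r * (opt k σ : ℝ≥0∞) + b}

/-- `r(G, k)`. -/
noncomputable def detRatio {P : Type} [DecidableEq P] (G : ExtGraph P) (k : ℕ) : ℝ≥0∞ :=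
  ⨅ a : DetAlg P k, ratio G k (detCost a)

/-- `r_obl(G, k)`. -/
noncomputable def oblRatio {P : Type} [DecidableEq P] (G : ExtGraph P) (k : ℕ) : ℝ≥0∞ :=
  ⨅ μ : RandAlg P k, ratio G k (randCost μ)

/-- `r^∞(G, k)`. -/
noncomputable def detRatioInf {P : Type} [DecidableEq P] (G : ExtGraph P) (k : ℕ) : ℝ≥0∞ :=
  ⨅ a : DetAlg P k, asympRatio G k (detCost a)

/-- `r^∞_obl(G, k)`. -/
noncomputable def oblRatioInf {P : Type} [DecidableEq P] (G : ExtGraph P) (k : ℕ) : ℝ≥0∞ :=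
  ⨅ μ : RandAlg P k, asympRatio G k (randCost μ)

/-- A deterministic algorithm that assigns to each access graph a strategy is truly online if the
strategies for two graphs on the same pages behave identically on all common request sequences. -/
def TrulyOnline {P : Type} [DecidableEq P] {k : ℕ} (A : ExtGraph P → DetAlg P k) : Prop :=
  ∀ G₁ G₂ : ExtGraph P, ∀ σ ∈ G₁.requests ∩ G₂.requests, (A G₁).run σ = (A G₂).run σ

/-- The same for randomized algorithms: the behavior on a common request sequence has the same
distribution for both graphs. -/
def RandTrulyOnline {P : Type} [DecidableEq P] {k : ℕ} (A : ExtGraph P → RandAlg P k) : Prop :=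
  ∀ G₁ G₂ : ExtGraph P, ∀ σ ∈ G₁.requests ∩ G₂.requests, ∀ E : Set (List (Finset P)),
    (A G₁ : Measure (DetAlg P k)) {a | a.run σ ∈ E} =
      (A G₂ : Measure (DetAlg P k)) {a | a.run σ ∈ E}

/-- A deterministic uniform algorithm: a strategy for each number `n` of virtual pages, each number
`k ≥ 1` of page slots and each extended access graph. -/
abbrev DetUniform := ∀ n k : ℕ, 0 < k → ExtGraph (Fin n) → DetAlg (Fin n) k

/-- A randomized uniform algorithm. -/
abbrev RandUniform := ∀ n k : ℕ, 0 < k → ExtGraph (Fin n) → RandAlg (Fin n) k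

/-- `A` is very strongly competitive on the class `𝒞` of paging problems `(G, k)`: its strict ratio
is at most a fixed linear function of the asymptotic deterministic ratio of the problem. -/
def VeryStronglyCompetitive (A : DetUniform) (𝒞 : ∀ n : ℕ, ℕ → Set (ExtGraph (Fin n))) : Prop :=
  ∃ b₁ b₂ : ℝ≥0, ∀ (n k : ℕ) (hk : 0 < k), ∀ G ∈ 𝒞 n k,
    ratio G k (detCost (A n k hk G)) ≤ b₁ * detRatioInf G k + b₂

/-- The same for randomized algorithms. -/
def RandVeryStronglyCompetitive (A : RandUniform) (𝒞 : ∀ n : ℕ, ℕ → Set (ExtGraph (Fin n))) :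
    Prop :=
  ∃ b₁ b₂ : ℝ≥0, ∀ (n k : ℕ) (hk : 0 < k), ∀ G ∈ 𝒞 n k,
    ratio G k (randCost (A n k hk G)) ≤ b₁ * oblRatioInf G k + b₂

end Paging

namespace Paging

/-! ### Fault counts, and the phase lower bound for the offline optimum -/

section Basic

variable {P : Type} [DecidableEq P] {k : ℕ}

/-! A truly online algorithm does not profit from the graph: on the complete graph every sequence is
a request sequence, so the algorithm amounts to one fixed strategy (`TrulyOnline.detCost_eq`,
`RandTrulyOnline.randCost_eq`), and the graph may be built against it. The graph is a path labeled
by `k + 1` pages and made of cells of length `k`. A cell is a block, which lists all but one of `f +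
1` pages in the order of some permutation, followed by a separator with the other `k - f` pages in a
fixed order. Equal labels are about `k - f` apart, so `Δ` is large whatever the permutations are.

Lower bounds. Before each new position the walk sweeps back over the recent part of the path. It
thus touches every page except those that may still come next in the block. Since a memory of size
`k` misses one of `k + 1` pages, some choice of the next entry goes with a fault
(`exists_step_fault`). A deterministic strategy can therefore be made to fault at every entry of a
block. Against a randomized one, a random permutation causes a fault at entry `j` with probability
at least `1 / (f + 1 - j)`, which gives a harmonic sum per block. Offline, it suffices to leave out
the page that the current cell lacks, at one fault per cell (`opt_sweep_le`).

Upper bounds. A strategy that knows the path only has to choose the evicted page well: once the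
memory is full, one of the `k + 1` pages is missing, and the next fault is its next request
(`lazyAlg_faults`). Faults are counted per phase, since the optimum is at least `k` plus the number
of completed phases (`phases_add_le_opt`). On any labeled path there is a page whose next request
either reveals a quarter of the pages missing in the phase or halves the possible starts of the
phase; this yields `O(log k)` on paths of polynomial length (`detRatio_pathExt_le`). For randomized
algorithms the blocks are moreover chosen such that consecutive permutations look independent
(`Good`), which costs the adversary at most one expected fault per block. The missing pages between
two partly visited blocks are those that come early in one permutation and late in the next. They
form a rectangle of positions, and a suitable eviction replaces its area, measured in units of about
`f log f`, by the square root (`GoodPair.pairWin`). So `O(log log f)` faults per phase suffice, even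
deterministically.

The consequence about very strong competitiveness is the case `k = j ^ 2`, `f = j`. -/

theorem DetAlg.faults_nil (a : DetAlg P k) : a.faults [] = 0 := by
  simp [DetAlg.faults]

theorem DetAlg.faults_append_singleton (a : DetAlg P k) (σ : List P) (p : P) :
    a.faults (σ ++ [p]) = a.faults σ + if p ∈ a.cache σ then 0 else 1 := by
  have key : ∀ τ : List P, a.faults τ =
      ∑ i ∈ Finset.range τ.length, if τ.getD i p ∈ a.cache (τ.take i) then 0 else 1 := by
    intro τ
    rw [DetAlg.faults, Finset.sum_range]
    refine Finset.sum_congr rfl fun i _ => ?_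
    simp
  rw [key, key, List.length_append, List.length_singleton, Finset.sum_range_succ]
  congr 1
  · refine Finset.sum_congr rfl fun i hi => ?_
    have hi := Finset.mem_range.1 hi
    rw [List.getD_append _ _ _ _ hi, List.take_append_of_le_length hi.le]
  · simp

theorem DetAlg.faults_le_append (a : DetAlg P k) (σ τ : List P) :
    a.faults σ ≤ a.faults (σ ++ τ) := by
  induction τ using List.reverseRecOn with
  | nil => simp
  | append_singleton τ p ih =>
    rw [← List.append_assoc, a.faults_append_singleton]
    omega

/-- A page that is missing from the memory causes a fault as soon as it is requested. -/
theorem DetAlg.faults_lt_of_notMem (a : DetAlg P k) (σ : List P) {q : P} (hq : q ∉ a.cache σ)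
    (τ : List P) (hτ : q ∈ τ) : a.faults σ < a.faults (σ ++ τ) := by
  have key : ∀ τ : List P, a.faults σ < a.faults (σ ++ τ) ∨ q ∉ a.cache (σ ++ τ) ∧ q ∉ τ := by
    intro τ
    induction τ using List.reverseRecOn with
    | nil => simp [hq]
    | append_singleton τ p ih =>
      rw [← List.append_assoc, a.faults_append_singleton]
      rcases ih with ih | ⟨h1, h2⟩
      · left; omega
      · by_cases hp : p = q
        · subst hp
          left
          have := a.faults_le_append σ τ
          simp [h1]; omega
        · right
          refine ⟨fun h => ?_, by simp [h2, Ne.symm hp]⟩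
          have := a.cache_subset _ _ h
          simp [h1, Ne.symm hp] at this
  rcases key τ with h | h
  · exact h
  · exact absurd hτ h.2

/-- If the memory cannot hold all pages of `M ∪ R`, then after touching all of `M` some request in
`R` completes a fault. -/
theorem DetAlg.exists_fault (a : DetAlg P k) (σ τ : List P) (Q : Finset P) (hQ : k < Q.card)
    (R : Finset P) (hR : R.Nonempty) (hM : ∀ q ∈ Q, q ∈ τ ∨ q ∈ R) :
    ∃ p ∈ R, a.faults σ < a.faults (σ ++ (τ ++ [p])) := by
  obtain ⟨q, hqQ, hq⟩ : ∃ q ∈ Q, q ∉ a.cache σ := by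
    by_contra! h
    exact absurd (Finset.card_le_card (show Q ⊆ a.cache σ from h))
      (by have := a.card_le σ; omega)
  rcases hM q hqQ with h | h
  · obtain ⟨p, hp⟩ := hR
    exact ⟨p, hp, a.faults_lt_of_notMem σ hq _ (by simp [h])⟩
  · exact ⟨q, h, a.faults_lt_of_notMem σ hq _ (by simp)⟩

/-! ### The offline optimum -/

theorem exists_serves (hk : 0 < k) (σ : List P) : ∀ C : Finset P, ∃ m, Serves k C σ m := by
  induction σ with
  | nil => exact fun C => ⟨0, .nil C⟩
  | cons p σ ih =>
    intro C
    obtain ⟨m, hm⟩ := ih {p}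
    exact ⟨_, .cons C {p} p σ m (by simp) (by simp) (by simpa using Nat.succ_le_of_lt hk) hm⟩

theorem serves_opt (hk : 0 < k) (σ : List P) : Serves k ∅ σ (opt k σ) :=
  Nat.sInf_mem (s := {m | Serves k ∅ σ m}) (exists_serves hk σ ∅)

theorem opt_le {σ : List P} {m : ℕ} (h : Serves k ∅ σ m) : opt k σ ≤ m := Nat.sInf_le h

theorem Serves.card_sdiff_le {C : Finset P} {σ : List P} {m : ℕ} (h : Serves k C σ m) :
    (σ.toFinset \ C).card ≤ m := by
  induction h with
  | nil C => simp
  | cons C C' p σ m hp hC hk h ih =>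
    have hsub : (p :: σ).toFinset \ C ⊆ (σ.toFinset \ C') ∪ (if p ∈ C then ∅ else {p}) := by
      intro x hx
      simp only [List.toFinset_cons, Finset.mem_sdiff, Finset.mem_insert, List.mem_toFinset] at hx
      by_cases hxp : x = p
      · subst hxp; simp [hx.2]
      · have : x ∉ C' := fun h => by
          have := hC h
          simp [hxp, hx.2] at this
        have h2 := hx.1.resolve_left hxp
        simp [this, h2]
    refine (Finset.card_le_card hsub).trans ((Finset.card_union_le _ _).trans ?_)
    split_ifs <;> simp <;> omega

theorem card_toFinset_le_opt (hk : 0 < k) (σ : List P) : σ.toFinset.card ≤ opt k σ := by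
  simpa using (serves_opt hk σ).card_sdiff_le

/-- One step of the partition of a request sequence into phases with at most `k` different pages:
the number of completed phases and the requests of the current phase. -/
def phaseStep (k : ℕ) (st : ℕ × List P) (p : P) : ℕ × List P :=
  if (st.2 ++ [p]).toFinset.card ≤ k then (st.1, st.2 ++ [p]) else (st.1 + 1, [p])

/-- The number of completed phases and the requests of the current phase. -/
def phases (k : ℕ) (σ : List P) : ℕ × List P := σ.foldl (phaseStep k) (0, [])

theorem phases_append_singleton (σ : List P) (p : P) :
    phases k (σ ++ [p]) = phaseStep k (phases k σ) p := by
  simp [phases]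

theorem le_foldl_phaseStep (σ : List P) : ∀ st : ℕ × List P,
    st.1 ≤ (σ.foldl (phaseStep k) st).1 := by
  induction σ with
  | nil => simp
  | cons p σ ih =>
    intro st
    refine le_trans ?_ (ih _)
    rw [phaseStep]; split_ifs <;> simp

/-- The last two summands give the size of the union of the memory and the pages of the current
phase. A request within the phase enlarges this union only by a fault. When a phase ends, its page
set has size `k`, and the union restarts with size at most `k`; the new page was a fault or an
additional element of the old union, which pays for the completed phase. -/
theorem Serves.phases_le (hk : 0 < k) {C : Finset P} {σ : List P} {m : ℕ} (h : Serves k C σ m) :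
    ∀ st : ℕ × List P, st.2.toFinset.card ≤ k → (σ.foldl (phaseStep k) st).1 = st.1 ∨
      (σ.foldl (phaseStep k) st).1 + k ≤
        st.1 + m + st.2.toFinset.card + (C \ st.2.toFinset).card := by
  induction h with
  | nil C => simp
  | cons C C' p σ m hp hC hk' h ih =>
    rintro ⟨z, s⟩ hs
    simp only [List.foldl_cons]
    have ih := ih (phaseStep k (z, s) p)
    set M := s.toFinset with hM
    have hto : (s ++ [p]).toFinset = insert p M := by
      ext; simp [hM]
    have hs : M.card ≤ k := hs
    generalize hw : (if p ∈ C then 0 else 1) = w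
    by_cases hc : (insert p M).card ≤ k
    · have hst : phaseStep k (z, s) p = (z, s ++ [p]) := by simp only [phaseStep, hto, if_pos hc]
      rw [hst] at ih ⊢
      simp only [hto] at ih ⊢
      rcases ih hc with ih | ih
      · exact Or.inl ih
      · right
        by_cases hpM : p ∈ M
        · rw [Finset.insert_eq_of_mem hpM] at ih
          have : (C' \ M).card ≤ (C \ M).card := by
            refine Finset.card_le_card fun x hx => ?_
            have hx' := Finset.mem_sdiff.1 hx
            have := hC hx'.1
            rcases Finset.mem_insert.1 this with rfl | h
            · exact absurd hpM hx'.2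
            · exact Finset.mem_sdiff.2 ⟨h, hx'.2⟩
          omega
        · rw [Finset.card_insert_of_notMem hpM] at ih
          have h1 : C' \ insert p M ⊆ (C \ M).erase p := by
            intro x hx
            simp only [Finset.mem_sdiff, Finset.mem_insert, not_or] at hx
            have := hC hx.1
            rcases Finset.mem_insert.1 this with h | h
            · exact absurd h hx.2.1
            · simp [hx, h]
          have h1 := Finset.card_le_card h1
          by_cases hpC : p ∈ C
          · have h2 : p ∈ C \ M := by simp [hpC, hpM]
            have := Finset.card_erase_add_one h2
            omega
          · have := Finset.card_erase_le (s := C \ M) (a := p)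
            simp only [hpC, if_false] at hw
            omega
    · have hst : phaseStep k (z, s) p = (z + 1, [p]) := by simp only [phaseStep, hto, if_neg hc]
      rw [hst] at ih ⊢
      right
      have hpC : (C' \ [p].toFinset).card + 1 ≤ k := by
        have : p ∈ C' := hp
        have h2 : C' \ [p].toFinset = C'.erase p := by ext; simp [and_comm]
        rw [h2, Finset.card_erase_add_one this]; exact hk'
      have hins := Finset.card_insert_le p M
      have hpM : p ∉ M := fun h => hc (by rwa [Finset.insert_eq_of_mem h])
      have hgood : 1 ≤ w + (C \ M).card := by
        by_cases h : p ∈ C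
        · have : 0 < (C \ M).card := Finset.card_pos.2 ⟨p, by simp [h, hpM]⟩
          omega
        · simp only [h, if_false] at hw
          omega
      have h1 : [p].toFinset.card = 1 := by simp
      rcases ih (by simpa using Nat.succ_le_of_lt hk) with ih | ih
      · simp only at ih ⊢; omega
      · simp only [h1] at ih ⊢; omega

/-- The summand `k` comes from filling the empty memory. It later absorbs the additive terms of all
fault bounds, which makes strict ratios possible. -/
theorem phases_add_le_opt (hk : 0 < k) (σ : List P) (h : (phases k σ).1 ≠ 0) :
    (phases k σ).1 + k ≤ opt k σ := by
  rcases (serves_opt hk σ).phases_le hk (0, []) (by simp) with h' | h'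
  · exact absurd h' h
  · simpa [phases] using h'

theorem phases_list_ne_nil {σ : List P} (h : σ ≠ []) : (phases k σ).2 ≠ [] := by
  induction σ using List.reverseRecOn with
  | nil => simp at h
  | append_singleton τ p ih =>
    rw [phases_append_singleton, phaseStep]; split_ifs <;> simp

theorem phases_list_card (hk : 0 < k) (σ : List P) : (phases k σ).2.toFinset.card ≤ k := by
  induction σ using List.reverseRecOn with
  | nil => simp [phases]
  | append_singleton τ p ih =>
    rw [phases_append_singleton, phaseStep]; split_ifs with h
    · exact h
    · simpa using Nat.succ_le_of_lt hk

theorem phases_list_suffix (σ : List P) : (phases k σ).2 <:+ σ := by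
  induction σ using List.reverseRecOn with
  | nil => simp [phases]
  | append_singleton τ p ih =>
    rw [phases_append_singleton, phaseStep]; split_ifs with h
    · obtain ⟨t, ht⟩ := ih
      exact ⟨t, by simp [← List.append_assoc, ht]⟩
    · exact ⟨τ, rfl⟩

theorem mem_phases_list {σ : List P} {p : P} : p ∈ (phases k (σ ++ [p])).2 := by
  rw [phases_append_singleton, phaseStep]; split_ifs <;> simp

theorem phases_fst_le (σ τ : List P) : (phases k σ).1 ≤ (phases k (σ ++ τ)).1 := by
  rw [phases, phases, List.foldl_append]
  exact le_foldl_phaseStep _ _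

theorem phases_append (σ τ : List P) : (phases k σ).1 < (phases k (σ ++ τ)).1 ∨
    ((phases k (σ ++ τ)).1 = (phases k σ).1 ∧
      (phases k (σ ++ τ)).2 = (phases k σ).2 ++ τ) := by
  induction τ using List.reverseRecOn with
  | nil => simp
  | append_singleton τ p ih =>
    rw [← List.append_assoc, phases_append_singleton, phaseStep]
    split_ifs with h
    · rcases ih with ih | ih
      · exact Or.inl ih
      · exact Or.inr ⟨ih.1, by simp [ih.2]⟩
    · left
      have := phases_fst_le (k := k) σ τ
      simp; omega

theorem card_le_of_phases_eq_zero (hk : 0 < k) {σ : List P} (h : (phases k σ).1 = 0) :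
    σ.toFinset.card ≤ k := by
  have h1 := phases_append (k := k) [] σ
  simp only [List.nil_append, h, not_lt_zero, false_or] at h1
  have := phases_list_card hk σ
  rw [h1.2] at this
  simpa [phases] using this

end Basic

theorem requests_append_left {P : Type} {G : ExtGraph P} {σ τ : List P} (h : σ ++ τ ∈ G.requests) :
    σ ∈ G.requests := by
  obtain ⟨vs, hc, hv⟩ := h
  obtain ⟨v1, v2, rfl, h1, h2⟩ := List.append_eq_map_iff.1 hv
  exact ⟨v1, hc.left_of_append, h1.symm⟩

/-! ### Competitive ratios and expected costs -/

section Ratio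

variable {P : Type} [DecidableEq P] {k : ℕ}

theorem le_ratio {G : ExtGraph P} {cost : List P → ℝ≥0∞} {x : ℝ≥0∞} {σ : List P}
    (hσ : σ ∈ G.requests) (h0 : opt k σ ≠ 0) (h : x * (opt k σ : ℝ≥0∞) ≤ cost σ) :
    x ≤ ratio G k cost := by
  refine le_sInf fun r hr => ?_
  have h2 := h.trans (hr σ hσ)
  rwa [ENNReal.mul_le_mul_iff_left (by exact_mod_cast h0) (ENNReal.natCast_ne_top _)] at h2

theorem asympRatio_le_ratio (G : ExtGraph P) (k : ℕ) (cost : List P → ℝ≥0∞) :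
    asympRatio G k cost ≤ ratio G k cost :=
  sInf_le_sInf fun _ hr => ⟨0, fun σ hσ => (hr σ hσ).trans le_self_add⟩

theorem detRatioInf_le (G : ExtGraph P) (k : ℕ) : detRatioInf G k ≤ detRatio G k :=
  iInf_mono fun _ => asympRatio_le_ratio _ _ _

theorem oblRatioInf_le (G : ExtGraph P) (k : ℕ) : oblRatioInf G k ≤ oblRatio G k :=
  iInf_mono fun _ => asympRatio_le_ratio _ _ _

theorem measurableSet_mem_cache (σ : List P) (S : Set (Finset P)) :
    MeasurableSet {a : DetAlg P k | a.cache σ ∈ S} := by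
  exact le_iSup (fun σ : List P =>
    MeasurableSpace.comap (fun a : DetAlg P k => a.cache σ) ⊤) σ _ ⟨S, trivial, rfl⟩

theorem measurable_faults (σ : List P) :
    Measurable fun a : DetAlg P k => a.faults σ := by
  induction σ using List.reverseRecOn with
  | nil => simp [DetAlg.faults_nil]
  | append_singleton σ p ih =>
    simp only [DetAlg.faults_append_singleton]
    refine ih.add (Measurable.ite ?_ measurable_const measurable_const)
    exact measurableSet_mem_cache σ {C | p ∈ C}

theorem measurable_detCost (σ : List P) : Measurable fun a : DetAlg P k => detCost a σ :=
  (measurable_from_top (f := fun n : ℕ => (n : ℝ≥0∞))).comp (measurable_faults σ)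

theorem oblRatio_le_detRatio (G : ExtGraph P) (k : ℕ) : oblRatio G k ≤ detRatio G k := by
  refine le_iInf fun a => ?_
  refine iInf_le_of_le ⟨Measure.dirac a, Measure.dirac.isProbabilityMeasure⟩ (le_of_eq ?_)
  congr 1
  funext σ
  exact lintegral_dirac' a (measurable_detCost σ)

theorem randCost_append_singleton (μ : RandAlg P k) (σ : List P) (p : P) :
    randCost μ (σ ++ [p]) =
      randCost μ σ + (μ : Measure (DetAlg P k)) {a | p ∉ a.cache σ} := by
  have h : ∀ a : DetAlg P k, (a.faults (σ ++ [p]) : ℝ≥0∞) =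
      a.faults σ + {a : DetAlg P k | p ∉ a.cache σ}.indicator 1 a := by
    intro a
    rw [DetAlg.faults_append_singleton]
    by_cases hp : p ∈ a.cache σ <;> simp [hp]
  simp only [randCost, h]
  have hm : Measurable fun a : DetAlg P k => (a.faults σ : ℝ≥0∞) := measurable_detCost σ
  rw [lintegral_add_left hm, lintegral_indicator_one]
  exact measurableSet_mem_cache σ {C | p ∉ C}

theorem randCost_le_append (μ : RandAlg P k) (σ τ : List P) :
    randCost μ σ ≤ randCost μ (σ ++ τ) :=
  lintegral_mono fun a => Nat.cast_le.2 (a.faults_le_append σ τ)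

theorem randCost_add_le (μ : RandAlg P k) (σ τ : List P) :
    randCost μ σ + (μ : Measure (DetAlg P k)) {a | a.faults σ < a.faults (σ ++ τ)} ≤
      randCost μ (σ ++ τ) := by
  have hm : MeasurableSet {a : DetAlg P k | a.faults σ < a.faults (σ ++ τ)} :=
    measurableSet_lt (measurable_faults _) (measurable_faults _)
  have hm' : Measurable fun a : DetAlg P k => (a.faults σ : ℝ≥0∞) := measurable_detCost σ
  rw [randCost, ← lintegral_indicator_one hm, ← lintegral_add_left hm']
  refine lintegral_mono fun a => ?_
  by_cases h : a.faults σ < a.faults (σ ++ τ)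
  · simp only [Set.indicator, Set.mem_ofPred_eq, h, if_true, Pi.one_apply]
    exact_mod_cast h
  · simp only [Set.indicator, Set.mem_ofPred_eq, h, if_false, add_zero]
    exact_mod_cast a.faults_le_append σ τ

/-! ### Truly online algorithms ignore the graph -/

/-- The complete graph on `n` pages: every sequence is a request sequence. -/
def completeExtGraph (n : ℕ) : ExtGraph (Fin n) := ⟨Fin n, inferInstance, ⊤, id⟩

theorem mem_requests_completeExtGraph {n : ℕ} (σ : List (Fin n)) :
    σ ∈ (completeExtGraph n).requests := by
  refine ⟨σ, ?_, by simp [completeExtGraph]⟩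
  refine (List.isChain_iff_getElem.2 fun i hi => ?_)
  simp only [completeExtGraph, SimpleGraph.top_adj]
  exact em _

theorem cache_mem_run (a : DetAlg P k) (σ : List P) : (a.run σ).getLast? = some (a.cache σ) := by
  induction σ using List.reverseRecOn with
  | nil => simp [DetAlg.run]
  | append_singleton σ p ih => simp [DetAlg.run, List.inits_append]

/-- The graph may thus be chosen after inspection of a single strategy, the one for the complete
graph. -/
theorem TrulyOnline.detCost_eq {n : ℕ} {A : ExtGraph (Fin n) → DetAlg (Fin n) k}
    (hA : TrulyOnline A) (G : ExtGraph (Fin n)) (σ : List (Fin n)) (hσ : σ ∈ G.requests) :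
    detCost (A G) σ = detCost (A (completeExtGraph n)) σ := by
  have h : (A G).faults σ = (A (completeExtGraph n)).faults σ := by
    induction σ using List.reverseRecOn with
    | nil => simp [DetAlg.faults_nil]
    | append_singleton σ p ih =>
      have hs := requests_append_left hσ
      have h1 := hA G (completeExtGraph n) σ ⟨hs, mem_requests_completeExtGraph σ⟩
      have h2 := cache_mem_run (A G) σ
      rw [h1, cache_mem_run, Option.some_inj] at h2
      rw [DetAlg.faults_append_singleton, DetAlg.faults_append_singleton, ih hs, h2]
  rw [detCost, detCost, h]

theorem RandTrulyOnline.randCost_eq {n : ℕ} {A : ExtGraph (Fin n) → RandAlg (Fin n) k}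
    (hA : RandTrulyOnline A) (G : ExtGraph (Fin n)) (σ : List (Fin n)) (hσ : σ ∈ G.requests) :
    randCost (A G) σ = randCost (A (completeExtGraph n)) σ := by
  induction σ using List.reverseRecOn with
  | nil => simp [randCost, DetAlg.faults_nil]
  | append_singleton σ p ih =>
    have hs := requests_append_left hσ
    -- A fault at `p` is an event of the behavior: it depends only on the last memory content of the
    -- run.
    have h1 := hA G (completeExtGraph n) σ ⟨hs, mem_requests_completeExtGraph σ⟩
      {L | ∃ C, L.getLast? = some C ∧ p ∉ C}
    simp only [cache_mem_run, Set.mem_ofPred_eq, Option.some_inj, exists_eq_left'] at h1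
    rw [randCost_append_singleton, randCost_append_singleton, ih hs, h1]

end Ratio

/-! ### Paths -/

section Path

variable {P : Type}

/-- The path with `N` vertices, labeled by the first `N` values of `lab`. -/
def pathExt (N : ℕ) (lab : ℕ → P) : ExtGraph P :=
  ⟨Fin N, inferInstance, SimpleGraph.pathGraph N, fun v => lab v⟩

/-- Two positions on a path are equal or adjacent. -/
def Near (x y : ℕ) : Prop := x ≤ y + 1 ∧ y ≤ x + 1

theorem mem_requests_pathExt {N : ℕ} {lab : ℕ → P} {σ : List P} :
    σ ∈ (pathExt N lab).requests ↔
      ∃ vs : List ℕ, (∀ v ∈ vs, v < N) ∧ vs.IsChain Near ∧ σ = vs.map lab := by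
  have hadj : ∀ u v : Fin N, (u = v ∨ (pathExt N lab).graph.Adj u v) ↔ Near u v := by
    intro u v
    change (u = v ∨ (SimpleGraph.pathGraph N).Adj u v) ↔ _
    rw [SimpleGraph.pathGraph_adj, Near, Fin.ext_iff]
    omega
  constructor
  · rintro ⟨vs, hc, rfl⟩
    change List (Fin N) at vs
    refine ⟨vs.map Fin.val, ?_, ?_, ?_⟩
    · intro v hv
      obtain ⟨u, -, rfl⟩ := List.mem_map.1 hv
      exact u.2
    · rw [List.isChain_map]
      exact hc.imp fun u v h => (hadj u v).1 h
    · rw [List.map_map]; rfl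
  · rintro ⟨vs, hN, hc, rfl⟩
    lift vs to List (Fin N) using hN
    rw [List.isChain_map] at hc
    refine ⟨vs, hc.imp fun u v h => (hadj u v).2 h, ?_⟩
    rw [List.map_map]; rfl

theorem walk_length_pathGraph {N : ℕ} {u v : Fin N} (w : (SimpleGraph.pathGraph N).Walk u v) :
    (u : ℕ) ≤ v + w.length ∧ (v : ℕ) ≤ u + w.length := by
  induction w with
  | nil => simp
  | cons h w ih =>
    rw [SimpleGraph.pathGraph_adj] at h
    rw [SimpleGraph.Walk.length_cons]
    omega

theorem le_Delta_pathExt {N : ℕ} {lab : ℕ → P} {d : ℕ}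
    (h : ∀ x y, x < y → y < N → lab x = lab y → x + d ≤ y) :
    (d : ℕ∞) ≤ (pathExt N lab).Delta := by
  refine le_iInf fun u => le_iInf fun v => le_iInf fun huv => le_iInf fun hl => le_iInf fun w => ?_
  change Fin N at u v
  have hw := walk_length_pathGraph (N := N) (u := u) (v := v) w
  have hl : lab u = lab v := hl
  have goal : d ≤ SimpleGraph.Walk.length (G := SimpleGraph.pathGraph N) w → (d : ℕ∞) ≤ w.length :=
    fun h => Nat.cast_le.2 h
  apply goal
  rcases lt_trichotomy (u : ℕ) v with h1 | h1 | h1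
  · have := h _ _ h1 v.2 hl; omega
  · exact absurd (Fin.ext h1) huv
  · have := h _ _ h1 u.2 hl.symm; omega

end Path

/-! ### Lazy strategies on `k + 1` pages -/

section Lazy

variable {P : Type} [DecidableEq P] {k : ℕ}

/-- One step of the lazy strategy that evicts `e h` at a fault with history `h` (if its memory is
full). -/
def lazyStep (k : ℕ) (e : List P → P) (st : List P × Finset P) (p : P) : List P × Finset P :=
  (st.1 ++ [p],
    if p ∈ st.2 then st.2
    else if st.2.card < k then insert p st.2
    else if e (st.1 ++ [p]) ∈ st.2 then insert p (st.2.erase (e (st.1 ++ [p])))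
    -- A legal dummy content, for rules that name a page outside of the memory.
    else {p})

theorem foldl_lazyStep_fst (e : List P → P) (σ : List P) :
    (σ.foldl (lazyStep k e) ([], ∅)).1 = σ := by
  induction σ using List.reverseRecOn with
  | nil => rfl
  | append_singleton σ p ih => simp [lazyStep, ih]

/-- The lazy strategy with eviction rule `e`. -/
def lazyAlg (hk : 0 < k) (e : List P → P) : DetAlg P k where
  cache σ := (σ.foldl (lazyStep k e) ([], ∅)).2
  cache_nil := rfl
  card_le σ := by
    induction σ using List.reverseRecOn with
    | nil => simp
    | append_singleton σ p ih =>
      simp only [List.foldl_append, List.foldl_cons, List.foldl_nil]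
      generalize σ.foldl (lazyStep k e) ([], ∅) = st at ih
      rw [lazyStep]
      dsimp only
      split_ifs with h1 h2 h3
      · exact ih
      · exact (Finset.card_insert_le _ _).trans h2
      · refine (Finset.card_insert_le _ _).trans ?_
        rw [Finset.card_erase_add_one h3]; exact ih
      · simpa using Nat.succ_le_of_lt hk
  mem_cache σ p := by
    simp only [List.foldl_append, List.foldl_cons, List.foldl_nil]
    rw [lazyStep]
    dsimp only
    split_ifs with h1 h2 h3 <;> simp [h1]
  cache_subset σ p := by
    simp only [List.foldl_append, List.foldl_cons, List.foldl_nil]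
    generalize σ.foldl (lazyStep k e) ([], ∅) = st
    rw [lazyStep]
    dsimp only
    split_ifs with h1 h2 h3
    · exact Finset.subset_insert _ _
    · exact subset_rfl
    · exact Finset.insert_subset_insert _ (Finset.erase_subset _ _)
    · simp

theorem lazyAlg_cache_append (hk : 0 < k) (e : List P → P) (σ : List P) (p : P) :
    (lazyAlg hk e).cache (σ ++ [p]) =
      if p ∈ (lazyAlg hk e).cache σ then (lazyAlg hk e).cache σ
      else if ((lazyAlg hk e).cache σ).card < k then insert p ((lazyAlg hk e).cache σ)
      else if e (σ ++ [p]) ∈ (lazyAlg hk e).cache σ then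
        insert p (((lazyAlg hk e).cache σ).erase (e (σ ++ [p])))
      else {p} := by
  simp only [lazyAlg, List.foldl_append, List.foldl_cons, List.foldl_nil]
  rw [lazyStep]
  dsimp only
  rw [foldl_lazyStep_fst]
  rfl

/-- Amortized analysis of a lazy strategy on sequences over `k + 1` pages: the potential
`L * Z h - rank h` grows by one from each fault to the next. -/
theorem lazyAlg_faults (hk : 0 < k) (Q : Finset P) (hQ : Q.card = k + 1) (ok : Set (List P))
    (ok_append : ∀ σ τ, σ ++ τ ∈ ok → σ ∈ ok) (ok_mem : ∀ σ ∈ ok, ∀ p ∈ σ, p ∈ Q)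
    (e : List P → P) (rank Z : List P → ℕ) (L : ℕ) (rank_le : ∀ h, rank h ≤ L)
    (Z_mono : ∀ σ τ, Z σ ≤ Z (σ ++ τ))
    (he : ∀ h p, h ++ [p] ∈ ok → e (h ++ [p]) ∈ Q ∧ e (h ++ [p]) ≠ p)
    (hstep : ∀ h τ, h ≠ [] → h ++ τ ++ [e h] ∈ ok → e h ∉ τ →
      rank (h ++ τ ++ [e h]) + 1 + L * Z h ≤ rank h + L * Z (h ++ τ ++ [e h]))
    (σ : List P) (hσ : σ ∈ ok) :
    (lazyAlg hk e).faults σ = σ.toFinset.card ∨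
      k < σ.toFinset.card ∧ (lazyAlg hk e).faults σ ≤ k + 1 + L * (Z σ + 1) := by
  set a := lazyAlg hk e with ha
  -- Until `k + 1` different pages have appeared, each page costs one fault. From then on the memory
  -- is `Q` without the page evicted at the last fault `h`, so the next fault is the next request of
  -- `e h`. The hypothesis `hstep` speaks about exactly this moment.
  have key : ∀ σ ∈ ok, (a.cache σ = σ.toFinset ∧ a.faults σ = σ.toFinset.card) ∨
      (k < σ.toFinset.card ∧ ∃ h τ, h ≠ [] ∧ σ = h ++ τ ∧ e h ∉ τ ∧ e h ∈ Q ∧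
        a.cache σ = Q.erase (e h) ∧ a.faults σ + rank h ≤ k + 1 + L * (Z h + 1)) := by
    intro σ
    induction σ using List.reverseRecOn with
    | nil => intro _; left; simp [a.cache_nil, a.faults_nil]
    | append_singleton σ p ih =>
      intro hok
      have hto : (σ ++ [p]).toFinset = insert p σ.toFinset := by ext; simp
      have hpQ : p ∈ Q := ok_mem _ hok p (by simp)
      have hcache := lazyAlg_cache_append hk e σ p
      rw [← ha] at hcache
      obtain ⟨heQ, hep⟩ := he σ p hok
      have hfull : ∀ q ∈ Q, a.cache σ = Q.erase q → (p = q →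
          a.cache (σ ++ [p]) = Q.erase (e (σ ++ [p]))) := by
        rintro q hq hc rfl
        have hcard : (Q.erase p).card = k := by
          rw [Finset.card_erase_of_mem hq, hQ]; rfl
        rw [hcache, hc, hcard]
        simp only [Finset.mem_erase, ne_eq, not_true, false_and, if_false, lt_irrefl, hep, heQ,
          not_false_eq_true, and_self, if_true]
        ext x
        simp only [Finset.mem_insert, Finset.mem_erase]
        by_cases hx : x = p
        · subst hx; simp [hpQ, Ne.symm hep]
        · simp [hx]
      rcases ih (ok_append _ _ hok) with ⟨hc, hf⟩ | ⟨hcard, h, τ, hne, rfl, hτ, hehQ, hc, hf⟩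
      · by_cases hp : p ∈ a.cache σ
        · left
          rw [hto, a.faults_append_singleton, hcache]
          have : p ∈ σ.toFinset := hc ▸ hp
          rw [Finset.insert_eq_of_mem this]
          rw [if_pos hp, if_pos hp]
          exact ⟨hc, hf⟩
        · have hp' : p ∉ σ.toFinset := hc ▸ hp
          by_cases hlt : (a.cache σ).card < k
          · left
            rw [hto, a.faults_append_singleton, hcache, Finset.card_insert_of_notMem hp']
            simp [hp, hlt, hf]
            rw [hc]
          · right
            have hk' : (a.cache σ).card = k := le_antisymm (a.card_le σ) (not_lt.1 hlt)
            have hkσ : σ.toFinset.card = k := hc ▸ hk'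
            have hsub : a.cache σ ⊆ Q.erase p := by
              intro x hx
              refine Finset.mem_erase.2 ⟨fun h => hp (h ▸ hx), ?_⟩
              rw [hc, List.mem_toFinset] at hx
              exact ok_mem _ (ok_append _ _ hok) x hx
            have heq : a.cache σ = Q.erase p := by
              refine Finset.eq_of_subset_of_card_le hsub ?_
              rw [Finset.card_erase_of_mem hpQ, hQ, hk']; simp
            refine ⟨?_, σ ++ [p], [], by simp, by simp, by simp, heQ, hfull p hpQ heq rfl, ?_⟩
            · rw [hto, Finset.card_insert_of_notMem hp']; omega
            · rw [a.faults_append_singleton, hf, hkσ]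
              have := rank_le (σ ++ [p])
              simp only [hp, if_false]
              nlinarith [Nat.zero_le (L * Z (σ ++ [p]))]
      · right
        refine ⟨hcard.trans_le ?_, ?_⟩
        · rw [hto]; exact Finset.card_le_card (Finset.subset_insert _ _)
        · by_cases hp : p = e h
          · have hnot : p ∉ a.cache (h ++ τ) := by rw [hc, hp]; simp
            have hst := hstep h τ hne (by rw [← hp]; exact hok) hτ
            rw [← hp] at hst
            refine ⟨h ++ τ ++ [p], [], by simp, by simp, by simp, heQ,
              hfull (e h) hehQ hc hp, ?_⟩
            rw [a.faults_append_singleton]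
            simp only [hnot, if_false]
            nlinarith
          · have hmem : p ∈ a.cache (h ++ τ) := by rw [hc]; simp [hp, hpQ]
            refine ⟨h, τ ++ [p], hne, by simp, by simp [hτ, Ne.symm hp], hehQ, ?_, ?_⟩
            · rw [hcache, if_pos hmem, hc]
            · rw [a.faults_append_singleton]
              simpa only [hmem, if_true, add_zero] using hf
  rcases key σ hσ with h | ⟨h1, h, τ, -, rfl, -, -, -, h2⟩
  · exact Or.inl h.2
  · right
    refine ⟨h1, ?_⟩
    have := Nat.mul_le_mul_left L (Nat.add_le_add_right (Z_mono h τ) 1)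
    omega

end Lazy

/-- Steps of length at most one leave no gaps. -/
theorem exists_toFinset_eq_Icc {vs : List ℕ} (hne : vs ≠ []) (hc : vs.IsChain Near) :
    ∃ l r, vs.toFinset = Finset.Icc l r := by
  induction vs with
  | nil => simp at hne
  | cons x vs ih =>
    cases vs with
    | nil => exact ⟨x, x, by simp⟩
    | cons y vs =>
      rw [List.isChain_cons_cons] at hc
      obtain ⟨l, r, h⟩ := ih (by simp) hc.2
      have hy : y ∈ Finset.Icc l r := by rw [← h]; simp
      obtain ⟨h1, h2⟩ := hc.1
      rw [Finset.mem_Icc] at hy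
      refine ⟨min l x, max r x, ?_⟩
      rw [List.toFinset_cons, h]
      ext z
      simp only [Finset.mem_insert, Finset.mem_Icc]
      omega

/-! ### Logarithmic upper bound for arbitrary labeled paths -/

section DetUpper

variable {P : Type} {k : ℕ}

/-- The possible first positions of a walk on the labeled path with label sequence `s`. -/
noncomputable def starts (N : ℕ) (lab : ℕ → P) (s : List P) : Finset ℕ := by
  classical
  exact (Finset.range N).filter fun x => ∃ vs : List ℕ, (∀ v ∈ vs, v < N) ∧ vs.IsChain Near ∧
    vs.head? = some x ∧ vs.map lab = s

theorem mem_starts {N : ℕ} {lab : ℕ → P} {s : List P} {x : ℕ} :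
    x ∈ starts N lab s ↔ ∃ vs : List ℕ, (∀ v ∈ vs, v < N) ∧ vs.IsChain Near ∧
      vs.head? = some x ∧ vs.map lab = s := by
  classical
  rw [starts, Finset.mem_filter, Finset.mem_range, and_iff_right_iff_imp]
  rintro ⟨vs, hN, -, hx, -⟩
  exact hN x (List.mem_of_mem_head? hx)

theorem starts_append_subset {N : ℕ} {lab : ℕ → P} {s : List P} (hs : s ≠ []) (τ : List P) :
    starts N lab (s ++ τ) ⊆ starts N lab s := by
  intro x hx
  rw [mem_starts] at hx ⊢
  obtain ⟨vs, hN, hc, hx, hv⟩ := hx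
  obtain ⟨v1, v2, rfl, h1, h2⟩ := List.map_eq_append_iff.1 hv
  have hv1 : v1 ≠ [] := by rintro rfl; exact hs (by simpa using h1.symm)
  refine ⟨v1, fun v hv => hN v (by simp [hv]), hc.left_of_append, ?_, h1⟩
  rwa [List.head?_append_of_ne_nil _ hv1] at hx

theorem starts_nonempty_of_suffix {N : ℕ} {lab : ℕ → P} {σ s : List P}
    (hσ : σ ∈ (pathExt N lab).requests) (hs : s <:+ σ) (hne : s ≠ []) :
    (starts N lab s).Nonempty := by
  obtain ⟨vs, hN, hc, rfl⟩ := mem_requests_pathExt.1 hσ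
  obtain ⟨t, ht⟩ := hs
  obtain ⟨v1, v2, rfl, h1, h2⟩ := List.map_eq_append_iff.1 ht.symm
  have hv2 : v2 ≠ [] := by rintro rfl; exact hne (by simpa using h2.symm)
  obtain ⟨x, w, rfl⟩ := List.exists_cons_of_ne_nil hv2
  exact ⟨x, mem_starts.2 ⟨x :: w, fun v hv => hN v (List.mem_append_right _ hv),
    hc.right_of_append, rfl, h2⟩⟩

variable [DecidableEq P]

theorem exists_interval_of_mem_starts {N : ℕ} {lab : ℕ → P} {s : List P} {x : ℕ}
    (hx : x ∈ starts N lab s) : ∃ l r, l ≤ x ∧ x ≤ r ∧ r < N ∧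
      (Finset.Icc l r).image lab = s.toFinset := by
  obtain ⟨vs, hN, hc, hx, hv⟩ := mem_starts.1 hx
  have hmem := List.mem_of_mem_head? hx
  obtain ⟨l, r, h⟩ := exists_toFinset_eq_Icc (List.ne_nil_of_mem hmem) hc
  have hx' : x ∈ Finset.Icc l r := by rw [← h]; simpa using hmem
  rw [Finset.mem_Icc] at hx'
  have hr : r ∈ Finset.Icc l r := Finset.mem_Icc.2 ⟨hx'.1.trans hx'.2, le_rfl⟩
  refine ⟨l, r, hx'.1, hx'.2, hN r (by rw [← h] at hr; simpa using hr), ?_⟩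
  rw [← h, ← hv]
  ext; simp

/-- `q` occurs in an interval around `x` with few pages outside of `M`. -/
def Early (N : ℕ) (lab : ℕ → P) (Q M : Finset P) (x : ℕ) (q : P) : Prop :=
  ∃ l r, l ≤ x ∧ x ≤ r ∧ r < N ∧ q ∈ (Finset.Icc l r).image lab ∧
    4 * ((Finset.Icc l r).image lab \ M).card ≤ (Q \ M).card

open Classical in
-- All intervals in question contain `x`. Hence an early page to the left of `x` lies in the
-- interval that reaches farthest to the left, and one to the right lies in the interval that
-- reaches farthest to the right. Each of the two contains at most a quarter of `Q \ M`.
theorem card_early_le (N : ℕ) (lab : ℕ → P) (Q M : Finset P) (x : ℕ) :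
    2 * ((Q \ M).filter (Early N lab Q M x)).card ≤ (Q \ M).card := by
  set S := ((Finset.range (x + 1)) ×ˢ (Finset.range N)).filter fun z =>
    x ≤ z.2 ∧ 4 * ((Finset.Icc z.1 z.2).image lab \ M).card ≤ (Q \ M).card with hS
  rcases S.eq_empty_or_nonempty with h | h
  · have : (Q \ M).filter (Early N lab Q M x) = ∅ := by
      rw [Finset.filter_eq_empty_iff]
      rintro q - ⟨l, r, h1, h2, h3, -, h5⟩
      have : (l, r) ∈ S := by simp [hS, h1, h2, h3, h5]
      simp [h] at this
    simp [this]
  · obtain ⟨z1, hz1, hmin⟩ := Finset.exists_min_image S Prod.fst h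
    obtain ⟨z2, hz2, hmax⟩ := Finset.exists_max_image S Prod.snd h
    have hsub : (Q \ M).filter (Early N lab Q M x) ⊆
        ((Finset.Icc z1.1 z1.2).image lab \ M) ∪ ((Finset.Icc z2.1 z2.2).image lab \ M) := by
      intro q hq
      obtain ⟨hq, l, r, h1, h2, h3, h4, h5⟩ := Finset.mem_filter.1 hq
      have hqM := (Finset.mem_sdiff.1 hq).2
      have hlr : (l, r) ∈ S := by simp [hS, h1, h2, h3, h5]
      have hl := hmin _ hlr
      have hr := hmax _ hlr
      obtain ⟨y, hy, rfl⟩ := Finset.mem_image.1 h4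
      simp only [hS, Finset.mem_filter, Finset.mem_product, Finset.mem_range] at hz1 hz2
      rw [Finset.mem_Icc] at hy
      dsimp only at hl hr
      rw [Finset.mem_union]
      rcases le_total y x with hyx | hyx
      · left
        exact Finset.mem_sdiff.2
          ⟨Finset.mem_image_of_mem _ (Finset.mem_Icc.2 ⟨by omega, by omega⟩), hqM⟩
      · right
        exact Finset.mem_sdiff.2
          ⟨Finset.mem_image_of_mem _ (Finset.mem_Icc.2 ⟨by omega, by omega⟩), hqM⟩
    have h1 := (Finset.card_le_card hsub).trans (Finset.card_union_le _ _)
    simp only [hS, Finset.mem_filter] at hz1 hz2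
    omega

open Classical in
-- Double counting: each start has at most half of the pages as early ones, so some page is early
-- for at most half of the starts.
theorem exists_rarely_early (N : ℕ) (lab : ℕ → P) (Q M : Finset P) (hM : (Q \ M).Nonempty)
    (X : Finset ℕ) : ∃ q ∈ Q \ M, 2 * (X.filter fun x => Early N lab Q M x q).card ≤ X.card := by
  by_contra! hcon
  have h1 := Finset.sum_card_bipartiteAbove_eq_sum_card_bipartiteBelow (s := X) (t := Q \ M)
    (Early N lab Q M)
  have h2 : ∑ x ∈ X, 2 * ((Q \ M).bipartiteAbove (Early N lab Q M) x).card ≤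
      X.card * (Q \ M).card := by
    rw [← smul_eq_mul]
    exact Finset.sum_le_card_nsmul _ _ _ fun x _ => card_early_le N lab Q M x
  have h3 : ∑ _q ∈ Q \ M, X.card <
      ∑ q ∈ Q \ M, 2 * (X.bipartiteBelow (Early N lab Q M) q).card :=
    Finset.sum_lt_sum_of_nonempty hM fun q hq => hcon q hq
  rw [← Finset.mul_sum, h1, Finset.mul_sum] at h2
  rw [Finset.sum_const, smul_eq_mul, mul_comm] at h3
  omega

/-- On a labeled path with `N` vertices and `k + 1` pages, the page that is evicted at a fault can
be chosen such that the next fault of the phase reveals a fraction of the missing pages or of the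
possible positions. -/
theorem detRatio_pathExt_le (hk : 0 < k) (N : ℕ) (lab : ℕ → P) (Q : Finset P)
    (hQ : Q.card = k + 1) (hlab : ∀ x < N, lab x ∈ Q) :
    detRatio (pathExt N lab) k ≤ ((Nat.log 2 ((k + 1) ^ 3 * N) + 2 : ℕ) : ℝ≥0∞) := by
  classical
  have hex : ∀ h : List P, ∃ q, q ∈ Q ∧ q ∉ (phases k h).2.toFinset ∧
      2 * ((starts N lab (phases k h).2).filter fun x =>
        Early N lab Q (phases k h).2.toFinset x q).card ≤ (starts N lab (phases k h).2).card := by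
    intro h
    have hM : (Q \ (phases k h).2.toFinset).Nonempty := by
      rw [← Finset.card_pos]
      have := Finset.le_card_sdiff (phases k h).2.toFinset Q
      have := phases_list_card hk h
      omega
    obtain ⟨q, hq, h2⟩ := exists_rarely_early N lab Q _ hM (starts N lab (phases k h).2)
    exact ⟨q, (Finset.mem_sdiff.1 hq).1, (Finset.mem_sdiff.1 hq).2, h2⟩
  choose e he using hex
  -- The exponent 3 makes the loss of a quarter of the missing pages count as a halving, since
  -- `(3/4) ^ 3 < 1/2`. The logarithm then drops by one at each fault within a phase.
  set rank : List P → ℕ := fun h =>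
    Nat.log 2 ((Q \ (phases k h).2.toFinset).card ^ 3 * (starts N lab (phases k h).2).card)
  set L := Nat.log 2 ((k + 1) ^ 3 * N) + 1 with hL
  have rank_lt : ∀ h, rank h < L := by
    intro h
    refine Nat.lt_succ_of_le (Nat.log_mono_right (Nat.mul_le_mul (Nat.pow_le_pow_left ?_ 3) ?_))
    · rw [← hQ]; exact Finset.card_le_card Finset.sdiff_subset
    · exact (Finset.card_filter_le _ _).trans (by simp)
  have okQ : ∀ σ ∈ (pathExt N lab).requests, ∀ p ∈ σ, p ∈ Q := by
    intro σ hσ p hp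
    obtain ⟨vs, hN, -, rfl⟩ := mem_requests_pathExt.1 hσ
    obtain ⟨v, hv, rfl⟩ := List.mem_map.1 hp
    exact hlab v (hN v hv)
  have main := lazyAlg_faults hk Q hQ (pathExt N lab).requests
    (fun σ τ h => requests_append_left h) okQ e rank (fun h => (phases k h).1) L
    (fun h => (rank_lt h).le) phases_fst_le ?_ ?_
  · refine iInf_le_of_le (lazyAlg hk e) (sInf_le fun σ hσ => ?_)
    rw [detCost, ← Nat.cast_mul, Nat.cast_le]
    have hopt := card_toFinset_le_opt hk σ
    rcases main σ hσ with h | ⟨h1, h2⟩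
    · rw [h]; nlinarith
    · have hz : (phases k σ).1 ≠ 0 := fun h => by
        have := card_le_of_phases_eq_zero hk h
        omega
      have h3 := phases_add_le_opt hk σ hz
      have h4 : L * ((phases k σ).1 + 1) ≤ L * opt k σ := Nat.mul_le_mul_left _ (by omega)
      have h5 : (Nat.log 2 ((k + 1) ^ 3 * N) + 2) * opt k σ = L * opt k σ + opt k σ := by
        rw [hL]; ring
      rw [h5]
      omega
  · intro h p hok
    refine ⟨(he _).1, fun heq => (he (h ++ [p])).2.1 ?_⟩
    rw [heq, List.mem_toFinset]
    exact mem_phases_list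
  · intro h τ hne hok hτ
    set q := e h with hq
    have hlt := rank_lt (h ++ τ ++ [q])
    rw [List.append_assoc] at hok hlt ⊢
    -- A new phase raises `L * Z` by at least `L`, more than any rank; only faults within one phase
    -- need an argument.
    rcases phases_append (k := k) h (τ ++ [q]) with hlt' | ⟨heq, hs⟩
    · have : L * ((phases k h).1 + 1) ≤ L * (phases k (h ++ (τ ++ [q]))).1 :=
        Nat.mul_le_mul_left _ hlt'
      rw [Nat.mul_add] at this
      omega
    · rw [heq]
      refine Nat.add_le_add_right ?_ _
      obtain ⟨-, -, hrare⟩ := he h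
      rw [← hq] at hrare
      have hsne := phases_list_ne_nil (k := k) hne
      have hXsub : starts N lab (phases k (h ++ (τ ++ [q]))).2 ⊆ starts N lab (phases k h).2 := by
        rw [hs]; exact starts_append_subset hsne _
      have hXne : (starts N lab (phases k (h ++ (τ ++ [q]))).2).Nonempty :=
        starts_nonempty_of_suffix hok (phases_list_suffix _) (phases_list_ne_nil (by simp))
      have hcard' := phases_list_card hk (h ++ (τ ++ [q]))
      have hMM : (phases k h).2.toFinset ⊆ (phases k (h ++ (τ ++ [q]))).2.toFinset := by
        rw [hs, List.toFinset_append]; exact Finset.subset_union_left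
      have hqM' : q ∈ (phases k (h ++ (τ ++ [q]))).2.toFinset := by rw [hs]; simp
      have hM'Q : (phases k (h ++ (τ ++ [q]))).2.toFinset ⊆ Q := fun p hp =>
        okQ _ hok p ((phases_list_suffix _).subset (List.mem_toFinset.1 hp))
      simp only [rank]
      generalize hsM : (phases k h).2 = s at *
      generalize hsM' : (phases k (h ++ (τ ++ [q]))).2 = s' at *
      have hu' : 0 < (Q \ s'.toFinset).card := by
        have := Finset.le_card_sdiff s'.toFinset Q
        omega
      have huu : (Q \ s.toFinset).card = (Q \ s'.toFinset).card + (s'.toFinset \ s.toFinset).card := by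
        rw [← Finset.card_union_of_disjoint]
        · congr 1
          ext p
          simp only [Finset.mem_sdiff, Finset.mem_union]
          have := @hMM p
          have := @hM'Q p
          tauto
        · rw [Finset.disjoint_left]
          intro p hp hp'
          exact (Finset.mem_sdiff.1 hp).2 (Finset.mem_sdiff.1 hp').1
      have hX0 := hXne.card_pos
      rw [← Nat.log_mul_base (by norm_num) (by positivity)]
      refine Nat.log_mono_right ?_
      -- If few new pages were seen, the interval visited from a possible start `x` witnesses that
      -- `q` is early for `x`, so at most half of the starts survive. Otherwise fewer than three
      -- quarters of the missing pages remain.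
      by_cases hc : 4 * (s'.toFinset \ s.toFinset).card ≤ (Q \ s.toFinset).card
      · have hsub : starts N lab s' ⊆ (starts N lab s).filter
            fun x => Early N lab Q s.toFinset x q := by
          intro x hx
          refine Finset.mem_filter.2 ⟨hXsub hx, ?_⟩
          obtain ⟨l, r, h1, h2, h3, h4⟩ := exists_interval_of_mem_starts hx
          exact ⟨l, r, h1, h2, h3, h4 ▸ hqM', h4 ▸ hc⟩
        have h1 := Finset.card_le_card hsub
        have h2 : (Q \ s'.toFinset).card ^ 3 ≤ (Q \ s.toFinset).card ^ 3 :=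
          Nat.pow_le_pow_left (by omega) 3
        calc (Q \ s'.toFinset).card ^ 3 * (starts N lab s').card * 2
            = (Q \ s'.toFinset).card ^ 3 * (2 * (starts N lab s').card) := by ring
          _ ≤ _ := Nat.mul_le_mul h2 (by omega)
      · have h1 := Finset.card_le_card hXsub
        have h2 : (4 * (Q \ s'.toFinset).card) ^ 3 ≤ (3 * (Q \ s.toFinset).card) ^ 3 :=
          Nat.pow_le_pow_left (by omega) 3
        rw [mul_pow, mul_pow] at h2
        calc (Q \ s'.toFinset).card ^ 3 * (starts N lab s').card * 2
            = (2 * (Q \ s'.toFinset).card ^ 3) * (starts N lab s').card := by ring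
          _ ≤ _ := Nat.mul_le_mul (by omega) h1

end DetUpper

/-- Two possible successors of a position are at distance at most two, so their labels tell them
apart. -/
theorem walk_unique {P : Type} {N : ℕ} {lab : ℕ → P}
    (hΔ : ∀ x y, x < y → y < N → lab x = lab y → x + 3 ≤ y) {vs : List ℕ} :
    ∀ {ws : List ℕ}, (∀ v ∈ vs, v < N) → (∀ v ∈ ws, v < N) → vs.IsChain Near → ws.IsChain Near →
      vs.head? = ws.head? → vs.map lab = ws.map lab → vs = ws := by
  induction vs with
  | nil =>
    intro ws _ _ _ _ _ h
    simpa using h.symm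
  | cons x vs ih =>
    intro ws hv hw hcv hcw hh hl
    cases ws with
    | nil => simp at hl
    | cons x' ws =>
      obtain rfl : x = x' := by simpa using hh
      simp only [List.map_cons, List.cons.injEq, true_and] at hl
      congr 1
      refine ih (fun v h => hv v (by simp [h])) (fun v h => hw v (by simp [h])) hcv.tail hcw.tail
        ?_ hl
      cases vs with
      | nil => cases ws with
        | nil => rfl
        | cons y' ws => simp at hl
      | cons y vs => cases ws with
        | nil => simp at hl
        | cons y' ws =>
          simp only [List.map_cons, List.cons.injEq] at hl
          have h1 := (List.isChain_cons_cons.1 hcv).1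
          have h2 := (List.isChain_cons_cons.1 hcw).1
          rw [Near] at h1 h2
          have hy := hv y (by simp)
          have hy' := hw y' (by simp)
          simp only [List.head?_cons, Option.some_inj]
          rcases lt_trichotomy y y' with h | h | h
          · have := hΔ _ _ h hy' hl.1; omega
          · exact h
          · have := hΔ _ _ h hy hl.1.symm; omega

/-! ### Following a guessed start: from a game on intervals to a strategy -/

section Tracking

variable {P : Type} [DecidableEq P] {k : ℕ}

/-- `Win N lab Q k n I`: if a fault occurs when the positions `I` have been visited during the
current phase, the evicted pages can be chosen such that the phase has fewer than `n` further
faults. -/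
def Win (N : ℕ) (lab : ℕ → P) (Q : Finset P) (k : ℕ) : ℕ → Finset ℕ → Prop
  | 0, _ => False
  | n + 1, I => ∃ q ∈ Q, q ∉ I.image lab ∧ ∀ l r, I ⊆ Finset.Icc l r → r < N →
      q ∈ (Finset.Icc l r).image lab → ((Finset.Icc l r).image lab).card ≤ k →
      Win N lab Q k n (Finset.Icc l r)

theorem Win.succ {N : ℕ} {lab : ℕ → P} {Q : Finset P} {n : ℕ} :
    ∀ {I : Finset ℕ}, Win N lab Q k n I → Win N lab Q k (n + 1) I := by
  induction n with
  | zero => intro I h; exact h.elim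
  | succ n ih =>
    rintro I ⟨q, hq, hqI, h⟩
    exact ⟨q, hq, hqI, fun l r h1 h2 h3 h4 => ih (h l r h1 h2 h3 h4)⟩

theorem Win.of_le {N : ℕ} {lab : ℕ → P} {Q : Finset P} {n m : ℕ} {I : Finset ℕ}
    (h : Win N lab Q k n I) (hnm : n ≤ m) : Win N lab Q k m I := by
  induction hnm with
  | refl => exact h
  | step _ ih => exact ih.succ

/-- The page to be evicted at `I` is either still unseen in the larger interval, or the larger
interval is already a legal answer to its eviction. -/
theorem Win.mono {N : ℕ} {lab : ℕ → P} {Q : Finset P} {n : ℕ} {I : Finset ℕ}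
    (h : Win N lab Q k n I) {l r : ℕ} (hI : I ⊆ Finset.Icc l r) (hr : r < N)
    (hc : ((Finset.Icc l r).image lab).card ≤ k) : Win N lab Q k n (Finset.Icc l r) := by
  cases n with
  | zero => exact h.elim
  | succ n =>
    obtain ⟨q, hq, hqI, h⟩ := h
    by_cases hq' : q ∈ (Finset.Icc l r).image lab
    · exact (h l r hI hr hq' hc).succ
    · exact ⟨q, hq, hq', fun l' r' h1 => h l' r' (hI.trans h1)⟩

/-- If equal labels on a path have distance at least three, the position is known once the start
is known, and a strategy that follows the first possible start has few faults. -/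
theorem detRatio_pathExt_le_of_win (hk : 0 < k) (N : ℕ) (lab : ℕ → P) (Q : Finset P)
    (hQ : Q.card = k + 1) (hlab : ∀ x < N, lab x ∈ Q)
    (hΔ : ∀ x y, x < y → y < N → lab x = lab y → x + 3 ≤ y)
    (hm : ∀ p, ((Finset.range N).filter fun x => lab x = p).card ≤ k + 1)
    (L : ℕ) (hwin : ∀ x < N, Win N lab Q k L {x}) :
    detRatio (pathExt N lab) k ≤ ((2 * L + 1 : ℕ) : ℝ≥0∞) := by
  classical
  have hwalk : ∀ (x : ℕ) (h : List P), ∃ vs : List ℕ, x ∈ starts N lab h →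
      (∀ v ∈ vs, v < N) ∧ vs.IsChain Near ∧ vs.head? = some x ∧ vs.map lab = h := by
    intro x h
    by_cases hx : x ∈ starts N lab h
    · obtain ⟨vs, hvs⟩ := mem_starts.1 hx
      exact ⟨vs, fun _ => hvs⟩
    · exact ⟨[], fun h => absurd h hx⟩
  choose walk hwalk using hwalk
  -- The strategy believes in the smallest start compatible with all requests so far; `vis` collects
  -- the positions that the believed walk visits in the current phase.
  set cand : List P → ℕ := fun h => sInf {x | x ∈ starts N lab h} with hcand
  set vis : List P → Finset ℕ := fun h =>
    ((walk (cand h) h).drop (h.length - (phases k h).2.length)).toFinset with hvis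
  set rank : List P → ℕ := fun h => min L (sInf {n | Win N lab Q k n (vis h)}) with hrank
  -- A refuted start is charged like a completed phase. There are at most `k + 1` of them, while the
  -- optimum is at least `k` plus the number of phases; hence the factor 2 in front of `L`.
  set fail : List P → Finset ℕ := fun h =>
    (Finset.range N).filter fun x => h.head? = some (lab x) ∧ x ∉ starts N lab h with hfail
  have cand_mem : ∀ h ∈ (pathExt N lab).requests, h ≠ [] → cand h ∈ starts N lab h := by
    intro h hok hne
    exact Nat.sInf_mem (s := {x | x ∈ starts N lab h})
      (starts_nonempty_of_suffix hok List.suffix_rfl hne)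
  have vis_eq : ∀ h ∈ (pathExt N lab).requests, h ≠ [] →
      (∃ l r, vis h = Finset.Icc l r ∧ l ≤ r ∧ r < N) ∧
        (vis h).image lab = (phases k h).2.toFinset := by
    intro h hok hne
    obtain ⟨h1, h2, -, h4⟩ := hwalk _ _ (cand_mem h hok hne)
    set vs := walk (cand h) h
    set d := h.length - (phases k h).2.length with hd
    have hdrop : (vs.drop d).map lab = (phases k h).2 := by
      rw [List.map_drop, h4]
      exact (List.suffix_iff_eq_drop.1 (phases_list_suffix h)).symm
    have hne' : vs.drop d ≠ [] := by
      intro h0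
      rw [h0] at hdrop
      exact phases_list_ne_nil hne hdrop.symm
    have himg : (vis h).image lab = (phases k h).2.toFinset := by
      have hv : vis h = (vs.drop d).toFinset := rfl
      rw [← hdrop, hv]
      ext x
      simp only [Finset.mem_image, List.mem_toFinset, List.mem_map]
    obtain ⟨l, r, hlr⟩ := exists_toFinset_eq_Icc hne' (h2.drop d)
    have hlr' : l ≤ r := by
      obtain ⟨y, hy⟩ := List.exists_mem_of_ne_nil _ hne'
      rw [← List.mem_toFinset, hlr, Finset.mem_Icc] at hy
      omega
    refine ⟨⟨l, r, hlr, hlr', h1 r (List.mem_of_mem_drop (i := d) ?_)⟩, himg⟩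
    rw [← List.mem_toFinset, hlr, Finset.mem_Icc]
    exact ⟨hlr', le_rfl⟩
  have win_vis : ∀ h ∈ (pathExt N lab).requests, h ≠ [] → Win N lab Q k L (vis h) := by
    intro h hok hne
    obtain ⟨⟨l, r, h1, h2, h3⟩, h4⟩ := vis_eq h hok hne
    have hc := phases_list_card hk h
    rw [← h4, h1] at hc
    rw [h1]
    exact (hwin r h3).mono (by simp [h2]) h3 hc
  have win_rank : ∀ h ∈ (pathExt N lab).requests, h ≠ [] → Win N lab Q k (rank h) (vis h) := by
    intro h hok hne
    have h1 := win_vis h hok hne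
    have h2 : rank h = sInf {n | Win N lab Q k n (vis h)} := min_eq_right (Nat.sInf_le h1)
    rw [h2]
    exact Nat.sInf_mem (s := {n | Win N lab Q k n (vis h)}) ⟨L, h1⟩
  have hex : ∀ h : List P, ∃ q, h ∈ (pathExt N lab).requests → h ≠ [] →
      0 < rank h ∧ q ∈ Q ∧ q ∉ (vis h).image lab ∧ ∀ l r, vis h ⊆ Finset.Icc l r → r < N →
        q ∈ (Finset.Icc l r).image lab → ((Finset.Icc l r).image lab).card ≤ k →
        Win N lab Q k (rank h - 1) (Finset.Icc l r) := by
    intro h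
    by_cases hh : h ∈ (pathExt N lab).requests ∧ h ≠ []
    · have h1 := win_rank h hh.1 hh.2
      cases hr : rank h with
      | zero => rw [hr] at h1; exact h1.elim
      | succ n =>
        rw [hr] at h1
        obtain ⟨q, hq⟩ := h1
        exact ⟨q, fun _ _ => ⟨by omega, hq⟩⟩
    · have hQne : Q.Nonempty := by rw [← Finset.card_pos]; omega
      exact ⟨hQne.choose, fun h1 h2 => absurd ⟨h1, h2⟩ hh⟩
  choose e he using hex
  have okQ : ∀ σ ∈ (pathExt N lab).requests, ∀ p ∈ σ, p ∈ Q := by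
    intro σ hσ p hp
    obtain ⟨vs, hN, -, rfl⟩ := mem_requests_pathExt.1 hσ
    obtain ⟨v, hv, rfl⟩ := List.mem_map.1 hp
    exact hlab v (hN v hv)
  have fail_mono : ∀ σ τ, fail σ ⊆ fail (σ ++ τ) := by
    intro σ τ x hx
    simp only [hfail, Finset.mem_filter] at hx ⊢
    have hne : σ ≠ [] := by rintro rfl; simp at hx
    refine ⟨hx.1, ?_, fun h => hx.2.2 (starts_append_subset hne τ h)⟩
    rw [List.head?_append_of_ne_nil _ hne]; exact hx.2.1
  have fail_card : ∀ σ, (fail σ).card ≤ k + 1 := by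
    intro σ
    cases σ with
    | nil => simp [hfail]
    | cons p σ =>
      refine (Finset.card_le_card fun x hx => ?_).trans (hm p)
      simp only [hfail, Finset.mem_filter, List.head?_cons, Option.some_inj] at hx ⊢
      exact ⟨hx.1, hx.2.1.symm⟩
  have main := lazyAlg_faults hk Q hQ (pathExt N lab).requests
    (fun σ τ h => requests_append_left h) okQ e rank
    (fun h => (phases k h).1 + (fail h).card) L
    (fun h => min_le_left _ _)
    (fun σ τ => Nat.add_le_add (phases_fst_le σ τ) (Finset.card_le_card (fail_mono σ τ))) ?_ ?_
  · refine iInf_le_of_le (lazyAlg hk e) (sInf_le fun σ hσ => ?_)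
    rw [detCost, ← Nat.cast_mul, Nat.cast_le]
    have hopt := card_toFinset_le_opt hk σ
    rcases main σ hσ with h | ⟨h1, h2⟩
    · rw [h]; nlinarith
    · have hz : (phases k σ).1 ≠ 0 := fun h => by
        have := card_le_of_phases_eq_zero hk h
        omega
      have h3 := phases_add_le_opt hk σ hz
      have h6 := fail_card σ
      have h4 : L * ((phases k σ).1 + (fail σ).card + 1) ≤ L * (2 * opt k σ) :=
        Nat.mul_le_mul_left _ (by omega)
      have h5 : (2 * L + 1) * opt k σ = L * (2 * opt k σ) + opt k σ := by ring
      rw [h5]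
      omega
  · intro h p hok
    have h1 := he (h ++ [p]) hok (by simp)
    refine ⟨h1.2.1, fun heq => h1.2.2.1 ?_⟩
    rw [(vis_eq _ hok (by simp)).2, heq, List.mem_toFinset]
    exact mem_phases_list
  · intro h τ hne hok hτ
    set q := e h with hq
    rw [List.append_assoc] at hok ⊢
    have hokh : h ∈ (pathExt N lab).requests := requests_append_left hok
    obtain ⟨hpos, -, -, hnext⟩ := he h hokh hne
    set h' := h ++ (τ ++ [q]) with hh'
    have hne' : h' ≠ [] := by simp [hh']
    have hL' : rank h' ≤ L := min_le_left _ _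
    have hfc := Finset.card_le_card (fail_mono h (τ ++ [q]))
    have hpm := phases_fst_le (k := k) h (τ ++ [q])
    have hpa := phases_append (k := k) h (τ ++ [q])
    rw [← hh'] at hfc hpm hpa
    by_cases hZ : (phases k h).1 + (fail h).card < (phases k h').1 + (fail h').card
    · have : L * ((phases k h).1 + (fail h).card + 1) ≤ L * ((phases k h').1 + (fail h').card) :=
        Nat.mul_le_mul_left _ hZ
      rw [Nat.mul_add] at this
      omega
    · have hph : (phases k h').1 = (phases k h).1 := by omega
      have hfcard : (fail h').card = (fail h).card := by omega
      have hfeq : fail h = fail h' :=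
        Finset.eq_of_subset_of_card_le (fail_mono h (τ ++ [q])) hfcard.le
      have hs : (phases k h').2 = (phases k h).2 ++ (τ ++ [q]) := by
        rcases hpa with h1 | h1
        · omega
        · exact h1.2
      -- If no start has been refuted since `h`, the believed start is the same, and by
      -- `walk_unique` the old walk is a prefix of the new one. The visited set has only grown, so
      -- the game continues.
      have hstarts : starts N lab h = starts N lab h' := by
        refine Finset.Subset.antisymm (fun x hx => ?_) (starts_append_subset hne _)
        by_contra hx'
        have hx2 := hx
        obtain ⟨vs, hN, -, hhd, hmap⟩ := mem_starts.1 hx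
        have : x ∈ fail h' := by
          refine Finset.mem_filter.2 ⟨Finset.mem_range.2 (hN x (List.mem_of_mem_head? hhd)), ?_, hx'⟩
          rw [hh', List.head?_append_of_ne_nil _ hne, ← hmap, List.head?_map, hhd]; rfl
        rw [← hfeq] at this
        exact (Finset.mem_filter.1 this).2.2 hx2
      have hc : cand h' = cand h := by simp only [hcand, hstarts]
      have hcm := cand_mem h hokh hne
      obtain ⟨a1, a2, a3, a4⟩ := hwalk _ _ hcm
      obtain ⟨b1, b2, b3, b4⟩ := hwalk _ _ (hstarts ▸ hcm : cand h ∈ starts N lab h')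
      obtain ⟨v1, v2, hv, c1, -⟩ := List.map_eq_append_iff.1 b4
      have hv1 : v1 ≠ [] := by rintro rfl; exact hne (by simpa using c1.symm)
      have huniq : walk (cand h) h = v1 := by
        refine walk_unique hΔ a1 (fun v h => b1 v (by rw [hv]; simp [h])) a2
          (by rw [hv] at b2; exact b2.left_of_append) ?_ (a4.trans c1.symm)
        rw [a3, ← b3, hv, List.head?_append_of_ne_nil _ hv1]
      have hsub : vis h ⊆ vis h' := by
        have hlen : h'.length - (phases k h').2.length = h.length - (phases k h).2.length := by
          rw [hs, hh', List.length_append, List.length_append (as := (phases k h).2)]; omega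
        simp only [hvis]
        rw [hlen, hc, hv, huniq]
        intro x hx
        rw [List.mem_toFinset] at hx ⊢
        rw [List.drop_append]
        exact List.mem_append_left _ hx
      obtain ⟨⟨l, r, d1, d2, d3⟩, d4⟩ := vis_eq h' hok hne'
      have hcard := phases_list_card hk h'
      rw [← d4, d1] at hcard
      have hqm : q ∈ (Finset.Icc l r).image lab := by
        rw [← d1, d4, hs]; simp
      have hw := hnext l r (d1 ▸ hsub) d3 hqm hcard
      rw [← d1] at hw
      have : rank h' ≤ rank h - 1 := (min_le_right _ _).trans (Nat.sInf_le hw)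
      rw [hph, hfcard]
      omega

end Tracking

/-! ### Random permutations and the search game on corners -/

section Perm

open Equiv

theorem sum_perm_mul_swap {M : Type*} [AddCommMonoid M] {n : ℕ} (S : Finset (Perm (Fin n)))
    (i j : Fin n) (hS : ∀ σ ∈ S, σ * swap i j ∈ S) (φ : Perm (Fin n) → M) :
    ∑ σ ∈ S, φ (σ * swap i j) = ∑ σ ∈ S, φ σ := by
  refine Finset.sum_nbij' (fun σ => σ * swap i j) (fun σ => σ * swap i j) hS hS ?_ ?_ ?_
  · intro σ _; simp [mul_assoc]
  · intro σ _; simp [mul_assoc]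
  · intro σ _; rfl

/-- The permutations that map `S` into `T`. -/
def permsInto {n : ℕ} (S T : Finset (Fin n)) : Finset (Perm (Fin n)) :=
  Finset.univ.filter fun σ => ∀ x ∈ S, σ x ∈ T

/-- Among the permutations that map `S` into `T`, all arguments outside `S` are equally likely to be
mapped into `T`, by composition with transpositions. Hence the conditional probability for `x` is
`(|T| - |S|) / (n - |S|)`, which is at most `|T| / n`. -/
theorem card_permsInto_insert {n : ℕ} (S T : Finset (Fin n)) {x : Fin n} (hx : x ∉ S) :
    n * (permsInto (insert x S) T).card ≤ T.card * (permsInto S T).card := by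
  have h1 : ∀ y ∈ Finset.univ \ S, ((permsInto S T).filter fun σ => σ y ∈ T).card =
      (permsInto (insert x S) T).card := by
    intro y hy
    have hy : y ∉ S := by simpa using hy
    have hcl : ∀ σ ∈ permsInto S T, σ * swap x y ∈ permsInto S T := by
      intro σ hσ
      simp only [permsInto, Finset.mem_filter, Finset.mem_univ, true_and] at hσ ⊢
      intro z hz
      rw [Perm.mul_apply, swap_apply_of_ne_of_ne]
      · exact hσ z hz
      · rintro rfl; exact hx hz
      · rintro rfl; exact hy hz
    have := sum_perm_mul_swap (permsInto S T) x y hcl fun σ => if σ y ∈ T then 1 else 0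
    rw [Finset.card_filter, ← this]
    simp only [Perm.mul_apply, swap_apply_right]
    rw [← Finset.card_filter]
    congr 1
    ext σ
    simp only [permsInto, Finset.mem_filter, Finset.mem_univ, true_and, Finset.mem_insert,
      forall_eq_or_imp]
    exact and_comm
  have h2 : ∀ σ ∈ permsInto S T, ((Finset.univ \ S).filter fun y => σ y ∈ T).card + S.card =
      T.card := by
    intro σ hσ
    simp only [permsInto, Finset.mem_filter, Finset.mem_univ, true_and] at hσ
    rw [← Finset.card_union_of_disjoint]
    · rw [← Finset.card_map (f := σ.toEmbedding)]
      congr 1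
      ext y
      simp only [Finset.mem_map, Finset.mem_union, Finset.mem_filter, Finset.mem_sdiff,
        Finset.mem_univ, true_and, Equiv.coe_toEmbedding]
      constructor
      · rintro ⟨z, h | h, rfl⟩
        · exact h.2
        · exact hσ z h
      · intro hy
        refine ⟨σ.symm y, ?_, by simp⟩
        by_cases h : σ.symm y ∈ S
        · exact Or.inr h
        · left; simpa [h] using hy
    · rw [Finset.disjoint_left]
      intro y hy hy'
      simp [hy'] at hy
  have h3 : (n - S.card) * (permsInto (insert x S) T).card =
      (T.card - S.card) * (permsInto S T).card := by
    have e1 : ∑ y ∈ Finset.univ \ S, ((permsInto S T).filter fun σ => σ y ∈ T).card =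
        (n - S.card) * (permsInto (insert x S) T).card := by
      rw [Finset.sum_congr rfl h1, Finset.sum_const, smul_eq_mul,
        Finset.card_sdiff_of_subset (Finset.subset_univ _), Finset.card_univ, Fintype.card_fin]
    have e2 : ∑ σ ∈ permsInto S T, ((Finset.univ \ S).filter fun y => σ y ∈ T).card =
        (T.card - S.card) * (permsInto S T).card := by
      rw [Finset.sum_congr rfl fun σ hσ => Nat.eq_sub_of_add_eq (h2 σ hσ), Finset.sum_const,
        smul_eq_mul, mul_comm]
    rw [← e1, ← e2]
    simp only [Finset.card_filter]
    exact Finset.sum_comm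
  have hSn : S.card < n := by
    have := Finset.card_lt_univ_of_notMem hx
    simpa using this
  have hTn : T.card ≤ n := by simpa using Finset.card_le_univ T
  by_cases hemp : (permsInto S T).card = 0
  · rw [hemp, Nat.mul_zero] at h3
    rcases Nat.mul_eq_zero.1 h3 with h | h
    · omega
    · simp [h]
  · obtain ⟨σ, hσ⟩ := Finset.card_pos.1 (Nat.pos_of_ne_zero hemp)
    have hST := h2 σ hσ
    have hle : S.card ≤ T.card := by omega
    refine le_of_mul_le_mul_left ?_ (Nat.sub_pos_of_lt hSn)
    calc (n - S.card) * (n * (permsInto (insert x S) T).card)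
        = n * ((n - S.card) * (permsInto (insert x S) T).card) := by ring
      _ = (n * (T.card - S.card)) * (permsInto S T).card := by rw [h3]; ring
      _ ≤ ((n - S.card) * T.card) * (permsInto S T).card := by
        refine Nat.mul_le_mul_right _ ?_
        zify [hle, hSn.le]
        nlinarith
      _ = _ := by ring

theorem card_permsInto_le {n : ℕ} (S T : Finset (Fin n)) :
    n ^ S.card * (permsInto S T).card ≤ T.card ^ S.card * n.factorial := by
  induction S using Finset.induction_on with
  | empty =>
    simp only [Finset.card_empty, pow_zero, one_mul]
    refine (Finset.card_le_univ _).trans ?_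
    rw [Fintype.card_perm, Fintype.card_fin]
  | insert x S hx ih =>
    rw [Finset.card_insert_of_notMem hx, pow_succ, pow_succ]
    have := card_permsInto_insert S T hx
    calc n ^ S.card * n * (permsInto (insert x S) T).card
        = n ^ S.card * (n * (permsInto (insert x S) T).card) := by ring
      _ ≤ n ^ S.card * (T.card * (permsInto S T).card) := Nat.mul_le_mul_left _ this
      _ = T.card * (n ^ S.card * (permsInto S T).card) := by ring
      _ ≤ T.card * (T.card ^ S.card * n.factorial) := Nat.mul_le_mul_left _ ih
      _ = _ := by ring

theorem card_permsInto_le_real {n : ℕ} (hn : 0 < n) (S T : Finset (Fin n)) :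
    ((permsInto S T).card : ℝ) ≤ ((T.card : ℝ) / n) ^ S.card * n.factorial := by
  have h : (n : ℝ) ^ S.card * (permsInto S T).card ≤ T.card ^ S.card * n.factorial := by
    exact_mod_cast card_permsInto_le S T
  rw [div_pow, div_mul_eq_mul_div, le_div_iff₀ (by positivity), mul_comm]
  exact h

/-- The elements that are among the first `a` of `α` and among the last `c` of `β`. -/
def corner {f : ℕ} (α β : Perm (Fin (f + 1))) (a c : ℕ) : Finset (Fin (f + 1)) :=
  Finset.univ.filter fun p => (α⁻¹ p : ℕ) < a ∧ f + 1 ≤ (β⁻¹ p : ℕ) + c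

theorem mem_corner {f : ℕ} {α β : Perm (Fin (f + 1))} {a c : ℕ} {p : Fin (f + 1)} :
    p ∈ corner α β a c ↔ (α⁻¹ p : ℕ) < a ∧ f + 1 ≤ (β⁻¹ p : ℕ) + c := by
  simp [corner]

theorem corner_subset {f : ℕ} (α β : Perm (Fin (f + 1))) {a c a' c' : ℕ} (ha : a' ≤ a)
    (hc : c' ≤ c) : corner α β a' c' ⊆ corner α β a c := by
  intro p hp
  rw [mem_corner] at hp ⊢
  omega

theorem card_filter_perm_lt {f : ℕ} (α : Perm (Fin (f + 1))) {a : ℕ} (ha : a ≤ f + 1) :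
    (Finset.univ.filter fun p => (α⁻¹ p : ℕ) < a).card = a := by
  rw [← Finset.card_map (f := (α⁻¹).toEmbedding)]
  have : (Finset.univ.filter fun p => (α⁻¹ p : ℕ) < a).map (α⁻¹).toEmbedding =
      Finset.univ.filter fun j : Fin (f + 1) => (j : ℕ) < a := by
    ext j
    simp only [Finset.mem_map, Finset.mem_filter, Finset.mem_univ, true_and,
      Equiv.coe_toEmbedding]
    constructor
    · rintro ⟨p, hp, rfl⟩; exact hp
    · intro hj; exact ⟨α j, by simpa using hj, by simp⟩
  rw [this, Fin.card_filter_val_lt, min_eq_right ha]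

theorem card_filter_inv_into {f : ℕ} (S T : Finset (Fin (f + 1))) :
    (Finset.univ.filter fun β : Perm (Fin (f + 1)) => ∀ p ∈ S, β⁻¹ p ∈ T).card =
      (permsInto S T).card := by
  refine Finset.card_bij' (fun β _ => β⁻¹) (fun β _ => β⁻¹) ?_ ?_ ?_ ?_
  · intro β hβ
    simp only [permsInto, Finset.mem_filter, Finset.mem_univ, true_and] at hβ ⊢
    exact hβ
  · intro β hβ
    simp only [permsInto, Finset.mem_filter, Finset.mem_univ, true_and, inv_inv] at hβ ⊢
    exact hβ
  · intro β _; simp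
  · intro β _; simp

/-- If the corner is empty, `β⁻¹` maps the first `a` entries of `α` to the first `f + 1 - c`
positions, an event of probability at most `(1 - c / (f + 1)) ^ a`. -/
theorem card_corner_empty_le {f : ℕ} (α : Perm (Fin (f + 1))) {a c : ℕ} (ha : a ≤ f + 1)
    (hc : c ≤ f + 1) :
    ((Finset.univ.filter fun β : Perm (Fin (f + 1)) => corner α β a c = ∅).card : ℝ) ≤
      Real.exp (-((a : ℝ) * c / (f + 1 : ℕ))) * (f + 1).factorial := by
  set S := Finset.univ.filter fun p => (α⁻¹ p : ℕ) < a
  set T := Finset.univ.filter fun j : Fin (f + 1) => (j : ℕ) < f + 1 - c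
  have hS : S.card = a := card_filter_perm_lt α ha
  have hT : T.card = f + 1 - c := by
    rw [Fin.card_filter_val_lt, min_eq_right (Nat.sub_le _ _)]
  have h1 : (Finset.univ.filter fun β : Perm (Fin (f + 1)) => corner α β a c = ∅).card ≤
      (permsInto S T).card := by
    rw [← card_filter_inv_into]
    refine Finset.card_le_card fun β hβ => ?_
    simp only [Finset.mem_filter, Finset.mem_univ, true_and] at hβ ⊢
    intro p hp
    have hp' : (α⁻¹ p : ℕ) < a := by simpa [S] using hp
    have : p ∉ corner α β a c := by rw [hβ]; simp
    rw [mem_corner] at this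
    simp only [T, Finset.mem_filter, Finset.mem_univ, true_and]
    omega
  have h2 := card_permsInto_le_real (Nat.succ_pos f) S T
  refine (Nat.cast_le.2 h1).trans (h2.trans (mul_le_mul_of_nonneg_right ?_ (by positivity)))
  rw [hS, hT, Nat.cast_sub hc]
  have h3 : (((f + 1 : ℕ) : ℝ) - c) / ((f + 1 : ℕ) : ℝ) = 1 - c / (f + 1 : ℕ) := by
    rw [sub_div, div_self (by positivity)]
  have h4 : (1 - (c : ℝ) / (f + 1 : ℕ)) ≤ Real.exp (-((c : ℝ) / (f + 1 : ℕ))) := by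
    have := Real.add_one_le_exp (-((c : ℝ) / (f + 1 : ℕ)))
    linarith
  have h5 : 0 ≤ 1 - (c : ℝ) / (f + 1 : ℕ) := by
    rw [sub_nonneg, div_le_one (by positivity)]; exact_mod_cast hc
  rw [h3]
  refine (pow_le_pow_left₀ h5 h4 a).trans (le_of_eq ?_)
  rw [← Real.exp_nat_mul]
  congr 1
  ring

/-- Union bound over the `s`-element subsets of the first `a` entries of `α`, all of which would
have to be among the last `c` entries of `β`. -/
theorem card_corner_large_le {f : ℕ} (α : Perm (Fin (f + 1))) {a c : ℕ} (ha : a ≤ f + 1)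
    (hc : c ≤ f + 1) (s : ℕ) :
    ((Finset.univ.filter fun β : Perm (Fin (f + 1)) => s ≤ (corner α β a c).card).card : ℝ) ≤
      ((a : ℝ) * c / (f + 1 : ℕ)) ^ s / s.factorial * (f + 1).factorial := by
  set S := Finset.univ.filter fun p => (α⁻¹ p : ℕ) < a
  set T := Finset.univ.filter fun j : Fin (f + 1) => f + 1 ≤ (j : ℕ) + c
  have hS : S.card = a := card_filter_perm_lt α ha
  have hT : T.card = c := by
    have h1 : (Finset.univ.filter fun j : Fin (f + 1) => (j : ℕ) < f + 1 - c).card = f + 1 - c := by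
      rw [Fin.card_filter_val_lt, min_eq_right (Nat.sub_le _ _)]
    have h2 := Finset.card_filter_add_card_filter_not (s := (Finset.univ : Finset (Fin (f + 1))))
      (fun j : Fin (f + 1) => (j : ℕ) < f + 1 - c)
    have h3 : (Finset.univ.filter fun j : Fin (f + 1) => ¬ (j : ℕ) < f + 1 - c) = T := by
      ext j; simp only [T, Finset.mem_filter, Finset.mem_univ, true_and]; omega
    rw [h3, h1, Finset.card_univ, Fintype.card_fin] at h2
    omega
  have h1 : (Finset.univ.filter fun β : Perm (Fin (f + 1)) => s ≤ (corner α β a c).card).card ≤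
      ∑ S' ∈ S.powersetCard s, (permsInto S' T).card := by
    refine le_trans (Finset.card_le_card (t := (S.powersetCard s).biUnion fun S' =>
      Finset.univ.filter fun β : Perm (Fin (f + 1)) => ∀ p ∈ S', β⁻¹ p ∈ T) ?_) ?_
    · intro β hβ
      simp only [Finset.mem_filter, Finset.mem_univ, true_and] at hβ
      obtain ⟨S', hS', hcard⟩ := Finset.exists_subset_card_eq hβ
      simp only [Finset.mem_biUnion, Finset.mem_powersetCard, Finset.mem_filter, Finset.mem_univ,
        true_and]
      refine ⟨S', ⟨fun p hp => ?_, hcard⟩, fun p hp => ?_⟩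
      · simpa [S] using (mem_corner.1 (hS' hp)).1
      · simpa [T] using (mem_corner.1 (hS' hp)).2
    · refine Finset.card_biUnion_le.trans (le_of_eq ?_)
      exact Finset.sum_congr rfl fun S' _ => card_filter_inv_into S' T
  have h2 : ((∑ S' ∈ S.powersetCard s, (permsInto S' T).card : ℕ) : ℝ) ≤
      (a.choose s : ℝ) * (((c : ℝ) / (f + 1 : ℕ)) ^ s * (f + 1).factorial) := by
    rw [Nat.cast_sum]
    refine (Finset.sum_le_card_nsmul _ _ (((c : ℝ) / (f + 1 : ℕ)) ^ s * (f + 1).factorial)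
      fun S' hS' => ?_).trans (le_of_eq ?_)
    · have := card_permsInto_le_real (Nat.succ_pos f) S' T
      rwa [(Finset.mem_powersetCard.1 hS').2, hT] at this
    · rw [Finset.card_powersetCard, hS, nsmul_eq_mul]
  refine (Nat.cast_le.2 h1).trans (h2.trans ?_)
  have h3 : (a.choose s : ℝ) ≤ (a : ℝ) ^ s / s.factorial := Nat.choose_le_pow_div s a
  calc (a.choose s : ℝ) * (((c : ℝ) / (f + 1 : ℕ)) ^ s * (f + 1).factorial)
      ≤ (a : ℝ) ^ s / s.factorial * (((c : ℝ) / (f + 1 : ℕ)) ^ s * (f + 1).factorial) :=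
        mul_le_mul_of_nonneg_right h3 (by positivity)
    _ = _ := by rw [mul_div_assoc, mul_pow]; ring

/-- `PairWin α β n a c`: with `n` faults one can search the elements of `corner α β a c`, where the
search of an element `q` removes the elements after `q` in `α` or those before `q` in `β`. -/
def PairWin {f : ℕ} (α β : Perm (Fin (f + 1))) : ℕ → ℕ → ℕ → Prop
  | 0, a, c => corner α β a c = ∅
  | n + 1, a, c => corner α β a c = ∅ ∨ ∃ q ∈ corner α β a c,
      PairWin α β n (α⁻¹ q : ℕ) c ∧ PairWin α β n a (f - (β⁻¹ q : ℕ))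

theorem PairWin.succ {f : ℕ} {α β : Perm (Fin (f + 1))} {n : ℕ} :
    ∀ {a c : ℕ}, PairWin α β n a c → PairWin α β (n + 1) a c := by
  induction n with
  | zero => intro a c h; exact Or.inl h
  | succ n ih =>
    rintro a c (h | ⟨q, hq, h1, h2⟩)
    · exact Or.inl h
    · exact Or.inr ⟨q, hq, ih h1, ih h2⟩

theorem PairWin.of_le {f : ℕ} {α β : Perm (Fin (f + 1))} {n m a c : ℕ}
    (h : PairWin α β n a c) (hnm : n ≤ m) : PairWin α β m a c := by
  induction hnm with
  | refl => exact h
  | step _ ih => exact ih.succ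

/-- Binary search. Take the shortest initial segment of `α` that contains more than half of the
corner, and in it the element `q` that comes last in `β`. Before `q` in `α` at most half of the
corner remains. After `q` in `β` nothing of the chosen majority remains. -/
theorem pairWin_of_card_lt {f : ℕ} {α β : Perm (Fin (f + 1))} {n : ℕ} :
    ∀ {a c : ℕ}, (corner α β a c).card < 2 ^ n → PairWin α β n a c := by
  induction n with
  | zero =>
    intro a c h
    rw [pow_zero, Nat.lt_one_iff, Finset.card_eq_zero] at h
    exact h
  | succ n ih =>
    intro a c h
    rcases (corner α β a c).eq_empty_or_nonempty with h0 | h0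
    · exact Or.inl h0
    · right
      set u := (corner α β a c).card with hu
      have hu0 : 0 < u := h0.card_pos
      have hex : ∃ a', u / 2 + 1 ≤ (corner α β a' c).card := ⟨a, by omega⟩
      classical
      set a' := Nat.find hex with ha'
      have hspec : u / 2 + 1 ≤ (corner α β a' c).card := Nat.find_spec hex
      have ha'a : a' ≤ a := Nat.find_min' hex (by omega)
      have hne : (corner α β a' c).Nonempty := by rw [← Finset.card_pos]; omega
      obtain ⟨q, hq, hmax⟩ := Finset.exists_max_image (corner α β a' c)
        (fun p => (β⁻¹ p : ℕ)) hne
      have hqa := (mem_corner.1 hq).1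
      refine ⟨q, corner_subset α β ha'a le_rfl hq, ih ?_, ih ?_⟩
      · have := Nat.find_min hex (m := (α⁻¹ q : ℕ)) hqa
        rw [pow_succ] at h
        omega
      · have hdisj : Disjoint (corner α β a (f - (β⁻¹ q : ℕ))) (corner α β a' c) := by
          rw [Finset.disjoint_left]
          intro p hp hp'
          have h1 := hmax p hp'
          have h2 := (mem_corner.1 hp).2
          have h3 := (β⁻¹ q).2
          omega
        have hsub : corner α β a (f - (β⁻¹ q : ℕ)) ∪ corner α β a' c ⊆ corner α β a c := by
          refine Finset.union_subset (corner_subset α β le_rfl ?_) (corner_subset α β ha'a le_rfl)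
          have := (mem_corner.1 hq).2
          omega
        have h1 := Finset.card_le_card hsub
        rw [Finset.card_union_of_disjoint hdisj] at h1
        rw [pow_succ] at h
        omega

/-- Corners of large area are not empty, and those of small area have few elements. -/
def GoodPair {f : ℕ} (w s : ℕ) (α β : Perm (Fin (f + 1))) : Prop :=
  ∀ a ≤ f + 1, ∀ c ≤ f + 1, (w * (f + 1) ≤ a * c → corner α β a c ≠ ∅) ∧
    (a * c ≤ 8 * w * (f + 1) → (corner α β a c).card < s)

/-- With `W = w * (f + 1)`, a subrectangle of area `W` in the corner still contains an element `q`.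
If it has the proportions of the full rectangle, each answer to `q` replaces the area `A` by less
than the square root of `A * W`. Iteration brings the area down to `8 * W`, where few elements are
left and binary search takes over. -/
theorem GoodPair.pairWin {f w s R : ℕ} {α β : Perm (Fin (f + 1))} (h : GoodPair w s α β)
    (hs : s ≤ 2 ^ R) (n : ℕ) : ∀ {a c : ℕ}, a ≤ f + 1 → c ≤ f + 1 →
      a * c ≤ 4 * w * (f + 1) * 2 ^ 2 ^ n → PairWin α β (n + R) a c := by
  have base : ∀ {a c : ℕ}, a ≤ f + 1 → c ≤ f + 1 → a * c ≤ 8 * w * (f + 1) →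
      PairWin α β R a c := fun ha hc hac =>
    pairWin_of_card_lt (((h _ ha _ hc).2 hac).trans_le hs)
  induction n with
  | zero =>
    intro a c ha hc hac
    rw [zero_add]
    exact base ha hc (hac.trans (le_of_eq (by norm_num; ring)))
  | succ n ih =>
    intro a c ha hc hac
    by_cases hsmall : a * c ≤ 8 * w * (f + 1)
    · exact (base ha hc hsmall).of_le (by omega)
    · push Not at hsmall
      set W := w * (f + 1) with hW
      have hac1 : W ≤ a * c := by nlinarith
      have ha0 : 0 < a := Nat.pos_of_ne_zero fun h0 => by simp [h0] at hsmall
      have hc0 : 0 < c := Nat.pos_of_ne_zero fun h0 => by simp [h0] at hsmall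
      -- The sides are the rounded values of `√(a * W / c)` and `√(c * W / a)`. Minimality of `x`
      -- and `y` bounds the areas that remain after an answer.
      have hex : ∃ x, a * W ≤ x ^ 2 * c := ⟨a, by
        rw [pow_two, mul_assoc]; exact Nat.mul_le_mul_left _ hac1⟩
      have hey : ∃ y, c * W ≤ y ^ 2 * a := ⟨c, by
        rw [pow_two, mul_assoc, mul_comm c a]; exact Nat.mul_le_mul_left _ hac1⟩
      classical
      set x := Nat.find hex with hx
      set y := Nat.find hey with hy
      have hxs : a * W ≤ x ^ 2 * c := Nat.find_spec hex
      have hys : c * W ≤ y ^ 2 * a := Nat.find_spec hey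
      have hxa : x ≤ a := Nat.find_min' hex (by
        rw [pow_two, mul_assoc]; exact Nat.mul_le_mul_left _ hac1)
      have hyc : y ≤ c := Nat.find_min' hey (by
        rw [pow_two, mul_assoc, mul_comm c a]; exact Nat.mul_le_mul_left _ hac1)
      have hxy : W ≤ x * y := by
        have h1 : (a * c) * W ^ 2 ≤ (a * c) * (x * y) ^ 2 := by
          calc (a * c) * W ^ 2 = (a * W) * (c * W) := by ring
            _ ≤ (x ^ 2 * c) * (y ^ 2 * a) := Nat.mul_le_mul hxs hys
            _ = _ := by ring
        exact (Nat.pow_le_pow_iff_left two_ne_zero).1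
          (Nat.le_of_mul_le_mul_left h1 (Nat.mul_pos ha0 hc0))
      obtain ⟨q, hq⟩ := Finset.nonempty_iff_ne_empty.2
        ((h x (hxa.trans ha) y (hyc.trans hc)).1 hxy)
      obtain ⟨hq1, hq2⟩ := mem_corner.1 hq
      set Y := 2 ^ 2 ^ n with hY
      have hYY : 2 ^ 2 ^ (n + 1) = Y ^ 2 := by rw [hY, ← pow_mul, pow_succ]
      rw [hYY] at hac
      have hW4 : 4 * w * (f + 1) = 4 * W := by rw [hW]; ring
      rw [hW4] at hac ih
      have bound : ∀ z : ℕ, z ^ 2 < (a * c) * W → z ≤ 4 * W * Y := by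
        intro z hz
        by_contra! hcon
        have h1 : (4 * W * Y) ^ 2 ≤ z ^ 2 := Nat.pow_le_pow_left hcon.le 2
        have h2 : (a * c) * W ≤ 4 * W * Y ^ 2 * W := Nat.mul_le_mul_right _ hac
        nlinarith [Nat.zero_le (W ^ 2 * Y ^ 2)]
      rw [show n + 1 + R = n + R + 1 by omega]
      refine Or.inr ⟨q, corner_subset α β hxa hyc hq, ih (by omega) hc ?_, ih ha (by omega) ?_⟩
      · have := Nat.find_min hex (m := (α⁻¹ q : ℕ)) hq1
        push Not at this
        refine bound _ ?_
        calc ((α⁻¹ q : ℕ) * c) ^ 2 = ((α⁻¹ q : ℕ) ^ 2 * c) * c := by ring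
          _ < (a * W) * c := Nat.mul_lt_mul_of_pos_right this hc0
          _ = _ := by ring
      · have := Nat.find_min hey (m := f - (β⁻¹ q : ℕ)) (by omega)
        push Not at this
        refine bound _ ?_
        calc (a * (f - (β⁻¹ q : ℕ))) ^ 2 = ((f - (β⁻¹ q : ℕ)) ^ 2 * a) * a := by ring
          _ < (c * W) * a := Nat.mul_lt_mul_of_pos_right this ha0
          _ = _ := by ring

end Perm

/-! ### Most permutations form a good pair with a given one -/

section GoodPairs

open Equiv

theorem exp_neg_le_of_clog {g : ℕ} (ℓ : ℕ) (hℓ : g ≤ 2 ^ ℓ) (hg : 0 < g) :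
    Real.exp (-((5 * ℓ : ℕ) : ℝ)) ≤ ((g : ℝ) ^ 5)⁻¹ := by
  rw [Real.exp_neg]
  refine inv_anti₀ (by positivity) ?_
  have h1 : (g : ℝ) ≤ 2 ^ ℓ := by exact_mod_cast hℓ
  have h2 : (2 : ℝ) ≤ Real.exp 1 := by
    have := Real.add_one_le_exp (1 : ℝ); linarith
  calc (g : ℝ) ^ 5 ≤ (2 ^ ℓ) ^ 5 := pow_le_pow_left₀ (by positivity) h1 5
    _ = 2 ^ (5 * ℓ) := by rw [← pow_mul, mul_comm]
    _ ≤ Real.exp 1 ^ (5 * ℓ) := pow_le_pow_left₀ (by norm_num) h2 _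
    _ = _ := by rw [← Real.exp_nat_mul, mul_one]

/-- With `W = 40 * ℓ`, one term of the exponential series gives `(2 * W) ^ (4 * W) / (4 * W)! ≤ e ^
(2 * W) ≤ 2 ^ (3 * W)`. Removing the factor `2 ^ (4 * W)` leaves `2 ^ (-W)`. -/
theorem pow_div_factorial_le_of_clog {g : ℕ} (ℓ : ℕ) (hℓ : g ≤ 2 ^ ℓ) (hg : 0 < g) :
    ((8 * (5 * ℓ) : ℕ) : ℝ) ^ (160 * ℓ) / (160 * ℓ).factorial ≤ ((g : ℝ) ^ 5)⁻¹ := by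
  set W := 8 * (5 * ℓ) with hW
  have hs : 160 * ℓ = 4 * W := by omega
  rw [hs]
  have h1 : (2 * (W : ℝ)) ^ (4 * W) / (4 * W).factorial ≤ Real.exp (2 * W) :=
    Real.pow_div_factorial_le_exp _ (by positivity) _
  have he : Real.exp (2 * W) ≤ 2 ^ (3 * W) := by
    have h2 : Real.exp 2 ≤ 2 ^ 3 := by
      have := Real.exp_one_lt_d9
      have h3 : Real.exp 2 = Real.exp 1 ^ 2 := by rw [← Real.exp_nat_mul]; norm_num
      rw [h3]
      nlinarith [Real.exp_pos 1]
    calc Real.exp (2 * W) = Real.exp 2 ^ W := by rw [← Real.exp_nat_mul]; ring_nf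
      _ ≤ (2 ^ 3) ^ W := pow_le_pow_left₀ (Real.exp_pos _).le h2 _
      _ = _ := by rw [← pow_mul]
  have h2 : (W : ℝ) ^ (4 * W) / (4 * W).factorial * 2 ^ (4 * W) ≤ 2 ^ (3 * W) := by
    refine le_trans (le_of_eq ?_) (h1.trans he)
    rw [mul_pow]; ring
  have h3 : (2 : ℝ) ^ (4 * W) = 2 ^ (3 * W) * 2 ^ W := by rw [← pow_add]; congr 1; omega
  have h4 : (W : ℝ) ^ (4 * W) / (4 * W).factorial * 2 ^ W ≤ 1 := by
    rw [h3] at h2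
    have : (0 : ℝ) < 2 ^ (3 * W) := by positivity
    nlinarith
  have h5 : (g : ℝ) ^ 5 ≤ 2 ^ W := by
    have h1 : (g : ℝ) ≤ 2 ^ ℓ := by exact_mod_cast hℓ
    calc (g : ℝ) ^ 5 ≤ (2 ^ ℓ) ^ 5 := pow_le_pow_left₀ (by positivity) h1 5
      _ = 2 ^ (ℓ * 5) := by rw [← pow_mul]
      _ ≤ 2 ^ W := pow_le_pow_right₀ (by norm_num) (by omega)
  rw [← one_div, le_div_iff₀ (by positivity)]
  refine le_trans (mul_le_mul_of_nonneg_left h5 (by positivity)) h4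

/-- `GoodPair` with the parameters for which most permutations qualify. -/
def Good {f : ℕ} (α β : Perm (Fin (f + 1))) : Prop :=
  GoodPair (5 * Nat.clog 2 (f + 1)) (160 * Nat.clog 2 (f + 1)) α β

open Classical in
-- Union bound over `(f + 2) ^ 2` pairs of sides with two bad events each, every event having
-- probability at most `(f + 1) ^ (-5)`. A failure probability of `1 / (f + 1)` is what the
-- adversary can afford, because only `f` faults per block are counted.
theorem card_not_good_le {f : ℕ} (hf : 2 ≤ f) (α : Perm (Fin (f + 1))) :
    ((f + 1 : ℕ) : ℝ) * (Finset.univ.filter fun β => ¬ Good α β).card ≤ (f + 1).factorial := by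
  set ℓ := Nat.clog 2 (f + 1) with hℓ
  have hgℓ : (f + 1) ≤ 2 ^ ℓ := Nat.le_pow_clog (by norm_num) (f + 1)
  set w := 5 * ℓ with hw
  set s := 160 * ℓ with hs
  set E : ℕ × ℕ → Finset (Perm (Fin (f + 1))) := fun z => Finset.univ.filter fun β =>
    (w * (f + 1) ≤ z.1 * z.2 ∧ corner α β z.1 z.2 = ∅) ∨
      (z.1 * z.2 ≤ 8 * w * (f + 1) ∧ s ≤ (corner α β z.1 z.2).card) with hE
  have hg0 : (0 : ℝ) < (f + 1 : ℕ) := by positivity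
  have hEcard : ∀ z ∈ Finset.range ((f + 1) + 1) ×ˢ Finset.range ((f + 1) + 1),
      ((E z).card : ℝ) ≤ 2 * (((f + 1 : ℕ) : ℝ) ^ 5)⁻¹ * (f + 1).factorial := by
    rintro ⟨a, c⟩ hz
    rw [Finset.mem_product, Finset.mem_range, Finset.mem_range] at hz
    have ha : a ≤ (f + 1) := by have := hz.1; simp only at this; omega
    have hc : c ≤ (f + 1) := by have := hz.2; simp only at this; omega
    have h1 : ((Finset.univ.filter fun β : Perm (Fin (f + 1)) =>
        w * (f + 1) ≤ a * c ∧ corner α β a c = ∅).card : ℝ) ≤ (((f + 1 : ℕ) : ℝ) ^ 5)⁻¹ * (f + 1).factorial := by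
      by_cases hac : w * (f + 1) ≤ a * c
      · simp only [hac, true_and]
        refine (card_corner_empty_le α ha hc).trans
          (mul_le_mul_of_nonneg_right ?_ (by positivity))
        refine le_trans (Real.exp_le_exp.2 (neg_le_neg ?_)) (exp_neg_le_of_clog ℓ hgℓ (by omega))
        rw [le_div_iff₀ hg0]
        exact_mod_cast hac
      · simp only [hac, false_and, Finset.filter_false, Finset.card_empty, Nat.cast_zero]
        positivity
    have h2 : ((Finset.univ.filter fun β : Perm (Fin (f + 1)) =>
        a * c ≤ 8 * w * (f + 1) ∧ s ≤ (corner α β a c).card).card : ℝ) ≤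
          (((f + 1 : ℕ) : ℝ) ^ 5)⁻¹ * (f + 1).factorial := by
      by_cases hac : a * c ≤ 8 * w * (f + 1)
      · simp only [hac, true_and]
        refine (card_corner_large_le α ha hc s).trans
          (mul_le_mul_of_nonneg_right ?_ (by positivity))
        refine le_trans ?_ (pow_div_factorial_le_of_clog ℓ hgℓ (by omega))
        refine div_le_div_of_nonneg_right (pow_le_pow_left₀ (by positivity) ?_ _) (by positivity)
        rw [div_le_iff₀ hg0]
        exact_mod_cast hac
      · simp only [hac, false_and, Finset.filter_false, Finset.card_empty, Nat.cast_zero]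
        positivity
    have h3 : (E (a, c)).card ≤ (Finset.univ.filter fun β : Perm (Fin (f + 1)) =>
        w * (f + 1) ≤ a * c ∧ corner α β a c = ∅).card + (Finset.univ.filter fun β : Perm (Fin (f + 1)) =>
        a * c ≤ 8 * w * (f + 1) ∧ s ≤ (corner α β a c).card).card := by
      rw [hE]
      dsimp only
      rw [Finset.filter_or]
      exact Finset.card_union_le _ _
    have h4 : ((E (a, c)).card : ℝ) ≤ _ := Nat.cast_le.2 h3
    push_cast at h4
    linarith
  have hsub : (Finset.univ.filter fun β => ¬ Good α β) ⊆
      (Finset.range ((f + 1) + 1) ×ˢ Finset.range ((f + 1) + 1)).biUnion E := by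
    intro β hβ
    simp only [Good, GoodPair, Finset.mem_filter, Finset.mem_univ, true_and, not_forall] at hβ
    obtain ⟨a, ha, c, hc, hac⟩ := hβ
    refine Finset.mem_biUnion.2 ⟨(a, c), ?_, ?_⟩
    · rw [Finset.mem_product, Finset.mem_range, Finset.mem_range]
      exact ⟨Nat.lt_succ_of_le ha, Nat.lt_succ_of_le hc⟩
    · simp only [hE, Finset.mem_filter, Finset.mem_univ, true_and]
      rw [not_and_or] at hac
      push Not at hac
      exact hac
  have h1 : ((Finset.univ.filter fun β => ¬ Good α β).card : ℝ) ≤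
      (((f + 1) + 1) * ((f + 1) + 1) : ℕ) * (2 * (((f + 1 : ℕ) : ℝ) ^ 5)⁻¹ * (f + 1).factorial) := by
    refine (Nat.cast_le.2 ((Finset.card_le_card hsub).trans Finset.card_biUnion_le)).trans ?_
    rw [Nat.cast_sum]
    refine (Finset.sum_le_card_nsmul _ _ _ hEcard).trans (le_of_eq ?_)
    rw [Finset.card_product, Finset.card_range, nsmul_eq_mul]
  have hg3 : (3 : ℝ) ≤ (f + 1 : ℕ) := by exact_mod_cast (by omega : 3 ≤ (f + 1))
  have h2 : 2 * (((f + 1 : ℕ) : ℝ) + 1) * (((f + 1 : ℕ) : ℝ) + 1) ≤ ((f + 1 : ℕ) : ℝ) ^ 4 := by nlinarith [sq_nonneg (((f + 1 : ℕ) : ℝ) ^ 2 - 9)]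
  calc ((f + 1 : ℕ) : ℝ) * (Finset.univ.filter fun β => ¬ Good α β).card
      ≤ ((f + 1 : ℕ) : ℝ) * ((((f + 1) + 1) * ((f + 1) + 1) : ℕ) * (2 * (((f + 1 : ℕ) : ℝ) ^ 5)⁻¹ * (f + 1).factorial)) :=
        mul_le_mul_of_nonneg_left h1 hg0.le
    _ = (2 * (((f + 1 : ℕ) : ℝ) + 1) * (((f + 1 : ℕ) : ℝ) + 1)) * (((f + 1 : ℕ) : ℝ) ^ 4)⁻¹ * (f + 1).factorial := by
        have : ((f + 1 : ℕ) : ℝ) ≠ 0 := hg0.ne'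
        rw [Nat.cast_mul, Nat.cast_add_one (f + 1)]
        field_simp
    _ ≤ ((f + 1 : ℕ) : ℝ) ^ 4 * (((f + 1 : ℕ) : ℝ) ^ 4)⁻¹ * (f + 1).factorial := by gcongr
    _ = (f + 1).factorial := by rw [mul_inv_cancel₀ (by positivity), one_mul]

/-- The number of faults that suffice for a good pair. -/
def pairRank (f : ℕ) : ℕ := 2 * Nat.clog 2 (Nat.clog 2 (f + 1)) + 8

/-- Since `f + 1 ≤ 2 ^ ℓ ≤ 2 ^ 2 ^ clog ℓ`, the area of the full corner is small enough for `clog ℓ`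
rounds of taking square roots. The `160 * ℓ ≤ 2 ^ (clog ℓ + 8)` bound accounts for the binary
search. -/
theorem Good.pairWin {f : ℕ} (hf : 1 ≤ f) {α β : Perm (Fin (f + 1))} (h : Good α β) :
    PairWin α β (pairRank f) f f := by
  set ℓ := Nat.clog 2 (f + 1) with hℓ
  have h1 : ℓ ≤ 2 ^ Nat.clog 2 ℓ := Nat.le_pow_clog (by norm_num) ℓ
  have hg : f + 1 ≤ 2 ^ ℓ := Nat.le_pow_clog (by norm_num) _
  have h2 : 160 * ℓ ≤ 2 ^ (Nat.clog 2 ℓ + 8) := by rw [pow_add]; omega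
  have h3 := GoodPair.pairWin h h2 (Nat.clog 2 ℓ) (a := f) (c := f) (by omega) (by omega) ?_
  · exact h3.of_le (by rw [pairRank, ← hℓ]; omega)
  · have h4 : f + 1 ≤ 2 ^ 2 ^ Nat.clog 2 ℓ := hg.trans (Nat.pow_le_pow_right (by norm_num) h1)
    have hℓ0 : 0 < ℓ := Nat.clog_pos (by norm_num) (by omega)
    calc f * f ≤ (f + 1) * 2 ^ 2 ^ Nat.clog 2 ℓ := Nat.mul_le_mul (by omega) (by omega)
      _ ≤ _ := Nat.mul_le_mul_right _ (by nlinarith)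

end GoodPairs

/-! ### The block path and the game on it -/

section Blocks

open Equiv

/-- The `j`-th entry of a permutation, as a function of natural numbers. -/
def entry {f : ℕ} (σ : Perm (Fin (f + 1))) (j : ℕ) : ℕ := σ (Fin.ofNat (f + 1) j)

theorem entry_le {f : ℕ} (σ : Perm (Fin (f + 1))) (j : ℕ) : entry σ j ≤ f :=
  Nat.le_of_lt_succ (σ _).2

theorem entry_val {f : ℕ} (σ : Perm (Fin (f + 1))) (j : Fin (f + 1)) : entry σ j = σ j := by
  rw [entry]; congr 2; ext; simp

theorem entry_inv {f : ℕ} (σ : Perm (Fin (f + 1))) (p : Fin (f + 1)) :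
    entry σ (σ⁻¹ p : Fin (f + 1)) = p := by
  rw [entry_val]; simp

theorem entry_inj {f : ℕ} {σ : Perm (Fin (f + 1))} {i j : ℕ} (hi : i ≤ f) (hj : j ≤ f)
    (h : entry σ i = entry σ j) : i = j := by
  have h1 := entry_val σ ⟨i, Nat.lt_succ_of_le hi⟩
  have h2 := entry_val σ ⟨j, Nat.lt_succ_of_le hj⟩
  simp only at h1 h2
  rw [h1, h2] at h
  have := σ.injective (Fin.ext h)
  simpa using this

theorem exists_entry_eq {f : ℕ} (σ : Perm (Fin (f + 1))) {p : ℕ} (hp : p ≤ f) :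
    ∃ j ≤ f, entry σ j = p :=
  ⟨_, Nat.le_of_lt_succ (σ⁻¹ ⟨p, Nat.lt_succ_of_le hp⟩).2, entry_inv σ ⟨p, Nat.lt_succ_of_le hp⟩⟩

/-- The labels of a path that consists of cells of length `k`: the `i`-th cell starts with a block
of the first `f` entries of the permutation `π i` of the pages `0, …, f`, followed by a separator
that consists of the pages `f + 1, …, k`. -/
def blockLab (f k : ℕ) (π : ℕ → Perm (Fin (f + 1))) (x : ℕ) : ℕ :=
  if x % k < f then entry (π (x / k)) (x % k) else x % k + 1

variable {f k : ℕ} {π : ℕ → Perm (Fin (f + 1))}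

theorem exists_cell (hk : 0 < k) (x : ℕ) : ∃ i j, j < k ∧ x = i * k + j :=
  ⟨x / k, x % k, Nat.mod_lt _ hk, by rw [mul_comm]; exact (Nat.div_add_mod x k).symm⟩

theorem cell_div {i j : ℕ} (hj : j < k) : (i * k + j) / k = i := by
  rw [mul_comm, Nat.mul_add_div (by omega), Nat.div_eq_of_lt hj, add_zero]

theorem cell_mod {i j : ℕ} (hj : j < k) : (i * k + j) % k = j := by
  rw [mul_comm, Nat.mul_add_mod, Nat.mod_eq_of_lt hj]

theorem blockLab_block {i j : ℕ} (hj : j < k) (hjf : j < f) :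
    blockLab f k π (i * k + j) = entry (π i) j := by
  rw [blockLab, cell_div hj, cell_mod hj, if_pos hjf]

theorem blockLab_sep {i j : ℕ} (hj : j < k) (hjf : f ≤ j) :
    blockLab f k π (i * k + j) = j + 1 := by
  rw [blockLab, cell_mod hj, if_neg (by omega)]

theorem blockLab_le (hk : 0 < k) (hfk : f ≤ k) (x : ℕ) : blockLab f k π x ≤ k := by
  obtain ⟨i, j, hj, rfl⟩ := exists_cell hk x
  by_cases hjf : j < f
  · rw [blockLab_block hj hjf]; exact (entry_le _ _).trans hfk
  · rw [blockLab_sep hj (by omega)]; omega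

theorem exists_block_of_le (hk : 0 < k) {x : ℕ} (h : blockLab f k π x ≤ f) :
    ∃ i j, j < k ∧ j < f ∧ x = i * k + j ∧ blockLab f k π x = entry (π i) j := by
  obtain ⟨i, j, hj, rfl⟩ := exists_cell hk x
  by_cases hjf : j < f
  · exact ⟨i, j, hj, hjf, rfl, blockLab_block hj hjf⟩
  · rw [blockLab_sep hj (by omega)] at h; omega

/-- Equal labels of the block path are far apart. -/
theorem blockLab_dist (hk : 0 < k) (hf : 1 ≤ f) (hfk : f ≤ k) {x y : ℕ} (hxy : x < y)
    (h : blockLab f k π x = blockLab f k π y) : x + (k - f + 1) ≤ y ∧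
      (x + (k - f + 1) = y → (k = k - f + 1) ∨ ∃ i, entry (π i) (f - 1) = entry (π (i + 1)) 0 ∧
        y = (i + 1) * k) := by
  obtain ⟨i, j, hj, rfl⟩ := exists_cell hk x
  obtain ⟨i', j', hj', rfl⟩ := exists_cell hk y
  have hii : i ≤ i' := by
    by_contra! hcon
    have := Nat.mul_le_mul_right k (Nat.succ_le_of_lt hcon)
    rw [Nat.succ_mul] at this
    omega
  by_cases hjf : j < f
  · rw [blockLab_block hj hjf] at h
    have hle := entry_le (π i) j
    by_cases hjf' : j' < f
    · rw [blockLab_block hj' hjf'] at h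
      rcases hii.eq_or_lt with rfl | hlt
      · have := entry_inj hjf.le hjf'.le h
        omega
      · have h1 := Nat.mul_le_mul_right k (Nat.succ_le_of_lt hlt)
        rw [Nat.succ_mul] at h1
        -- The distance is attained only by the last position of a block and the first one of the
        -- next block. The deterministic adversary avoids this coincidence and gains one in `Δ`.
        refine ⟨by omega, fun heq => Or.inr ⟨i, ?_⟩⟩
        have h2 : i' = i + 1 := by
          by_contra hne
          have := Nat.mul_le_mul_right k (show i + 2 ≤ i' by omega)
          rw [Nat.add_mul] at this
          omega
        subst h2
        rw [Nat.succ_mul] at heq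
        have hj1 : j = f - 1 := by omega
        have hj0 : j' = 0 := by omega
        subst hj1 hj0
        exact ⟨h, by omega⟩
    · rw [blockLab_sep hj' (by omega)] at h; omega
  · rw [blockLab_sep hj (by omega)] at h
    by_cases hjf' : j' < f
    · rw [blockLab_block hj' hjf'] at h
      have := entry_le (π i') j'
      omega
    · rw [blockLab_sep hj' (by omega)] at h
      have hjj : j = j' := by omega
      subst hjj
      rcases hii.eq_or_lt with rfl | hlt
      · omega
      · have h1 := Nat.mul_le_mul_right k (Nat.succ_le_of_lt hlt)
        rw [Nat.succ_mul] at h1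
        refine ⟨by omega, fun heq => Or.inl (by omega)⟩

theorem card_filter_blockLab_le (hk : 0 < k) (m p : ℕ) :
    ((Finset.range (m * k)).filter fun x => blockLab f k π x = p).card ≤ m := by
  have : ((Finset.range (m * k)).filter fun x => blockLab f k π x = p).card ≤
      (Finset.range m).card := by
    refine Finset.card_le_card_of_injOn (fun x => x / k) ?_ ?_
    · intro x hx
      have hx : x < m * k := by
        have := (Finset.mem_filter.1 hx).1
        simpa using this
      exact Finset.mem_coe.2 (Finset.mem_range.2 (Nat.div_lt_of_lt_mul (by rwa [mul_comm])))
    · intro x hx y hy hxy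
      have hx := (Finset.mem_filter.1 hx).2
      have hy := (Finset.mem_filter.1 hy).2
      obtain ⟨i, j, hj, rfl⟩ := exists_cell hk x
      obtain ⟨i', j', hj', rfl⟩ := exists_cell hk y
      simp only [cell_div hj, cell_div hj'] at hxy
      subst hxy
      have h := hx.trans hy.symm
      by_cases hjf : j < f
      · by_cases hjf' : j' < f
        · rw [blockLab_block hj hjf, blockLab_block hj' hjf'] at h
          rw [entry_inj hjf.le hjf'.le h]
        · rw [blockLab_block hj hjf, blockLab_sep hj' (by omega)] at h
          have := entry_le (π i) j; omega
      · by_cases hjf' : j' < f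
        · rw [blockLab_sep hj (by omega), blockLab_block hj' hjf'] at h
          have := entry_le (π i) j'; omega
        · rw [blockLab_sep hj (by omega), blockLab_sep hj' (by omega)] at h
          rw [show j = j' by omega]
  simpa using this

/-- The page `p` occurs in the interval from `l` to `r`. -/
def Occurs (f k : ℕ) (π : ℕ → Perm (Fin (f + 1))) (l r p : ℕ) : Prop :=
  ∃ x, l ≤ x ∧ x ≤ r ∧ blockLab f k π x = p

theorem Occurs.mono {l r l' r' p : ℕ} (h : Occurs f k π l r p) (hl : l' ≤ l) (hr : r ≤ r') :
    Occurs f k π l' r' p := by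
  obtain ⟨x, h1, h2, h3⟩ := h
  exact ⟨x, by omega, by omega, h3⟩

theorem occurs_sep {l r i p : ℕ} (hl : l ≤ i * k + f) (hr : (i + 1) * k ≤ r + 1) (hp : f < p)
    (hpk : p ≤ k) : Occurs f k π l r p := by
  rw [Nat.succ_mul] at hr
  refine ⟨i * k + (p - 1), by omega, by omega, ?_⟩
  rw [blockLab_sep (by omega) (by omega)]
  omega

/-- Block `i` shows all of the pages `0, …, f` but one. That page can only be met in a different
block, and the way there crosses a whole separator. -/
theorem occurs_all_of_block (hk : 0 < k) (hfk : f ≤ k) {l r i : ℕ} (hl : l ≤ i * k)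
    (hr : i * k + f ≤ r + 1) (he : Occurs f k π l r (entry (π i) f)) {p : ℕ} (hp : p ≤ k) :
    Occurs f k π l r p := by
  by_cases hpf : p ≤ f
  · obtain ⟨j, hj, rfl⟩ := exists_entry_eq (π i) hpf
    rcases hj.eq_or_lt with rfl | hj
    · exact he
    · exact ⟨i * k + j, by omega, by omega, blockLab_block (by omega) hj⟩
  · obtain ⟨x, h1, h2, h3⟩ := he
    obtain ⟨i', j, hj, hjf, rfl, h4⟩ := exists_block_of_le hk (h3.trans_le (entry_le (π i) f))
    rw [h3] at h4
    rcases lt_trichotomy i i' with hlt | rfl | hlt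
    · have := Nat.mul_le_mul_right k (Nat.succ_le_of_lt hlt)
      exact occurs_sep (i := i) (by omega) (by rw [Nat.succ_eq_add_one] at this; omega)
        (by omega) hp
    · have := entry_inj le_rfl hjf.le h4
      omega
    · have := Nat.mul_le_mul_right k (Nat.succ_le_of_lt hlt)
      rw [Nat.succ_eq_add_one] at this
      exact occurs_sep (i := i') (by omega) (by omega) (by omega) hp

variable {P : Type} [DecidableEq P] {pg : ℕ → P}

/-- The set of the first `k + 1` pages. -/
def pageSet (pg : ℕ → P) (k : ℕ) : Finset P := (Finset.range (k + 1)).image pg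

theorem card_pageSet (hpg : Set.InjOn pg (Set.Iic k)) : (pageSet pg k).card = k + 1 := by
  rw [pageSet, Finset.card_image_of_injOn, Finset.card_range]
  intro x hx y hy
  simp only [Finset.coe_range, Set.mem_Iio] at hx hy
  exact hpg (Set.mem_Iic.2 (by omega)) (Set.mem_Iic.2 (by omega))

theorem mem_pageSet {p : ℕ} (hp : p ≤ k) : pg p ∈ pageSet pg k :=
  Finset.mem_image_of_mem _ (Finset.mem_range.2 (by omega))

theorem mem_image_Icc_iff (hk : 0 < k) (hfk : f ≤ k) (hpg : Set.InjOn pg (Set.Iic k)) {l r p : ℕ}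
    (hp : p ≤ k) : pg p ∈ (Finset.Icc l r).image (fun x => pg (blockLab f k π x)) ↔
      Occurs f k π l r p := by
  simp only [Finset.mem_image, Finset.mem_Icc, Occurs]
  constructor
  · rintro ⟨x, ⟨h1, h2⟩, h3⟩
    exact ⟨x, h1, h2, hpg (Set.mem_Iic.2 (blockLab_le hk hfk x)) (Set.mem_Iic.2 hp) h3⟩
  · rintro ⟨x, h1, h2, h3⟩
    exact ⟨x, ⟨h1, h2⟩, by rw [h3]⟩

theorem not_card_le_of_occurs_all (hk : 0 < k) (hfk : f ≤ k) (hpg : Set.InjOn pg (Set.Iic k))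
    {l r : ℕ} (h : ∀ p ≤ k, Occurs f k π l r p) :
    ¬ ((Finset.Icc l r).image (fun x => pg (blockLab f k π x))).card ≤ k := by
  have hsub : pageSet pg k ⊆ (Finset.Icc l r).image (fun x => pg (blockLab f k π x)) := by
    intro q hq
    obtain ⟨p, hp, rfl⟩ := Finset.mem_image.1 hq
    have hp : p ≤ k := Nat.le_of_lt_succ (Finset.mem_range.1 hp)
    exact (mem_image_Icc_iff hk hfk hpg hp).2 (h p hp)
  have := Finset.card_le_card hsub
  rw [card_pageSet hpg] at this
  omega

section Game

variable {N : ℕ} (hk : 0 < k) (hfk : f ≤ k) (hpg : Set.InjOn pg (Set.Iic k))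

include hk hfk hpg

/-- If `q` has already occurred in the phase, the assumption applies to the present interval, and
the fault reserved for `q` is not needed. -/
theorem win_of_next {n l r q : ℕ} (hlr : l ≤ r) (hq : q ≤ k) (hr : r < N)
    (hc : ((Finset.Icc l r).image (fun x => pg (blockLab f k π x))).card ≤ k)
    (h : ∀ l' r', l' ≤ l → r ≤ r' → r' < N → Occurs f k π l' r' q →
      ((Finset.Icc l' r').image (fun x => pg (blockLab f k π x))).card ≤ k →
      Win N (fun x => pg (blockLab f k π x)) (pageSet pg k) k n (Finset.Icc l' r')) :
    Win N (fun x => pg (blockLab f k π x)) (pageSet pg k) k (n + 1) (Finset.Icc l r) := by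
  by_cases ho : Occurs f k π l r q
  · exact (h l r le_rfl le_rfl hr ho hc).succ
  · refine ⟨pg q, mem_pageSet hq, fun hm => ho ((mem_image_Icc_iff hk hfk hpg hq).1 hm), ?_⟩
    intro l' r' hsub hr' hm hc'
    rw [Finset.Icc_subset_Icc_iff hlr] at hsub
    exact h l' r' hsub.1 hsub.2 hr' ((mem_image_Icc_iff hk hfk hpg hq).1 hm) hc'

/-- After eviction of the page that block `i` lacks, its request would complete all `k + 1` pages
and so end the phase. -/
theorem win_of_block {l r i : ℕ} (hlr : l ≤ r) (hr : r < N)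
    (hc : ((Finset.Icc l r).image (fun x => pg (blockLab f k π x))).card ≤ k)
    (hl : l ≤ i * k) (hir : i * k + f ≤ r + 1) :
    Win N (fun x => pg (blockLab f k π x)) (pageSet pg k) k 1 (Finset.Icc l r) := by
  refine win_of_next hk hfk hpg hlr ((entry_le (π i) f).trans hfk) hr hc ?_
  intro l' r' h1 h2 _ ho hc'
  exact absurd hc' (not_card_le_of_occurs_all hk hfk hpg fun p hp =>
    occurs_all_of_block hk hfk (by omega) (by omega) ho hp)

/-- At most the first `a` positions of block `i` and the last `c - 1` positions of block `i + 1` are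
unvisited; the remaining unit of `c` stands for the page that block `i + 1` lacks. Given that the
page lacking in block `i` was seen, unseen pages lie in the corner, and an empty corner contradicts
the page bound of the phase. -/
theorem win_of_pairWin {i n : ℕ} : ∀ {a c l r : ℕ}, a ≤ f → 1 ≤ c → c ≤ f → l ≤ r → r < N →
    l ≤ i * k + a → (i + 1) * k + f ≤ r + c →
    ((Finset.Icc l r).image (fun x => pg (blockLab f k π x))).card ≤ k →
    Occurs f k π l r (entry (π i) f) → PairWin (π i) (π (i + 1)) n a c →
    Win N (fun x => pg (blockLab f k π x)) (pageSet pg k) k (n + 1) (Finset.Icc l r) := by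
  have hempty : ∀ {a c l r : ℕ}, a ≤ f → 1 ≤ c → c ≤ f →
      l ≤ i * k + a → (i + 1) * k + f ≤ r + c →
      ((Finset.Icc l r).image (fun x => pg (blockLab f k π x))).card ≤ k →
      Occurs f k π l r (entry (π i) f) → corner (π i) (π (i + 1)) a c ≠ ∅ := by
    intro a c l r ha hc1 hc hl hr hcard he hU
    refine not_card_le_of_occurs_all hk hfk hpg (fun p hp => ?_) hcard
    have hr' := hr
    rw [Nat.succ_mul] at hr'
    by_cases hpf : p ≤ f
    · set q : Fin (f + 1) := ⟨p, Nat.lt_succ_of_le hpf⟩ with hq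
      have h1 : entry (π i) ((π i)⁻¹ q : Fin (f + 1)) = p := entry_inv (π i) q
      have h2 : entry (π (i + 1)) ((π (i + 1))⁻¹ q : Fin (f + 1)) = p := entry_inv (π (i + 1)) q
      have h3 : q ∉ corner (π i) (π (i + 1)) a c := by rw [hU]; simp
      rw [mem_corner] at h3
      have h4 := ((π i)⁻¹ q).2
      generalize (((π i)⁻¹ q : Fin (f + 1)) : ℕ) = x at *
      generalize (((π (i + 1))⁻¹ q : Fin (f + 1)) : ℕ) = y at *
      by_cases hx : x = f
      · subst hx; rw [← h1]; exact he
      · by_cases hxa : a ≤ x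
        · exact ⟨i * k + x, by omega, by omega,
            (blockLab_block (by omega) (by omega)).trans h1⟩
        · have hy : y + c < f + 1 := by
            by_contra! hcon
            exact h3 ⟨by omega, hcon⟩
          exact ⟨(i + 1) * k + y, by rw [Nat.succ_mul]; omega, by omega,
            (blockLab_block (by omega) (by omega)).trans h2⟩
    · exact occurs_sep (i := i) (by omega) (by omega) (by omega) hp
  induction n with
  | zero =>
    intro a c l r ha hc1 hc hlr hrN hl hr hcard he hw
    exact absurd hw (hempty ha hc1 hc hl hr hcard he)
  | succ n ih =>
    intro a c l r ha hc1 hc hlr hrN hl hr hcard he hw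
    rcases hw with hw | ⟨q, hq, hw1, hw2⟩
    · exact absurd hw (hempty ha hc1 hc hl hr hcard he)
    · rw [mem_corner] at hq
      refine win_of_next hk hfk hpg hlr (q := q) ((Nat.le_of_lt_succ q.2).trans hfk) hrN hcard ?_
      intro l' r' hl' hr' hr'N ho hcard'
      have he' := he.mono hl' hr'
      obtain ⟨x, hx1, hx2, hx3⟩ := ho
      obtain ⟨i', j, hj, hjf, rfl, hx4⟩ :=
        exists_block_of_le hk (hx3.trans_le (Nat.le_of_lt_succ q.2))
      rw [hx3] at hx4
      have hi1 : (i + 1) * k = i * k + k := Nat.succ_mul i k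
      -- The evicted page can be met in block `i` or in block `i + 1`, the two answers in `PairWin`.
      -- Meeting it before block `i` would end the phase, and meeting it beyond block `i + 1` makes
      -- that block fully visited.
      rcases lt_trichotomy i' i with hlt | rfl | hlt
      · have := Nat.mul_le_mul_right k (Nat.succ_le_of_lt hlt)
        rw [Nat.succ_mul] at this
        exact absurd hcard' (not_card_le_of_occurs_all hk hfk hpg fun p hp =>
          occurs_all_of_block hk hfk (i := i) (by omega) (by omega) he' hp)
      · have hji : j = ((π i')⁻¹ q : Fin (f + 1)) :=
          entry_inj hjf.le (Nat.le_of_lt_succ ((π i')⁻¹ q).2) (hx4.symm.trans (entry_inv _ q).symm)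
        exact ih (a := ((π i')⁻¹ q : Fin (f + 1))) (by omega) hc1 hc (by omega) hr'N (by omega)
          (by omega) hcard' he' hw1
      · rcases (Nat.succ_le_of_lt hlt).eq_or_lt with heq | hlt2
        · rw [Nat.succ_eq_add_one] at heq
          subst heq
          have hji : j = ((π (i + 1))⁻¹ q : Fin (f + 1)) :=
            entry_inj hjf.le (Nat.le_of_lt_succ ((π (i + 1))⁻¹ q).2)
              (hx4.symm.trans (entry_inv _ q).symm)
          exact ih (c := f - ((π (i + 1))⁻¹ q : Fin (f + 1))) ha (by omega) (by omega) (by omega)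
            hr'N (by omega) (by omega) hcard' he' hw2
        · have := Nat.mul_le_mul_right k (Nat.succ_le_of_lt hlt2)
          simp only [Nat.succ_eq_add_one] at this
          rw [Nat.succ_mul] at this
          exact (win_of_block hk hfk hpg (i := i + 1) (by omega) hr'N hcard' (by omega)
            (by omega)).of_le (by omega)

variable {n : ℕ} (hf : 1 ≤ f) (hpair : ∀ i, (i + 1) * k < N → PairWin (π i) (π (i + 1)) n f f)

include hf hpair

theorem win_of_two_blocks {i l r : ℕ} (hrN : r < N)
    (hl : l < i * k + f) (hr : (i + 1) * k ≤ r)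
    (hc : ((Finset.Icc l r).image (fun x => pg (blockLab f k π x))).card ≤ k) :
    Win N (fun x => pg (blockLab f k π x)) (pageSet pg k) k (n + 2) (Finset.Icc l r) := by
  have hi1 : (i + 1) * k = i * k + k := Nat.succ_mul i k
  refine win_of_next hk hfk hpg (by omega) ((entry_le (π i) f).trans hfk) hrN hc ?_
  intro l' r' hl' hr' hr'N ho hc'
  exact win_of_pairWin hk hfk hpg (a := f) (c := f) le_rfl hf le_rfl (by omega) hr'N (by omega)
    (by omega) hc' ho (hpair i (by omega))

/-- The page that block `i` lacks is evicted; its request happens in another block, and then two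
consecutive blocks have been touched. -/
theorem win_of_one_block {i l r : ℕ} (hlr : l ≤ r) (hrN : r < N)
    (hl : l < i * k + f) (hr : i * k ≤ r)
    (hc : ((Finset.Icc l r).image (fun x => pg (blockLab f k π x))).card ≤ k) :
    Win N (fun x => pg (blockLab f k π x)) (pageSet pg k) k (n + 3) (Finset.Icc l r) := by
  refine win_of_next hk hfk hpg hlr ((entry_le (π i) f).trans hfk) hrN hc ?_
  intro l' r' hl' hr' hr'N ho hc'
  obtain ⟨x, hx1, hx2, hx3⟩ := ho
  obtain ⟨i', j, hj, hjf, rfl, hx4⟩ := exists_block_of_le hk (hx3.trans_le (entry_le _ _))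
  rw [hx3] at hx4
  rcases lt_trichotomy i i' with hlt | rfl | hlt
  · have := Nat.mul_le_mul_right k (Nat.succ_le_of_lt hlt)
    rw [Nat.succ_eq_add_one] at this
    exact win_of_two_blocks hk hfk hpg hf hpair (i := i) hr'N (by omega) (by omega) hc'
  · have := entry_inj le_rfl hjf.le hx4
    omega
  · have := Nat.mul_le_mul_right k (Nat.succ_le_of_lt hlt)
    rw [Nat.succ_eq_add_one] at this
    exact win_of_two_blocks hk hfk hpg hf hpair (i := i') hr'N (by omega) (by omega) hc'

/-- Page `0` occurs only in blocks, so its eviction forces the walk to touch a block before the next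
fault. -/
theorem win_singleton {x : ℕ} (hx : x < N) :
    Win N (fun x => pg (blockLab f k π x)) (pageSet pg k) k (n + 4) {x} := by
  rw [← Finset.Icc_self]
  refine win_of_next hk hfk hpg le_rfl (q := 0) (Nat.zero_le _) hx (by simpa using Nat.succ_le_of_lt hk) ?_
  intro l' r' hl' hr' hr'N ho hc'
  obtain ⟨y, hy1, hy2, hy3⟩ := ho
  obtain ⟨i, j, hj, hjf, rfl, -⟩ := exists_block_of_le hk (hy3.trans_le (Nat.zero_le f))
  exact win_of_one_block hk hfk hpg hf hpair (i := i) (by omega) hr'N (by omega) (by omega) hc'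

end Game

/-- On a path whose consecutive blocks are good pairs, `O(log log f)` faults per phase suffice. -/
theorem detRatio_blockPath_le (hk : 0 < k) (hf : 1 ≤ f) (hfk : f + 2 ≤ k)
    (hpg : Set.InjOn pg (Set.Iic k))
    (hgood : ∀ i < k, Good (π i) (π (i + 1))) :
    detRatio (pathExt ((k + 1) * k) fun x => pg (blockLab f k π x)) k ≤
      ((2 * (pairRank f + 4) + 1 : ℕ) : ℝ≥0∞) := by
  have hfk' : f ≤ k := by omega
  have hle := fun x => blockLab_le (π := π) hk hfk' x
  refine detRatio_pathExt_le_of_win hk _ _ (pageSet pg k) (card_pageSet hpg)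
    (fun x _ => mem_pageSet (hle x)) ?_ ?_ _ fun x hx => ?_
  · intro x y hxy _ h
    have := (blockLab_dist hk hf hfk' hxy
      (hpg (Set.mem_Iic.2 (hle x)) (Set.mem_Iic.2 (hle y)) h)).1
    omega
  · intro p
    by_cases hp : ∃ j ≤ k, pg j = p
    · obtain ⟨j, hj, rfl⟩ := hp
      refine (Finset.card_le_card fun x hx => ?_).trans
        (card_filter_blockLab_le (π := π) hk (k + 1) j)
      rw [Finset.mem_filter] at hx ⊢
      exact ⟨hx.1, hpg (Set.mem_Iic.2 (hle x)) (Set.mem_Iic.2 hj) hx.2⟩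
    · rw [Finset.filter_eq_empty_iff.2]
      · simp
      · intro x _ h
        exact hp ⟨_, hle x, h⟩
  · refine win_singleton hk hfk' hpg hf (fun i hi => ?_) hx
    exact (hgood i (by have := Nat.lt_of_mul_lt_mul_right hi; omega)).pairWin hf

end Blocks

/-! ### Upper bounds for the offline optimum -/

section Reach

variable {P : Type} [DecidableEq P] {k : ℕ}

/-- With memory content `C` one can serve `σ` with `m` faults and end with memory content `C'`. -/
def Reach (k : ℕ) (C : Finset P) (σ : List P) (m : ℕ) (C' : Finset P) : Prop :=
  ∀ τ m', Serves k C' τ m' → Serves k C (σ ++ τ) (m + m')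

theorem Reach.trans {C C' C'' : Finset P} {σ τ : List P} {m m' : ℕ} (h : Reach k C σ m C')
    (h' : Reach k C' τ m' C'') : Reach k C (σ ++ τ) (m + m') C'' := by
  intro ρ m'' hs
  rw [List.append_assoc, add_assoc]
  exact h _ _ (h' _ _ hs)

theorem Reach.serves {C C' : Finset P} {σ : List P} {m : ℕ} (h : Reach k C σ m C') :
    Serves k C σ m := by
  simpa using h [] 0 (.nil C')

theorem reach_nil (C : Finset P) : Reach k C [] 0 C := fun τ m' h => by simpa using h

theorem reach_hit {C : Finset P} (hC : C.card ≤ k) {p : P} (hp : p ∈ C) : Reach k C [p] 0 C := by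
  intro τ m' h
  have := Serves.cons C C p τ m' hp (Finset.subset_insert _ _) hC h
  simpa [hp] using this

theorem reach_miss {Q : Finset P} (hQ : Q.card = k + 1) {p q : P} (hp : p ∈ Q) (hq : q ∈ Q)
    (hpq : p ≠ q) : Reach k (Q.erase p) [p] 1 (Q.erase q) := by
  intro τ m' h
  have := Serves.cons (Q.erase p) (Q.erase q) p τ m' (Finset.mem_erase.2 ⟨hpq, hp⟩) ?_ ?_ h
  · simpa using this
  · rw [Finset.insert_erase hp]; exact Finset.erase_subset _ _
  · rw [Finset.card_erase_of_mem hq, hQ]; simp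

/-- A sequence that avoids the page `e` can be served with one fault, or with none if `e` is the
missing page. -/
theorem exists_reach_avoiding {Q : Finset P} (hQ : Q.card = k + 1) {e : P} (he : e ∈ Q)
    (s : List P) : ∀ (_ : ∀ p ∈ s, p ∈ Q ∧ p ≠ e) {q : P} (_ : q ∈ Q), ∃ m, ∃ q' ∈ Q,
      Reach k (Q.erase q) s m (Q.erase q') ∧
        m + (if q' = e then 0 else 1) ≤ if q = e then 0 else 1 := by
  induction s with
  | nil => exact fun _ q hq => ⟨0, q, hq, reach_nil _, by simp⟩
  | cons p s ih =>
    intro hs q hq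
    have hs' : ∀ p ∈ s, p ∈ Q ∧ p ≠ e := fun p hp => hs p (by simp [hp])
    obtain ⟨hpQ, hpe⟩ := hs p (by simp)
    by_cases hpq : p = q
    · subst hpq
      obtain ⟨m, q', hq', hr, hm⟩ := ih hs' he
      refine ⟨1 + m, q', hq', (reach_miss hQ hpQ he hpe).trans hr, ?_⟩
      simp only [if_true, hpe, if_false] at hm ⊢
      omega
    · obtain ⟨m, q', hq', hr, hm⟩ := ih hs' hq
      have hc : (Q.erase q).card ≤ k := by rw [Finset.card_erase_of_mem hq, hQ]; simp
      refine ⟨0 + m, q', hq', (reach_hit hc (Finset.mem_erase.2 ⟨hpq, hpQ⟩)).trans hr, ?_⟩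
      omega

/-- The smaller memory imitates the larger one without its unseen pages, each of which costs at most
one extra fault. This permits an offline analysis that starts with a full memory. -/
theorem Serves.of_subset {C : Finset P} {σ : List P} {m : ℕ} (h : Serves k C σ m) :
    ∀ {D : Finset P}, D ⊆ C → ∃ m' ≤ m + (C \ D).card, Serves k D σ m' := by
  induction h with
  | nil C => exact fun {D} _ => ⟨0, Nat.zero_le _, .nil D⟩
  | cons C C' p σ m hp hC hk h ih =>
    intro D hD
    obtain ⟨m', hm', hs⟩ := ih (D := C' ∩ insert p D) Finset.inter_subset_left
    refine ⟨_, ?_, Serves.cons D (C' ∩ insert p D) p σ m' (by simp [hp]) Finset.inter_subset_right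
      ((Finset.card_le_card Finset.inter_subset_left).trans hk) hs⟩
    have hsub : C' \ (C' ∩ insert p D) ⊆ (C \ D).erase p := by
      intro x hx
      simp only [Finset.mem_sdiff, Finset.mem_inter, Finset.mem_insert, not_and, not_or] at hx
      have h1 := hx.2 hx.1
      have h2 := Finset.mem_insert.1 (hC hx.1)
      simp only [Finset.mem_erase, Finset.mem_sdiff]
      exact ⟨h1.1, h2.resolve_left h1.1, h1.2⟩
    have hcard := Finset.card_le_card hsub
    have hle := Finset.card_erase_le (s := C \ D) (a := p)
    by_cases hpD : p ∈ D
    · simp only [hpD, hD hpD, if_true]; omega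
    · by_cases hpC : p ∈ C
      · have := Finset.card_erase_add_one (Finset.mem_sdiff.2 ⟨hpC, hpD⟩)
        simp only [hpD, hpC, if_true, if_false]; omega
      · simp only [hpD, hpC, if_false]; omega

end Reach

/-! ### The sweeping walk -/

section Sweep

open Equiv

/-- The position to which the walk goes back from `t` before it visits `t + 1` for the first
time. -/
def backTo (f k t : ℕ) : ℕ := (t + 1) / k * k + f - k - if (t + 1) % k = 0 then 1 else 0

/-- The walk on a path from `t` back to `y` and forth to `t` again. -/
def backAndForth (y t : ℕ) : List ℕ := (List.range' y (t + 1 - y)).reverse ++ List.range' (y + 1) (t - y)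

/-- The walk that repeatedly goes back over recent positions, up to its first visit of `t`. -/
def sweep (f k : ℕ) : ℕ → List ℕ
  | 0 => [0]
  | t + 1 => sweep f k t ++ (backAndForth (backTo f k t) t ++ [t + 1])

theorem mem_backAndForth {y t v : ℕ} (h : y ≤ t) : v ∈ backAndForth y t ↔ y ≤ v ∧ v ≤ t := by
  simp only [backAndForth, List.mem_append, List.mem_reverse, List.mem_range'_1]
  omega

/-- The target is where the separator before cell `i` starts, or one position earlier, in the
preceding block, if `t + 1` opens the cell. Truncated subtraction gives `0` in the first cell. -/
theorem backTo_eq {f k i j t : ℕ} (hj : j < k) (ht : t + 1 = i * k + j) :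
    backTo f k t = i * k + f - k - if j = 0 then 1 else 0 := by
  rw [backTo, ht, cell_div hj, cell_mod hj]

theorem backTo_le {f k : ℕ} (hk : 0 < k) (hfk : f ≤ k) (t : ℕ) : backTo f k t ≤ t := by
  obtain ⟨i, j, hj, ht⟩ := exists_cell hk (t + 1)
  rw [backTo_eq hj ht]
  split_ifs <;> omega

theorem le_of_mem_sweep {f k : ℕ} (hk : 0 < k) (hfk : f ≤ k) (t : ℕ) :
    ∀ v ∈ sweep f k t, v ≤ t := by
  induction t with
  | zero => simp [sweep]
  | succ t ih =>
    intro v hv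
    simp only [sweep, List.mem_append, mem_backAndForth (backTo_le hk hfk t),
      List.mem_singleton] at hv
    rcases hv with h | h | h
    · exact (ih v h).trans (Nat.le_succ t)
    · omega
    · omega

theorem isChain_backAndForth {y t : ℕ} (h : y ≤ t) : (backAndForth y t ++ [t + 1]).IsChain Near := by
  obtain ⟨n, rfl⟩ := Nat.exists_eq_add_of_le h
  have h1 : ∀ a m, (List.range' a m).IsChain Near := fun a m =>
    (List.isChain_range' a m 1).imp fun u v h => by rw [Near]; omega
  have h2 : (List.range' y (y + n + 1 - y)).reverse.IsChain Near := by
    rw [List.isChain_reverse]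
    refine (h1 _ _).imp fun u v h => ?_
    rw [Near] at h ⊢; exact ⟨h.2, h.1⟩
  have h3 : List.range' (y + 1) (y + n - y) ++ [y + n + 1] = List.range' (y + 1) (n + 1) := by
    rw [List.range'_concat, Nat.add_sub_cancel_left]; congr 2; ring
  rw [backAndForth, List.append_assoc, h3]
  refine List.isChain_append.2 ⟨h2, h1 _ _, ?_⟩
  intro a ha b hb
  rw [show y + n + 1 - y = n + 1 by omega, List.getLast?_reverse, List.range'_succ] at ha
  rw [List.range'_succ] at hb
  simp only [List.head?_cons, Option.mem_def, Option.some_inj] at ha hb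
  rw [Near]; omega

theorem sweep_spec {f k : ℕ} (hk : 0 < k) (hfk : f ≤ k) (t : ℕ) :
    (sweep f k t).IsChain Near ∧ (sweep f k t).getLast? = some t := by
  induction t with
  | zero => simp [sweep]
  | succ t ih =>
    have hle := backTo_le hk hfk t
    refine ⟨?_, by simp [sweep]⟩
    rw [sweep, List.isChain_append]
    refine ⟨ih.1, isChain_backAndForth hle, ?_⟩
    intro a ha b hb
    rw [ih.2] at ha
    have hlen : t + 1 - backTo f k t = (t - backTo f k t) + 1 := by omega
    rw [backAndForth, hlen, List.range'_concat, List.reverse_append] at hb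
    simp only [List.reverse_cons, List.reverse_nil, List.nil_append, List.cons_append,
      List.head?_cons, Option.mem_def, Option.some_inj] at ha hb
    rw [Near]; omega

theorem sweep_mem_requests {P : Type} {f k : ℕ} (hk : 0 < k) (hfk : f ≤ k) {t N : ℕ} (ht : t < N)
    (lab : ℕ → P) : (sweep f k t).map lab ∈ (pathExt N lab).requests :=
  mem_requests_pathExt.2 ⟨sweep f k t, fun v hv => (le_of_mem_sweep hk hfk t v hv).trans_lt ht,
    (sweep_spec hk hfk t).1, rfl⟩

variable {f k : ℕ} {π : ℕ → Perm (Fin (f + 1))}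

theorem blockLab_ne_missing (hk : 0 < k) (x : ℕ) :
    blockLab f k π x ≠ entry (π (x / k)) f := by
  obtain ⟨i, j, hj, rfl⟩ := exists_cell hk x
  rw [cell_div hj]
  by_cases hjf : j < f
  · rw [blockLab_block hj hjf]
    intro h
    have := entry_inj hjf.le le_rfl h
    omega
  · rw [blockLab_sep hj (by omega)]
    have := entry_le (π i) f
    omega

/-- The swept range consists of positions in the cell of `t` and possibly the separator before it,
and separators contain no block pages. So sweeping is free for a memory that lacks just this page.
-/
theorem blockLab_ne_missing_of_backTo_le (hk : 0 < k) (hf : 1 ≤ f) {t x : ℕ}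
    (hx : backTo f k t ≤ x) (hxt : x ≤ t) : blockLab f k π x ≠ entry (π (t / k)) f := by
  obtain ⟨i, j, hj, ht⟩ := exists_cell hk (t + 1)
  rw [backTo_eq hj ht] at hx
  have hcell : ∀ c u, c * k ≤ u → u < c * k + k → u / k = c := fun c u h1 h2 => by
    have := cell_div (k := k) (i := c) (j := u - c * k) (by omega)
    rwa [show c * k + (u - c * k) = u by omega] at this
  by_cases hj0 : j = 0
  · subst hj0
    simp only [if_true] at hx
    obtain ⟨i, rfl⟩ : ∃ i', i = i' + 1 := Nat.exists_eq_succ_of_ne_zero (by rintro rfl; omega)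
    rw [Nat.succ_mul] at ht hx
    rw [hcell i t (by omega) (by omega), ← hcell i x (by omega) (by omega)]
    exact blockLab_ne_missing hk x
  · simp only [hj0, if_false] at hx
    rw [hcell i t (by omega) (by omega)]
    by_cases hxi : i * k ≤ x
    · rw [← hcell i x hxi (by omega)]
      exact blockLab_ne_missing hk x
    · obtain ⟨i, rfl⟩ : ∃ i', i = i' + 1 := Nat.exists_eq_succ_of_ne_zero (by rintro rfl; omega)
      rw [Nat.succ_mul] at hx hxi
      have : x = i * k + (x - i * k) := by omega
      rw [this, blockLab_sep (by omega) (by omega)]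
      have := entry_le (π (i + 1)) f
      omega

variable {P : Type} [DecidableEq P] {pg : ℕ → P}

/-- The offline strategy aims to lack the page that the current cell lacks. The aim changes once per
cell, at the cost of at most one fault; the summand `k` is the cost of the initial filling. -/
theorem opt_sweep_le (hk : 0 < k) (hf : 1 ≤ f) (hfk : f ≤ k) (hpg : Set.InjOn pg (Set.Iic k))
    (t : ℕ) : opt k ((sweep f k t).map fun x => pg (blockLab f k π x)) ≤ k + t / k := by
  set Q := pageSet pg k with hQ
  have hQc : Q.card = k + 1 := card_pageSet hpg
  set e : ℕ → P := fun i => pg (entry (π i) f) with he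
  have heQ : ∀ i, e i ∈ Q := fun i => mem_pageSet ((entry_le _ _).trans hfk)
  have hne : ∀ {x i}, blockLab f k π x ≠ entry (π i) f → pg (blockLab f k π x) ≠ e i :=
    fun {x i} h h' => h (hpg (Set.mem_Iic.2 (blockLab_le hk hfk x))
      (Set.mem_Iic.2 ((entry_le _ _).trans hfk)) h')
  have hmem : ∀ x, pg (blockLab f k π x) ∈ Q := fun x => mem_pageSet (blockLab_le hk hfk x)
  have key : ∀ t, ∃ m, ∃ q ∈ Q,
      Reach k (Q.erase (e 0)) ((sweep f k t).map fun x => pg (blockLab f k π x)) m (Q.erase q) ∧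
        m + (if q = e (t / k) then 0 else 1) ≤ t / k := by
    intro t
    induction t with
    | zero =>
      obtain ⟨m, q, hq, hr, hm⟩ := exists_reach_avoiding hQc (heQ 0)
        ((sweep f k 0).map fun x => pg (blockLab f k π x)) (by
          intro p hp
          simp only [sweep, List.map_cons, List.map_nil, List.mem_singleton] at hp
          subst hp
          refine ⟨hmem 0, hne ?_⟩
          have := blockLab_ne_missing (π := π) (f := f) hk 0
          rwa [Nat.zero_div] at this) (heQ 0)
      exact ⟨m, q, hq, hr, by simpa using hm⟩
    | succ t ih =>
      obtain ⟨m, q, hq, hr, hm⟩ := ih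
      obtain ⟨m₁, q₁, hq₁, hr₁, hm₁⟩ := exists_reach_avoiding hQc (heQ (t / k))
        ((backAndForth (backTo f k t) t).map fun x => pg (blockLab f k π x)) (by
          intro p hp
          obtain ⟨x, hx, rfl⟩ := List.mem_map.1 hp
          rw [mem_backAndForth (backTo_le hk hfk t)] at hx
          exact ⟨hmem x, hne (blockLab_ne_missing_of_backTo_le hk hf hx.1 hx.2)⟩) hq
      obtain ⟨m₂, q₂, hq₂, hr₂, hm₂⟩ := exists_reach_avoiding hQc (heQ ((t + 1) / k))
        [pg (blockLab f k π (t + 1))] (by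
          intro p hp
          obtain rfl := List.mem_singleton.1 hp
          exact ⟨hmem _, hne (blockLab_ne_missing hk _)⟩) hq₁
      refine ⟨m + (m₁ + m₂), q₂, hq₂, ?_, ?_⟩
      · rw [sweep, List.map_append, List.map_append]
        exact hr.trans (hr₁.trans hr₂)
      · by_cases hdiv : (t + 1) / k = t / k
        · rw [hdiv] at hm₂ ⊢; omega
        · have h1 : t / k ≤ (t + 1) / k := Nat.div_le_div_right (Nat.le_succ t)
          have h2 : (if q₁ = e ((t + 1) / k) then 0 else 1) ≤ 1 := by split_ifs <;> simp
          omega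
  obtain ⟨m, q, -, hr, hm⟩ := key t
  obtain ⟨m', hm', hs⟩ := hr.serves.of_subset (Finset.empty_subset _)
  refine (opt_le hs).trans (hm'.trans ?_)
  rw [Finset.sdiff_empty, Finset.card_erase_of_mem (heQ 0), hQc]
  omega

theorem block_cover (hk : 0 < k) (hf : 1 ≤ f) (hfk : f ≤ k) {t i j : ℕ} (hjf : j < f)
    (ht : t + 1 = (i + 1) * k + j) {p : ℕ} (hp : p ≤ k) :
    (∃ x ∈ backAndForth (backTo f k t) t, blockLab f k π x = p) ∨
      ∃ j', j ≤ j' ∧ j' ≤ f ∧ entry (π (i + 1)) j' = p := by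
  have hb := backTo_eq (f := f) (by omega : j < k) ht
  have hle := backTo_le hk hfk t
  have hi : (i + 1) * k = i * k + k := Nat.succ_mul i k
  have hb' : backTo f k t ≤ i * k + f := by rw [hb]; split_ifs <;> omega
  by_cases hpf : p ≤ f
  · obtain ⟨j', hj', rfl⟩ := exists_entry_eq (π (i + 1)) hpf
    by_cases hjj : j ≤ j'
    · exact Or.inr ⟨j', hjj, hj', rfl⟩
    · left
      refine ⟨(i + 1) * k + j', ?_, blockLab_block (by omega) (by omega)⟩
      rw [mem_backAndForth hle]
      omega
  · left
    refine ⟨i * k + (p - 1), ?_, ?_⟩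
    · rw [mem_backAndForth hle]
      omega
    · rw [blockLab_sep (by omega) (by omega)]; omega

/-- This is the purpose of the additional step back in `backTo`: the last page of the preceding
block is touched, so the adversary need not use it as the first entry of the next block. -/
theorem block_cover_first (hk : 0 < k) (hf : 1 ≤ f) (hfk : f ≤ k) {t i : ℕ}
    (ht : t + 1 = (i + 1) * k) :
    ∃ x ∈ backAndForth (backTo f k t) t, blockLab f k π x = entry (π i) (f - 1) := by
  have hb := backTo_eq (f := f) (j := 0) hk (by omega : t + 1 = (i + 1) * k + 0)
  have hi : (i + 1) * k = i * k + k := Nat.succ_mul i k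
  simp only [if_true] at hb
  refine ⟨i * k + (f - 1), ?_, blockLab_block (by omega) (by omega)⟩
  rw [mem_backAndForth (backTo_le hk hfk t)]
  omega

end Sweep

/-! ### Adversarial choice of the blocks -/

section LowerBounds

open Equiv

variable {P : Type} {pg : ℕ → P} {f k : ℕ} {π : ℕ → Perm (Fin (f + 1))}

/-- The requests of the sweeping walk on the block path, up to its first visit of `t`. -/
def sweepReq (pg : ℕ → P) (f k : ℕ) (π : ℕ → Perm (Fin (f + 1))) (t : ℕ) : List P :=
  (sweep f k t).map fun x => pg (blockLab f k π x)

/-- The requests of the sweeping walk between the first visits of `t` and `t + 1`. -/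
def backReq (pg : ℕ → P) (f k : ℕ) (π : ℕ → Perm (Fin (f + 1))) (t : ℕ) : List P :=
  (backAndForth (backTo f k t) t).map fun x => pg (blockLab f k π x)

theorem sweepReq_succ (t : ℕ) : sweepReq pg f k π (t + 1) =
    sweepReq pg f k π t ++ (backReq pg f k π t ++ [pg (blockLab f k π (t + 1))]) := by
  simp [sweepReq, backReq, sweep]

theorem sweepReq_prefix {s t : ℕ} (h : s ≤ t) :
    sweepReq pg f k π s <+: sweepReq pg f k π t := by
  induction h with
  | refl => exact List.prefix_rfl
  | step _ ih => rw [sweepReq_succ]; exact ih.trans (List.prefix_append _ _)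

theorem req_congr (hk : 0 < k) (hfk : f ≤ k) {π' : ℕ → Perm (Fin (f + 1))} {t : ℕ}
    (h : ∀ x ≤ t, blockLab f k π x = blockLab f k π' x) :
    sweepReq pg f k π t = sweepReq pg f k π' t ∧ backReq pg f k π t = backReq pg f k π' t := by
  constructor
  · exact List.map_congr_left fun x hx => by rw [h x (le_of_mem_sweep hk hfk t x hx)]
  · refine List.map_congr_left fun x hx => ?_
    rw [mem_backAndForth (backTo_le hk hfk t)] at hx
    rw [h x hx.2]

theorem blockLab_update_of_lt {i : ℕ} {σ : Perm (Fin (f + 1))} {x : ℕ}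
    (hx : x < i * k) : blockLab f k (Function.update π i σ) x = blockLab f k π x := by
  have : x / k ≠ i := (Nat.div_lt_of_lt_mul (by rwa [mul_comm])).ne
  rw [blockLab, blockLab, Function.update_of_ne this]

theorem entry_mul_swap_of_lt {σ : Perm (Fin (f + 1))} {j : ℕ} {a b : Fin (f + 1)}
    (ha : j < a) (hb : j < b) : entry (σ * swap a b) j = entry σ j := by
  have hj : j < f + 1 := ha.trans a.2
  have h1 := entry_val (σ * swap a b) ⟨j, hj⟩
  have h2 := entry_val σ ⟨j, hj⟩
  simp only at h1 h2
  rw [h1, h2, Perm.mul_apply, swap_apply_of_ne_of_ne]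
  · rintro rfl; exact lt_irrefl _ ha
  · rintro rfl; exact lt_irrefl _ hb

theorem entry_mul_swap (σ : Perm (Fin (f + 1))) (a b : Fin (f + 1)) :
    entry (σ * swap a b) a = entry σ b := by
  rw [entry_val, entry_val, Perm.mul_apply, swap_apply_left]

/-- Exchanging two entries from position `a` on leaves the earlier requests unchanged, so the next
page can be chosen after the strategy has committed itself to its memory. -/
theorem blockLab_update_swap (hfk : f ≤ k) {i : ℕ} {σ : Perm (Fin (f + 1))}
    {a b : Fin (f + 1)} (hab : a ≤ b) {x : ℕ} (hx : x < i * k + a) :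
    blockLab f k (Function.update π i (σ * swap a b)) x =
      blockLab f k (Function.update π i σ) x := by
  by_cases hxi : x < i * k
  · rw [blockLab_update_of_lt hxi, blockLab_update_of_lt hxi]
  · have hx' : x = i * k + (x - i * k) := by omega
    have ha := a.2
    rw [hx', blockLab_block (by omega) (by omega), blockLab_block (by omega) (by omega),
      Function.update_self, Function.update_self, entry_mul_swap_of_lt (by omega)]
    have : (a : ℕ) ≤ b := hab
    omega

variable [DecidableEq P]

/-- In each step of the walk within a block, some choice of the next page forces a fault. -/
theorem exists_step_fault (hk : 0 < k) (hf : 1 ≤ f) (hfk : f ≤ k) (hpg : Set.InjOn pg (Set.Iic k))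
    (a : DetAlg P k) {t i : ℕ} {j : Fin (f + 1)} (hj : (j : ℕ) < f)
    (ht : t + 1 = (i + 1) * k + j) :
    ∃ j', j ≤ j' ∧ a.faults (sweepReq pg f k π t) < a.faults (sweepReq pg f k π t ++
      (backReq pg f k π t ++ [pg (entry (π (i + 1)) (j' : Fin (f + 1)))])) := by
  have hcover : ∀ q ∈ pageSet pg k, q ∈ backReq pg f k π t ∨
      q ∈ (Finset.univ.filter fun j' : Fin (f + 1) => j ≤ j').image
        fun j' : Fin (f + 1) => pg (entry (π (i + 1)) j') := by
    intro q hq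
    obtain ⟨p, hp, rfl⟩ := Finset.mem_image.1 hq
    rcases block_cover (π := π) hk hf hfk hj ht (Nat.le_of_lt_succ (Finset.mem_range.1 hp)) with
      ⟨x, hx, rfl⟩ | ⟨j', h1, h2, rfl⟩
    · exact Or.inl (List.mem_map_of_mem hx)
    · right
      exact Finset.mem_image.2 ⟨⟨j', Nat.lt_succ_of_le h2⟩,
        Finset.mem_filter.2 ⟨Finset.mem_univ _, h1⟩, rfl⟩
  obtain ⟨p, hp, h⟩ := a.exists_fault (sweepReq pg f k π t) _ (pageSet pg k)
    (by rw [card_pageSet hpg]; omega) _ ⟨_, Finset.mem_image_of_mem _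
      (Finset.mem_filter.2 ⟨Finset.mem_univ _, le_refl j⟩)⟩ hcover
  obtain ⟨j', hj', rfl⟩ := Finset.mem_image.1 hp
  exact ⟨j', (Finset.mem_filter.1 hj').2, h⟩

/-- The same for the first step within a block, where the last page of the preceding block is not
chosen. -/
theorem exists_first_fault (hk : 0 < k) (hf : 1 ≤ f) (hfk : f ≤ k) (hpg : Set.InjOn pg (Set.Iic k))
    (a : DetAlg P k) {t i : ℕ} (ht : t + 1 = (i + 1) * k) :
    ∃ j' : Fin (f + 1), entry (π (i + 1)) j' ≠ entry (π i) (f - 1) ∧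
      a.faults (sweepReq pg f k π t) < a.faults (sweepReq pg f k π t ++
        (backReq pg f k π t ++ [pg (entry (π (i + 1)) j')])) := by
  have hne : ∃ j' : Fin (f + 1), entry (π (i + 1)) j' ≠ entry (π i) (f - 1) := by
    by_contra! hcon
    have h0 := hcon ⟨0, by omega⟩
    have h1 := hcon ⟨1, by omega⟩
    have := entry_inj (by omega) (by omega) (h0.trans h1.symm)
    simp at this
  obtain ⟨j₀, hj₀⟩ := hne
  have hcover : ∀ q ∈ pageSet pg k, q ∈ backReq pg f k π t ∨
      q ∈ (Finset.univ.filter fun j' : Fin (f + 1) =>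
        entry (π (i + 1)) j' ≠ entry (π i) (f - 1)).image
          fun j' : Fin (f + 1) => pg (entry (π (i + 1)) j') := by
    intro q hq
    obtain ⟨p, hp, rfl⟩ := Finset.mem_image.1 hq
    rcases block_cover (π := π) hk hf hfk (j := 0) hf (by omega : t + 1 = (i + 1) * k + 0)
      (Nat.le_of_lt_succ (Finset.mem_range.1 hp)) with ⟨x, hx, rfl⟩ | ⟨j', h1, h2, rfl⟩
    · exact Or.inl (List.mem_map_of_mem hx)
    · by_cases hz : entry (π (i + 1)) j' = entry (π i) (f - 1)
      · left
        obtain ⟨x, hx, hx'⟩ := block_cover_first (π := π) hk hf hfk ht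
        rw [hz, ← hx']
        exact List.mem_map_of_mem hx
      · right
        exact Finset.mem_image.2 ⟨⟨j', Nat.lt_succ_of_le h2⟩,
          Finset.mem_filter.2 ⟨Finset.mem_univ _, hz⟩, rfl⟩
  obtain ⟨p, hp, h⟩ := a.exists_fault (sweepReq pg f k π t) _ (pageSet pg k)
    (by rw [card_pageSet hpg]; omega) _
    (by exact ⟨_, Finset.mem_image_of_mem _ (Finset.mem_filter.2 ⟨Finset.mem_univ j₀, hj₀⟩)⟩) hcover
  obtain ⟨j', hj', rfl⟩ := Finset.mem_image.1 hp
  exact ⟨j', (Finset.mem_filter.1 hj').2, h⟩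

/-- Against a deterministic strategy, a block can be chosen such that all its entries cause
faults. -/
theorem exists_det_block (hk : 0 < k) (hf : 1 ≤ f) (hfk : f ≤ k) (hpg : Set.InjOn pg (Set.Iic k))
    (a : DetAlg P k) (π : ℕ → Perm (Fin (f + 1))) (i : ℕ) (j : ℕ) (hj : j ≤ f) :
    ∃ σ : Perm (Fin (f + 1)), (1 ≤ j → entry σ 0 ≠ entry (π i) (f - 1)) ∧
      a.faults (sweepReq pg f k π ((i + 1) * k - 1)) + j ≤
        a.faults (sweepReq pg f k (Function.update π (i + 1) σ) ((i + 1) * k + j - 1)) := by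
  have hi : (i + 1) * k = i * k + k := Nat.succ_mul i k
  induction j with
  | zero =>
    refine ⟨π (i + 1), by simp, ?_⟩
    rw [Function.update_eq_self]; simp
  | succ j ih =>
    obtain ⟨σ, hσ, hfaults⟩ := ih (by omega)
    set π' := Function.update π (i + 1) σ with hπ'
    obtain ⟨t, ht⟩ : ∃ t, t + 1 = (i + 1) * k + j := ⟨(i + 1) * k + j - 1, by omega⟩
    have ht' : (i + 1) * k + j - 1 = t := by omega
    rw [ht'] at hfaults
    have hself : π' (i + 1) = σ := Function.update_self ..
    have hπi : π' i = π i := Function.update_of_ne (by omega) _ _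
    set J : Fin (f + 1) := ⟨j, by omega⟩ with hJ
    obtain ⟨j', hjj', hz, hlt⟩ : ∃ j' : Fin (f + 1), J ≤ j' ∧
        (j = 0 → entry σ j' ≠ entry (π i) (f - 1)) ∧
        a.faults (sweepReq pg f k π' t) < a.faults (sweepReq pg f k π' t ++
          (backReq pg f k π' t ++ [pg (entry σ j')])) := by
      by_cases h0 : j = 0
      · obtain ⟨j', h1, h2⟩ := exists_first_fault (π := π') hk hf hfk hpg a (t := t) (i := i)
          (by omega)
        rw [hself] at h1 h2
        rw [hπi] at h1
        exact ⟨j', by simp [hJ, h0], fun _ => h1, h2⟩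
      · obtain ⟨j', h1, h2⟩ := exists_step_fault (π := π') hk hf hfk hpg a (t := t) (i := i)
          (j := J) hj ht
        rw [hself] at h2
        exact ⟨j', h1, fun h => absurd h h0, h2⟩
    -- The entry that causes the fault is moved to position `j`.
    refine ⟨σ * swap J j', fun _ => ?_, ?_⟩
    · by_cases h0 : j = 0
      · have := entry_mul_swap σ J j'
        simp only [hJ, h0] at this
        rw [show (⟨0, by omega⟩ : Fin (f + 1)) = ⟨j, by omega⟩ by simp [h0]] at this
        rw [this]; exact hz h0
      · have hj0 : 0 < j := by omega
        rw [entry_mul_swap_of_lt (a := J) (b := j') hj0 (hj0.trans_le hjj')]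
        exact hσ (by omega)
    · have hcongr := req_congr (pg := pg) hk hfk (t := t)
        (π := Function.update π (i + 1) (σ * swap J j')) (π' := π')
        (fun x hx => blockLab_update_swap hfk hjj' (by simp only [hJ]; omega))
      rw [show (i + 1) * k + (j + 1) - 1 = t + 1 by omega, sweepReq_succ, hcongr.1, hcongr.2, ht,
        blockLab_block (by omega) (by omega), Function.update_self]
      have := entry_mul_swap σ J j'
      simp only [hJ] at this
      rw [this]
      omega

theorem exists_det_blocks (hk : 0 < k) (hf : 1 ≤ f) (hfk : f ≤ k)
    (hpg : Set.InjOn pg (Set.Iic k)) (a : DetAlg P k) (m : ℕ) :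
    ∃ π : ℕ → Perm (Fin (f + 1)), (∀ i < m, entry (π (i + 1)) 0 ≠ entry (π i) (f - 1)) ∧
      f * m ≤ a.faults (sweepReq pg f k π ((m + 1) * k - 1)) := by
  induction m with
  | zero => exact ⟨fun _ => 1, by simp, by simp⟩
  | succ m ih =>
    obtain ⟨π, h1, h2⟩ := ih
    obtain ⟨σ, h3, h4⟩ := exists_det_block hk hf hfk hpg a π m f le_rfl
    have hi : (m + 1 + 1) * k = (m + 1) * k + k := Nat.succ_mul _ k
    refine ⟨Function.update π (m + 1) σ, fun i hi => ?_, ?_⟩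
    · rcases (Nat.le_of_lt_succ hi).eq_or_lt with rfl | hlt
      · rw [Function.update_self, Function.update_of_ne (by omega)]
        exact h3 hf
      · rw [Function.update_of_ne (by omega), Function.update_of_ne (by omega)]
        exact h1 i hlt
    · obtain ⟨τ, hτ⟩ := sweepReq_prefix (pg := pg) (f := f) (k := k)
        (π := Function.update π (m + 1) σ) (s := (m + 1) * k + f - 1) (t := (m + 1 + 1) * k - 1)
        (by omega)
      have := a.faults_le_append (sweepReq pg f k (Function.update π (m + 1) σ)
        ((m + 1) * k + f - 1)) τ
      rw [hτ] at this
      rw [Nat.mul_succ]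
      omega

/-! ### Randomized strategies -/

/-- The probability of a fault between the first visits of `t` and `t + 1`. -/
noncomputable def stepProb (μ : RandAlg P k) (pg : ℕ → P) (f : ℕ) (π : ℕ → Perm (Fin (f + 1)))
    (t : ℕ) : ℝ :=
  ((μ : Measure (DetAlg P k)) {a | a.faults (sweepReq pg f k π t) <
    a.faults (sweepReq pg f k π (t + 1))}).toReal

theorem stepProb_nonneg (μ : RandAlg P k) (t : ℕ) : 0 ≤ stepProb μ pg f π t :=
  ENNReal.toReal_nonneg

theorem stepProb_le_one (μ : RandAlg P k) (t : ℕ) : stepProb μ pg f π t ≤ 1 :=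
  ENNReal.toReal_le_of_le_ofReal zero_le_one (by simpa using prob_le_one)

theorem randCost_add_sum_stepProb_le (μ : RandAlg P k) (t j : ℕ) :
    randCost μ (sweepReq pg f k π t) +
      ENNReal.ofReal (∑ r ∈ Finset.range j, stepProb μ pg f π (t + r)) ≤
      randCost μ (sweepReq pg f k π (t + j)) := by
  induction j with
  | zero => simp
  | succ j ih =>
    rw [Finset.sum_range_succ, ENNReal.ofReal_add
      (Finset.sum_nonneg fun r _ => stepProb_nonneg μ _) (stepProb_nonneg μ _), ← add_assoc]
    refine (add_le_add_left ih _).trans ?_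
    rw [stepProb, ENNReal.ofReal_toReal (measure_ne_top _ _), ← add_assoc t j 1,
      sweepReq_succ (t + j)]
    exact randCost_add_le μ _ _

/-- Every deterministic strategy faults for at least one of the possible next entries
(`exists_step_fault`), so the fault events cover the whole probability space. -/
theorem sum_stepProb_swap_ge (hk : 0 < k) (hf : 1 ≤ f) (hfk : f ≤ k)
    (hpg : Set.InjOn pg (Set.Iic k)) (μ : RandAlg P k) (π : ℕ → Perm (Fin (f + 1))) (i : ℕ)
    {j : Fin (f + 1)} (hj : (j : ℕ) < f) {t : ℕ} (ht : t + 1 = (i + 1) * k + j)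
    (σ : Perm (Fin (f + 1))) :
    1 ≤ ∑ j' ∈ Finset.univ.filter fun j' => j ≤ j',
      stepProb μ pg f (Function.update π (i + 1) (σ * swap j j')) t := by
  set π' := Function.update π (i + 1) σ with hπ'
  set E : Fin (f + 1) → Set (DetAlg P k) := fun j' =>
    {a | a.faults (sweepReq pg f k π' t) < a.faults (sweepReq pg f k π' t ++
      (backReq pg f k π' t ++ [pg (entry σ j')]))} with hE
  have hstep : ∀ j' ∈ Finset.univ.filter fun j' => j ≤ j',
      stepProb μ pg f (Function.update π (i + 1) (σ * swap j j')) t =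
        ((μ : Measure (DetAlg P k)) (E j')).toReal := by
    intro j' hj'
    have hjj' : j ≤ j' := (Finset.mem_filter.1 hj').2
    have hcongr := req_congr (pg := pg) hk hfk (t := t)
      (π := Function.update π (i + 1) (σ * swap j j')) (π' := π')
      (fun x hx => blockLab_update_swap hfk hjj' (by omega))
    rw [stepProb, sweepReq_succ, hcongr.1, hcongr.2, ht, blockLab_block (by omega) hj,
      Function.update_self, entry_mul_swap]
  rw [Finset.sum_congr rfl hstep, ← ENNReal.toReal_sum fun _ _ => measure_ne_top _ _]
  have hcover : (Set.univ : Set (DetAlg P k)) ⊆ ⋃ j' ∈ Finset.univ.filter fun j' => j ≤ j', E j' := by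
    intro a _
    obtain ⟨j', h1, h2⟩ := exists_step_fault (π := π') hk hf hfk hpg a hj ht
    rw [hπ', Function.update_self] at h2
    exact Set.mem_biUnion (Finset.mem_coe.2 (Finset.mem_filter.2 ⟨Finset.mem_univ _, h1⟩)) h2
  have h1 : (1 : ℝ≥0∞) ≤ ∑ j' ∈ Finset.univ.filter fun j' => j ≤ j',
      (μ : Measure (DetAlg P k)) (E j') := by
    rw [← measure_univ (μ := (μ : Measure (DetAlg P k)))]
    exact (measure_mono hcover).trans (measure_biUnion_finset_le _ _)
  have h2 : (∑ j' ∈ Finset.univ.filter fun j' => j ≤ j',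
      (μ : Measure (DetAlg P k)) (E j')) ≠ ∞ :=
    (ENNReal.sum_lt_top.2 fun _ _ => measure_lt_top _ _).ne
  rw [← ENNReal.toReal_one]
  exact ENNReal.toReal_mono h2 h1

/-- After summation over all permutations, the `f + 1 - j` terms of `sum_stepProb_swap_ge` coincide,
because multiplication by a transposition permutes the permutations. -/
theorem sum_perm_stepProb_ge (hk : 0 < k) (hf : 1 ≤ f) (hfk : f ≤ k)
    (hpg : Set.InjOn pg (Set.Iic k)) (μ : RandAlg P k) (π : ℕ → Perm (Fin (f + 1))) (i : ℕ)
    {j : ℕ} (hj : j < f) {t : ℕ} (ht : t + 1 = (i + 1) * k + j) :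
    ((f + 1).factorial : ℝ) * ((f + 1 - j : ℕ) : ℝ)⁻¹ ≤
      ∑ σ : Perm (Fin (f + 1)), stepProb μ pg f (Function.update π (i + 1) σ) t := by
  set J : Fin (f + 1) := ⟨j, by omega⟩ with hJ
  set S := ∑ σ : Perm (Fin (f + 1)), stepProb μ pg f (Function.update π (i + 1) σ) t with hS
  have h1 : ∑ σ : Perm (Fin (f + 1)), (1 : ℝ) ≤ ∑ σ : Perm (Fin (f + 1)),
      ∑ j' ∈ Finset.univ.filter fun j' => J ≤ j',
        stepProb μ pg f (Function.update π (i + 1) (σ * swap J j')) t :=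
    Finset.sum_le_sum fun σ _ => sum_stepProb_swap_ge hk hf hfk hpg μ π i (j := J) hj ht σ
  have h2 : ∀ j' ∈ Finset.univ.filter fun j' => J ≤ j', ∑ σ : Perm (Fin (f + 1)),
      stepProb μ pg f (Function.update π (i + 1) (σ * swap J j')) t = S := fun j' _ =>
    sum_perm_mul_swap Finset.univ J j' (fun _ _ => Finset.mem_univ _)
      fun σ => stepProb μ pg f (Function.update π (i + 1) σ) t
  have hcard : (Finset.univ.filter fun j' : Fin (f + 1) => J ≤ j').card = f + 1 - j := by
    rw [Finset.filter_le_eq_Ici, Fin.card_Ici]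
  rw [Finset.sum_comm, Finset.sum_congr rfl h2, Finset.sum_const, Finset.sum_const,
    Finset.card_univ, Fintype.card_perm, Fintype.card_fin, nsmul_eq_mul, mul_one, nsmul_eq_mul,
    hcard] at h1
  have hpos : (0 : ℝ) < ((f + 1 - j : ℕ) : ℝ) := by exact_mod_cast (by omega : 0 < f + 1 - j)
  rw [← div_eq_mul_inv, div_le_iff₀ hpos, mul_comm S]
  exact h1

theorem sum_inv_eq_harmonic (f : ℕ) :
    ∑ j ∈ Finset.range f, ((f + 1 - j : ℕ) : ℝ)⁻¹ = (harmonic (f + 1) : ℝ) - 1 := by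
  rw [harmonic, Finset.sum_range_succ']
  push_cast
  rw [← Finset.sum_range_reflect (fun j => ((j : ℝ) + 1 + 1)⁻¹)]
  simp only [inv_one, add_sub_cancel_right]
  refine Finset.sum_congr rfl fun j hj => ?_
  have hj := Finset.mem_range.1 hj
  have : f + 1 - j = (f - 1 - j) + 1 + 1 := by omega
  rw [this]; push_cast; rfl

/-- Against a randomized strategy, a block can be chosen such that it forms a good pair with the
preceding one and causes many faults. -/
theorem exists_rand_block (hk : 0 < k) (hf : 2 ≤ f) (hfk : f ≤ k)
    (hpg : Set.InjOn pg (Set.Iic k)) (hH : 2 ≤ (harmonic (f + 1) : ℝ)) (μ : RandAlg P k)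
    (π : ℕ → Perm (Fin (f + 1))) (i : ℕ) :
    ∃ σ : Perm (Fin (f + 1)), Good (π i) σ ∧
      randCost μ (sweepReq pg f k π ((i + 1) * k - 1)) +
        ENNReal.ofReal ((harmonic (f + 1) : ℝ) - 2) ≤
        randCost μ (sweepReq pg f k (Function.update π (i + 1) σ) ((i + 1) * k - 1 + f)) := by
  classical
  have hi : (i + 1) * k = i * k + k := Nat.succ_mul i k
  set t := (i + 1) * k - 1 with ht
  set V : Perm (Fin (f + 1)) → ℝ := fun σ =>
    ∑ j ∈ Finset.range f, stepProb μ pg f (Function.update π (i + 1) σ) (t + j) with hV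
  have hV1 : ∀ σ, V σ ≤ f := fun σ => by
    refine (Finset.sum_le_card_nsmul _ _ 1 fun j _ => stepProb_le_one μ _).trans ?_
    simp
  have htotal : ((f + 1).factorial : ℝ) * ((harmonic (f + 1) : ℝ) - 1) ≤ ∑ σ, V σ := by
    rw [Finset.sum_comm, ← sum_inv_eq_harmonic, Finset.mul_sum]
    refine Finset.sum_le_sum fun j hj => ?_
    have hj := Finset.mem_range.1 hj
    exact sum_perm_stepProb_ge hk (by omega) hfk hpg μ π i hj (by omega)
  have hbad := card_not_good_le hf (π i)
  have hsplit := Finset.sum_filter_add_sum_filter_not Finset.univ (fun σ => Good (π i) σ) V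
  -- A block has value at most `f`, and at most one in `f + 1` permutations is bad. So excluding the
  -- bad ones lowers the average by at most one, from `H - 1` to `H - 2`.
  have hbadV : ∑ σ ∈ Finset.univ.filter fun σ => ¬ Good (π i) σ, V σ ≤ (f + 1).factorial := by
    refine (Finset.sum_le_card_nsmul _ _ (f : ℝ) fun σ _ => hV1 σ).trans ?_
    rw [nsmul_eq_mul, mul_comm]
    refine le_trans ?_ hbad
    gcongr
    simp
  have hgood : ((f + 1).factorial : ℝ) * ((harmonic (f + 1) : ℝ) - 2) ≤
      ∑ σ ∈ Finset.univ.filter fun σ => Good (π i) σ, V σ := by linarith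
  have hne : (Finset.univ.filter fun σ => Good (π i) σ).Nonempty := by
    by_contra hemp
    rw [Finset.not_nonempty_iff_eq_empty] at hemp
    have h1 := Finset.card_filter_add_card_filter_not (s := (Finset.univ : Finset (Perm (Fin (f + 1)))))
      (fun σ => Good (π i) σ)
    rw [hemp, Finset.card_empty, zero_add, Finset.card_univ, Fintype.card_perm,
      Fintype.card_fin] at h1
    rw [h1] at hbad
    have h2 : (0 : ℝ) < (f + 1).factorial := by positivity
    have h3 : (3 : ℝ) ≤ (f + 1 : ℕ) := by exact_mod_cast (by omega : 3 ≤ f + 1)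
    nlinarith
  have hcardle : ((Finset.univ.filter fun σ => Good (π i) σ).card : ℝ) ≤ (f + 1).factorial := by
    have := Finset.card_le_univ (Finset.univ.filter fun σ => Good (π i) σ)
    rw [Fintype.card_perm, Fintype.card_fin] at this
    exact_mod_cast this
  obtain ⟨σ, hσ, hle⟩ := Finset.exists_le_of_sum_le (f := fun _ => (harmonic (f + 1) : ℝ) - 2)
    (g := V) hne (by
      rw [Finset.sum_const, nsmul_eq_mul]
      exact (mul_le_mul_of_nonneg_right hcardle (by linarith)).trans hgood)
  refine ⟨σ, (Finset.mem_filter.1 hσ).2, ?_⟩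
  have hcongr := req_congr (pg := pg) hk hfk (t := t) (π := π) (π' := Function.update π (i + 1) σ)
    (fun x hx => (blockLab_update_of_lt (by omega)).symm)
  rw [hcongr.1]
  exact (add_le_add_right (ENNReal.ofReal_le_ofReal hle) _).trans
    (randCost_add_sum_stepProb_le μ t f)

theorem exists_rand_blocks (hk : 0 < k) (hf : 2 ≤ f) (hfk : f ≤ k)
    (hpg : Set.InjOn pg (Set.Iic k)) (hH : 2 ≤ (harmonic (f + 1) : ℝ)) (μ : RandAlg P k) (m : ℕ) :
    ∃ π : ℕ → Perm (Fin (f + 1)), (∀ i < m, Good (π i) (π (i + 1))) ∧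
      m * ENNReal.ofReal ((harmonic (f + 1) : ℝ) - 2) ≤
        randCost μ (sweepReq pg f k π ((m + 1) * k - 1)) := by
  induction m with
  | zero => exact ⟨fun _ => 1, by simp, by simp⟩
  | succ m ih =>
    obtain ⟨π, h1, h2⟩ := ih
    obtain ⟨σ, h3, h4⟩ := exists_rand_block hk hf hfk hpg hH μ π m
    have hi : (m + 1 + 1) * k = (m + 1) * k + k := Nat.succ_mul _ k
    have hpos : 0 < (m + 1) * k := Nat.mul_pos (Nat.succ_pos m) hk
    refine ⟨Function.update π (m + 1) σ, fun i hi => ?_, ?_⟩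
    · rcases (Nat.le_of_lt_succ hi).eq_or_lt with rfl | hlt
      · rw [Function.update_self, Function.update_of_ne (by omega)]
        exact h3
      · rw [Function.update_of_ne (by omega), Function.update_of_ne (by omega)]
        exact h1 i hlt
    · obtain ⟨τ, hτ⟩ := sweepReq_prefix (pg := pg) (f := f) (k := k)
        (π := Function.update π (m + 1) σ) (s := (m + 1) * k - 1 + f) (t := (m + 1 + 1) * k - 1)
        (by omega)
      have h5 := randCost_le_append μ (sweepReq pg f k (Function.update π (m + 1) σ)
        ((m + 1) * k - 1 + f)) τ
      rw [hτ] at h5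
      refine le_trans ?_ (h4.trans h5)
      push_cast
      rw [add_mul, one_mul]
      exact add_le_add_left h2 _

end LowerBounds

/-! ### Numerical estimates -/

section Estimates

theorem le_log_three : (1.02 : ℝ) ≤ Real.log 3 := by
  have h := Real.one_sub_inv_le_log_of_pos (show (0 : ℝ) < 3 / 2 by norm_num)
  rw [Real.log_div (by norm_num) (by norm_num)] at h
  have := Real.log_two_gt_d9
  norm_num at h
  linarith

theorem natLog_add_two_le {k m : ℕ} (hk : 2 ≤ k) (hm : m ≤ k ^ 9) :
    ((Nat.log 2 m + 2 : ℕ) : ℝ) ≤ 100 * Real.log k := by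
  have hk' : (2 : ℝ) ≤ k := by exact_mod_cast hk
  have h1 : (2 : ℝ) ^ Nat.log 2 m ≤ (k : ℝ) ^ 9 := by
    have : 2 ^ Nat.log 2 (k ^ 9) ≤ k ^ 9 := Nat.pow_log_le_self 2 (by positivity)
    exact_mod_cast (Nat.pow_le_pow_right two_pos (Nat.log_mono_right hm)).trans this
  have h2 := Real.log_le_log (by positivity) h1
  rw [Real.log_pow, Real.log_pow] at h2
  have h3 := Real.log_le_log two_pos hk'
  have h4 := Real.log_two_gt_d9
  push_cast at h2 ⊢
  have h5 : (0 : ℝ) ≤ Nat.log 2 m := by positivity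
  nlinarith

theorem clog_mul_log_two_le {m : ℕ} (hm : 2 ≤ m) :
    (Nat.clog 2 m : ℝ) * Real.log 2 ≤ Real.log m + Real.log 2 := by
  have h1 : (2 : ℝ) ^ (Nat.clog 2 m).pred ≤ m := by
    exact_mod_cast (Nat.pow_pred_clog_lt_self one_lt_two hm).le
  have h2 := Real.log_le_log (by positivity) h1
  rw [Real.log_pow] at h2
  have h3 : 0 < Nat.clog 2 m := Nat.clog_pos one_lt_two hm
  have h4 : ((Nat.clog 2 m).pred : ℝ) = Nat.clog 2 m - 1 := by
    rw [Nat.pred_eq_sub_one, Nat.cast_sub h3, Nat.cast_one]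
  rw [h4] at h2
  linarith

theorem four_le_log {f : ℕ} (hf : 64 ≤ f) : 4 ≤ Real.log f := by
  have h1 : Real.log ((2 : ℝ) ^ 6) ≤ Real.log f :=
    Real.log_le_log (by norm_num) (by norm_num; exact_mod_cast hf)
  rw [Real.log_pow] at h1
  have := Real.log_two_gt_d9
  push_cast at h1
  linarith

theorem one_le_log_log {f : ℕ} (hf : 64 ≤ f) : 1 ≤ Real.log (Real.log f) := by
  have h1 : Real.log ((2 : ℝ) ^ 2) ≤ Real.log (Real.log f) :=
    Real.log_le_log (by norm_num) (by norm_num; exact four_le_log hf)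
  rw [Real.log_pow] at h1
  have := Real.log_two_gt_d9
  push_cast at h1
  linarith

theorem pairRank_bound {f : ℕ} (hf : 64 ≤ f) :
    ((2 * (pairRank (f - 1) + 4) + 1 : ℕ) : ℝ) ≤ 60 * Real.log (Real.log f) := by
  have hl2 := Real.log_two_gt_d9
  have hl2' := Real.log_two_lt_d9
  have hlf := four_le_log hf
  have hL := one_le_log_log hf
  have h6 : 6 ≤ Nat.clog 2 f := by
    by_contra! h
    have := Nat.le_pow_clog one_lt_two f
    have := Nat.pow_le_pow_right two_pos (Nat.le_of_lt_succ h)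
    omega
  have h1 := clog_mul_log_two_le (show 2 ≤ f by omega)
  have h2 := clog_mul_log_two_le (show 2 ≤ Nat.clog 2 f by omega)
  have h3 : (Nat.clog 2 f : ℝ) ≤ 2 ^ 2 * Real.log f := by nlinarith
  have h4 : Real.log (Nat.clog 2 f) ≤ Real.log (2 ^ 2 * Real.log f) :=
    Real.log_le_log (by exact_mod_cast (by omega : 0 < Nat.clog 2 f)) h3
  rw [Real.log_mul (by norm_num) (by linarith), Real.log_pow] at h4
  push_cast at h4
  have h5 : (Nat.clog 2 (Nat.clog 2 f) : ℝ) ≤ 6 * Real.log (Real.log f) := by nlinarith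
  rw [pairRank, show f - 1 + 1 = f by omega]
  push_cast
  linarith

/-- The critical cases are `f = 2`, where `log (log 2)` is negative and `k ≥ 3` just compensates for
it, and `f = 3`, where `log (log f)` is barely positive. The small margins explain the factor 100.
For `f = 1` the iterated logarithm is `Real.log 0 = 0`. -/
theorem one_le_log_sub_log {f k : ℕ} (hf : 0 < f) (hfk : f < k) :
    1 ≤ 100 * (Real.log k - Real.log f + Real.log (Real.log f)) := by
  have hl2 := Real.log_two_gt_d9
  have hl3 := le_log_three
  have hmono : Real.log f ≤ Real.log k :=
    Real.log_le_log (by exact_mod_cast hf) (by exact_mod_cast hfk.le)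
  rcases (by omega : f = 1 ∨ f = 2 ∨ 3 ≤ f) with rfl | rfl | h3
  · have : Real.log 2 ≤ Real.log k := Real.log_le_log two_pos (by exact_mod_cast hfk)
    simp only [Nat.cast_one, Real.log_one, Real.log_zero]
    linarith
  · have h1 : Real.log 3 ≤ Real.log k := Real.log_le_log (by norm_num) (by exact_mod_cast hfk)
    have h2 := Real.one_sub_inv_le_log_of_pos (show (0 : ℝ) < 3 / 2 * Real.log 2 by positivity)
    rw [Real.log_mul (by norm_num) (by positivity), Real.log_div (by norm_num) (by norm_num)] at h2
    have h4 : (3 / 2 * Real.log 2)⁻¹ ≤ (1.03 : ℝ)⁻¹ := inv_anti₀ (by norm_num) (by linarith)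
    norm_num at h4 h2 ⊢
    linarith
  · have h1 : Real.log 3 ≤ Real.log f := Real.log_le_log (by norm_num) (by exact_mod_cast h3)
    have h2 := Real.one_sub_inv_le_log_of_pos (show (0 : ℝ) < Real.log f by linarith)
    have h4 : (Real.log f)⁻¹ ≤ (1.02 : ℝ)⁻¹ := inv_anti₀ (by norm_num) (by linarith)
    norm_num at h4
    linarith

theorem log_le_five {f : ℕ} (hf : 0 < f) (hf' : f < 64) : Real.log f ≤ 5 := by
  have h1 : Real.log f ≤ Real.log ((2 : ℝ) ^ 6) :=
    Real.log_le_log (by exact_mod_cast hf) (by norm_num; exact_mod_cast hf'.le)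
  rw [Real.log_pow] at h1
  have := Real.log_two_lt_d9
  push_cast at h1
  linarith

theorem harmonic_bound {f : ℕ} (hf : 64 ≤ f) :
    2 * (1 / 5 * Real.log f) ≤ (harmonic f : ℝ) - 2 ∧ 2 ≤ (harmonic f : ℝ) := by
  have h1 := log_add_one_le_harmonic f
  have h2 : Real.log f ≤ Real.log ↑(f + 1) :=
    Real.log_le_log (by exact_mod_cast (by omega : 0 < f)) (by exact_mod_cast Nat.le_succ f)
  have h3 := four_le_log hf
  constructor <;> linarith

end Estimates

/-! ### The one-vertex graph, used for small `f` -/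

section SmallGraph

variable {P : Type} [DecidableEq P] {k : ℕ}

theorem opt_ne_zero (hk : 0 < k) {σ : List P} (hσ : σ ≠ []) : opt k σ ≠ 0 := by
  have h := card_toFinset_le_opt hk σ
  have : σ.toFinset.card ≠ 0 := by
    rw [Finset.card_ne_zero]
    exact List.toFinset_nonempty_iff _ |>.2 hσ
  omega

/-- The strategy that keeps only the last requested page. -/
def lastPage (hk : 0 < k) : DetAlg P k where
  cache σ := σ.getLast?.toFinset
  cache_nil := rfl
  card_le σ := by
    cases σ.getLast? <;> simp
    omega
  mem_cache σ p := by simp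
  cache_subset σ p := by simp

theorem detRatio_single_le (hk : 0 < k) (p : P) : detRatio (pathExt 1 fun _ => p) k ≤ 1 := by
  refine iInf_le_of_le (lastPage hk) (sInf_le fun σ hσ => ?_)
  obtain ⟨vs, -, -, rfl⟩ := mem_requests_pathExt.1 hσ
  have key : ∀ vs : List ℕ, (lastPage hk).faults (vs.map fun _ => p) ≤ 1 := by
    intro vs
    induction vs using List.reverseRecOn with
    | nil => simp [DetAlg.faults_nil]
    | append_singleton vs v ih =>
      rw [List.map_append, List.map_singleton, DetAlg.faults_append_singleton]
      rcases vs.eq_nil_or_concat with rfl | ⟨ws, w, rfl⟩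
      · simp only [List.map_nil, DetAlg.faults_nil]
        split_ifs <;> simp
      · rw [if_pos (by simp [lastPage])]
        exact ih
  rw [one_mul, detCost, Nat.cast_le]
  rcases vs.eq_nil_or_concat with rfl | ⟨ws, w, rfl⟩
  · simp [DetAlg.faults_nil]
  · exact (key _).trans (Nat.one_le_iff_ne_zero.2 (opt_ne_zero hk (by simp)))

theorem one_le_ratio_single (hk : 0 < k) (p : P) (μ : RandAlg P k) :
    1 ≤ ratio (pathExt 1 fun _ => p) k (randCost μ) := by
  refine le_ratio (σ := [p]) (mem_requests_pathExt.2 ⟨[0], by simp, by simp, by simp⟩)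
    (opt_ne_zero hk (by simp)) ?_
  have h1 : opt k [p] ≤ 1 := by
    refine opt_le (m := 1) ?_
    simpa using Serves.cons (k := k) ∅ {p} p [] 0 (by simp) (by simp) (by rw [Finset.card_singleton]; exact hk) (.nil _)
  have h2 : ∀ a : DetAlg P k, a.faults [p] = 1 := by
    intro a
    have := a.faults_append_singleton [] p
    simpa [DetAlg.faults_nil, a.cache_nil] using this
  simp only [randCost, h2]
  simpa using h1

end SmallGraph

/-! ### The graphs for given `n`, `k` and `f` -/

section Construction

variable {n k f : ℕ}

/-- The pages used by the constructions. -/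
def page (hn : 0 < n) (i : ℕ) : Fin n := ⟨i % n, Nat.mod_lt _ hn⟩

theorem injOn_page (hkn : k < n) : Set.InjOn (page (hkn.trans_le' k.zero_le)) (Set.Iic k) := by
  intro i hi j hj h
  have h' := congrArg Fin.val h
  simp only [Set.mem_Iic] at hi hj
  simpa [page, Nat.mod_eq_of_lt (hi.trans_lt hkn), Nat.mod_eq_of_lt (hj.trans_lt hkn)] using h'

theorem sweepReq_ne_nil {P : Type} {pg : ℕ → P} {π : ℕ → Equiv.Perm (Fin (f + 1))} (t : ℕ) :
    sweepReq pg f k π t ≠ [] := by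
  cases t <;> simp [sweepReq, sweep]

theorem opt_sweepReq_le {P : Type} [DecidableEq P] {pg : ℕ → P}
    {π : ℕ → Equiv.Perm (Fin (f + 1))} (hk : 0 < k) (hf : 1 ≤ f) (hfk : f ≤ k)
    (hpg : Set.InjOn pg (Set.Iic k)) (m : ℕ) :
    opt k (sweepReq pg f k π ((m + 1) * k - 1)) ≤ k + m := by
  refine (opt_sweep_le hk hf hfk hpg _).trans (Nat.add_le_add_left ?_ _)
  refine Nat.le_of_lt_succ (Nat.div_lt_of_lt_mul ?_)
  have : 0 < (m + 1) * k := by positivity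
  rw [mul_comm k]
  exact Nat.sub_one_lt_of_lt this

/-- The lower bound and the upper bound for deterministic algorithms. -/
theorem exists_det_graph (hf : 0 < f) (hfk : f < k) (hkn : k < n)
    (A : ExtGraph (Fin n) → DetAlg (Fin n) k) (hA : TrulyOnline A) :
    ∃ G : ExtGraph (Fin n), ((k - f + 1 : ℕ) : ℕ∞) ≤ G.Delta ∧
      (f : ℝ≥0∞) ≤ ratio G k (detCost (A G)) ∧
      detRatio G k ≤ ENNReal.ofReal (100 * Real.log k) := by
  have hk : 0 < k := by omega
  have hpg := injOn_page hkn
  set pg := page (hkn.trans_le' k.zero_le)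
  -- Blocks of `f + 1` entries, one more than the ratio, and `f * k` of them: `(f + 1) * (f * k) = f
  -- * (k + f * k)`, so the surplus pays for the initial `k` faults of the optimum.
  obtain ⟨π, h1, h2⟩ := exists_det_blocks hk (Nat.succ_pos f) hfk hpg (A (completeExtGraph n))
    (f * k)
  have hpos : 0 < (f * k + 1) * k := by positivity
  have hmem := sweep_mem_requests hk hfk (Nat.sub_one_lt_of_lt hpos)
    fun x => pg (blockLab (f + 1) k π x)
  have hle := fun x => blockLab_le (π := π) hk hfk x
  refine ⟨pathExt ((f * k + 1) * k) fun x => pg (blockLab (f + 1) k π x),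
    le_Delta_pathExt fun x y hxy hy h => ?_, ?_, ?_⟩
  · obtain ⟨h3, h4⟩ := blockLab_dist hk (Nat.succ_pos f) hfk hxy (hpg (hle x) (hle y) h)
    rcases h3.eq_or_lt with h5 | h5
    · rcases h4 h5 with h6 | ⟨i, h6, h7⟩
      · omega
      · exact absurd h6.symm (h1 i (by rw [h7] at hy; have := lt_of_mul_lt_mul_right' hy; omega))
    · omega
  · refine le_ratio hmem (opt_ne_zero hk (sweepReq_ne_nil _)) ?_
    rw [hA.detCost_eq _ _ hmem, detCost]
    have h3 := opt_sweepReq_le (π := π) hk (Nat.succ_pos f) hfk hpg (f * k)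
    have h4 : f * opt k (sweepReq pg (f + 1) k π ((f * k + 1) * k - 1)) ≤
        (A (completeExtGraph n)).faults (sweepReq pg (f + 1) k π ((f * k + 1) * k - 1)) :=
      (Nat.mul_le_mul_left f h3).trans (le_trans (le_of_eq (by rw [Nat.succ_eq_add_one]; ring)) h2)
    exact_mod_cast h4
  · refine (detRatio_pathExt_le hk _ _ (pageSet pg k) (card_pageSet hpg)
      fun x _ => mem_pageSet (hle x)).trans ?_
    rw [← ENNReal.ofReal_natCast]
    refine ENNReal.ofReal_le_ofReal (natLog_add_two_le (by omega) ?_)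
    have h3 : (k + 1) ^ 3 ≤ k ^ 6 := by
      rw [show 6 = 2 * 3 by norm_num, pow_mul]
      exact Nat.pow_le_pow_left (by nlinarith) 3
    have h4 : (f * k + 1) * k ≤ k ^ 3 := by
      obtain ⟨d, rfl⟩ : ∃ d, k = f + 1 + d := ⟨k - (f + 1), by omega⟩
      nlinarith [Nat.zero_le (d * (f + 1 + d))]
    calc (k + 1) ^ 3 * ((f * k + 1) * k) ≤ k ^ 6 * k ^ 3 := Nat.mul_le_mul h3 h4
      _ = k ^ 9 := by ring

/-- The lower bound and the upper bound for randomized algorithms and long blocks. -/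
theorem exists_rand_graph (hf : 64 ≤ f) (hfk : f < k) (hkn : k < n)
    (A : ExtGraph (Fin n) → RandAlg (Fin n) k) (hA : RandTrulyOnline A) :
    ∃ G : ExtGraph (Fin n), ((k - f - 1 : ℕ) : ℕ∞) ≤ G.Delta ∧
      ENNReal.ofReal (1 / 5 * Real.log f) ≤ ratio G k (randCost (A G)) ∧
      oblRatio G k ≤ ENNReal.ofReal (60 * Real.log (Real.log f)) := by
  have hk : 0 < k := by omega
  have hpg := injOn_page hkn
  have hff : f - 1 + 1 = f := by omega
  have hf' : 1 ≤ f - 1 := by omega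
  have hfk' : f - 1 ≤ k := by omega
  obtain ⟨hh1, hh2⟩ := harmonic_bound hf
  set pg := page (hkn.trans_le' k.zero_le)
  -- With `k` blocks the optimum is at most `2 * k`; the factor 2 is accounted for in
  -- `harmonic_bound`.
  obtain ⟨π, h1, h2⟩ := exists_rand_blocks hk (by omega : 2 ≤ f - 1) hfk' hpg (by rwa [hff])
    (A (completeExtGraph n)) k
  have hpos : 0 < (k + 1) * k := by positivity
  have hmem := sweep_mem_requests hk hfk' (Nat.sub_one_lt_of_lt hpos)
    fun x => pg (blockLab (f - 1) k π x)
  have hle := fun x => blockLab_le (π := π) hk hfk' x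
  refine ⟨pathExt ((k + 1) * k) fun x => pg (blockLab (f - 1) k π x),
    le_Delta_pathExt fun x y hxy hy h => ?_, ?_, ?_⟩
  · have h3 := (blockLab_dist hk hf' hfk' hxy (hpg (hle x) (hle y) h)).1
    omega
  · refine le_ratio hmem (opt_ne_zero hk (sweepReq_ne_nil _)) ?_
    rw [hA.randCost_eq _ _ hmem]
    have h3 := opt_sweepReq_le (π := π) hk hf' hfk' hpg k
    rw [hff] at h2
    refine le_trans ?_ h2
    calc ENNReal.ofReal (1 / 5 * Real.log f) *
          (opt k (sweepReq pg (f - 1) k π ((k + 1) * k - 1)) : ℝ≥0∞)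
        ≤ ENNReal.ofReal (1 / 5 * Real.log f) * ((k + k : ℕ) : ℝ≥0∞) := by gcongr
      _ = k * ENNReal.ofReal (2 * (1 / 5 * Real.log f)) := by
          rw [ENNReal.ofReal_mul two_pos.le, ENNReal.ofReal_ofNat]
          push_cast
          ring
      _ ≤ _ := by gcongr
  · refine (oblRatio_le_detRatio _ _).trans
      ((detRatio_blockPath_le hk hf' (by omega) hpg h1).trans ?_)
    rw [← ENNReal.ofReal_natCast]
    exact ENNReal.ofReal_le_ofReal (pairRank_bound hf)

/-- For `f < 64` the required lower bound is at most one, and a single vertex, with `Δ = ⊤`,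
suffices. For larger `f` the bound `O(log log f)` is stronger than required. -/
theorem exists_rand_graph_of_pos (hf : 0 < f) (hfk : f < k) (hkn : k < n)
    (A : ExtGraph (Fin n) → RandAlg (Fin n) k) (hA : RandTrulyOnline A) :
    ∃ G : ExtGraph (Fin n), ((k - f - 1 : ℕ) : ℕ∞) ≤ G.Delta ∧
      ENNReal.ofReal (1 / 5 * Real.log f) ≤ ratio G k (randCost (A G)) ∧
      oblRatio G k ≤
        ENNReal.ofReal (100 * (Real.log k - Real.log f + Real.log (Real.log f))) := by
  by_cases h64 : 64 ≤ f
  · obtain ⟨G, h1, h2, h3⟩ := exists_rand_graph h64 hfk hkn A hA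
    refine ⟨G, h1, h2, h3.trans (ENNReal.ofReal_le_ofReal ?_)⟩
    have h4 := one_le_log_log h64
    have h5 : Real.log f ≤ Real.log k :=
      Real.log_le_log (by exact_mod_cast hf) (by exact_mod_cast hfk.le)
    linarith
  · have hk : 0 < k := by omega
    refine ⟨pathExt 1 fun _ => page (hkn.trans_le' k.zero_le) 0,
      le_Delta_pathExt fun x y hxy hy _ => by omega, ?_, ?_⟩
    · refine le_trans ?_ (one_le_ratio_single hk _ _)
      rw [ENNReal.ofReal_le_one]
      linarith [log_le_five hf (not_le.1 h64)]
    · refine (oblRatio_le_detRatio _ _).trans ((detRatio_single_le hk _).trans ?_)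
      rw [ENNReal.one_le_ofReal]
      exact one_le_log_sub_log hf hfk

end Construction

/-! ### Families of graphs and the failure of very strong competitiveness -/

section Asymptotics

theorem exists_det_graph_family {f : ℕ → ℕ}
    (hf : (fun k : ℕ => Real.log k) =o[atTop] (fun k : ℕ => (f k : ℝ)))
    (A : DetUniform) (hA : ∀ n k hk, TrulyOnline (A n k hk)) :
    ∃ G : ∀ _ n : ℕ, ExtGraph (Fin n),
      (∀ (k n : ℕ) (hk : 0 < k), 0 < f k → f k < k → k < n →
        ((k - f k + 1 : ℕ) : ℕ∞) ≤ (G k n).Delta ∧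
        (f k : ℝ≥0∞) ≤ ratio (G k n) k (detCost (A n k hk (G k n))) ∧
        detRatio (G k n) k ≤ ENNReal.ofReal (100 * Real.log k)) ∧
      ∀ B : ℝ≥0, ∀ᶠ k : ℕ in atTop, ∀ (hk : 0 < k) (n : ℕ), f k < k → k < n →
        B * detRatio (G k n) k ≤ ratio (G k n) k (detCost (A n k hk (G k n))) := by
  have hex : ∀ k n : ℕ, ∃ G : ExtGraph (Fin n), ∀ hk : 0 < k, 0 < f k → f k < k → k < n →
      ((k - f k + 1 : ℕ) : ℕ∞) ≤ G.Delta ∧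
      (f k : ℝ≥0∞) ≤ ratio G k (detCost (A n k hk G)) ∧
      detRatio G k ≤ ENNReal.ofReal (100 * Real.log k) := by
    intro k n
    by_cases h : 0 < k ∧ 0 < f k ∧ f k < k ∧ k < n
    · obtain ⟨G, hG⟩ := exists_det_graph h.2.1 h.2.2.1 h.2.2.2 (A n k h.1) (hA n k h.1)
      exact ⟨G, fun _ _ _ _ => hG⟩
    · exact ⟨completeExtGraph n, fun h1 h2 h3 h4 => absurd ⟨h1, h2, h3, h4⟩ h⟩
  choose G hG using hex
  refine ⟨G, hG, fun B => ?_⟩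
  have hc : (0 : ℝ) < (100 * (B : ℝ) + 1)⁻¹ := by positivity
  filter_upwards [hf.def hc, eventually_ge_atTop 2] with k hB h2 hk n hfk hkn
  have hlog : 0 < Real.log k := Real.log_pos (by exact_mod_cast h2)
  rw [Real.norm_of_nonneg hlog.le, Real.norm_of_nonneg (Nat.cast_nonneg _),
    inv_mul_eq_div, le_div_iff₀ (by positivity)] at hB
  have hB0 : (0 : ℝ) ≤ B := B.2
  have hfpos : 0 < f k := by
    have : (0 : ℝ) < f k := lt_of_lt_of_le (by positivity) hB
    exact_mod_cast this
  obtain ⟨-, h3, h4⟩ := hG k n hk hfpos hfk hkn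
  refine le_trans ?_ h3
  calc (B : ℝ≥0∞) * detRatio (G k n) k ≤ B * ENNReal.ofReal (100 * Real.log k) := by gcongr
    _ = ENNReal.ofReal (B * (100 * Real.log k)) := by
        rw [ENNReal.ofReal_mul hB0, ENNReal.ofReal_coe_nnreal]
    _ ≤ ENNReal.ofReal (f k) := ENNReal.ofReal_le_ofReal (by nlinarith)
    _ = f k := ENNReal.ofReal_natCast _

/-- With `ε = 1 / (4 * (b + 1))`, eventually `log k - log f ≤ ε * log k` and `log (log f) ≤ 2 * ε *
log f`; moreover `log k ≤ 4/3 * log f`. The sum is at most `10/3 * ε * log f`. -/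
theorem eventually_log_sub_log_le {f : ℕ → ℕ}
    (hf : Tendsto (fun k : ℕ => Real.log (f k) / Real.log k) atTop (nhds 1)) {b : ℝ} (hb : 0 ≤ b) :
    ∀ᶠ k : ℕ in atTop, 0 < f k ∧
      b * (Real.log k - Real.log (f k) + Real.log (Real.log (f k))) ≤ Real.log (f k) := by
  have hlog : Tendsto (fun k : ℕ => Real.log k) atTop atTop :=
    Real.tendsto_log_atTop.comp tendsto_natCast_atTop_atTop
  have hlogf : Tendsto (fun k : ℕ => Real.log (f k)) atTop atTop := by
    refine (hf.pos_mul_atTop one_pos hlog).congr' ?_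
    filter_upwards [hlog.eventually_gt_atTop 0] with k hk
    field_simp
  have hε : (0 : ℝ) < (4 * (b + 1))⁻¹ := by positivity
  have h1 : ∀ᶠ k : ℕ in atTop, 1 - (4 * (b + 1))⁻¹ < Real.log (f k) / Real.log k :=
    hf.eventually (lt_mem_nhds (by linarith))
  have h2 := hlogf.eventually (Real.isLittleO_log_id_atTop.def
    (show (0 : ℝ) < (2 * (b + 1))⁻¹ by positivity))
  filter_upwards [h1, h2, hlog.eventually_gt_atTop 0, hlogf.eventually_gt_atTop 0]
    with k h1 h2 h3 h4
  refine ⟨Nat.pos_of_ne_zero fun h => by simp [h] at h4, ?_⟩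
  rw [lt_div_iff₀ h3] at h1
  have hle : Real.log (Real.log (f k)) ≤ (2 * (b + 1))⁻¹ * Real.log (f k) := by
    refine (le_abs_self _).trans ?_
    simpa [abs_of_pos h4] using h2
  set x := Real.log (f k)
  set y := Real.log k
  set ε := (4 * (b + 1))⁻¹ with hεdef
  have hε1 : 4 * (b + 1) * ε = 1 := mul_inv_cancel₀ (by positivity)
  have hε2 : (2 * (b + 1))⁻¹ = 2 * ε := by rw [hεdef]; field_simp; norm_num
  have hεle : ε ≤ 1 / 4 := by nlinarith
  rw [hε2] at hle
  have hy : y ≤ 4 / 3 * x := by nlinarith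
  have h5 : y - x + Real.log x ≤ 10 / 3 * (ε * x) := by nlinarith
  calc b * (y - x + Real.log x) ≤ b * (10 / 3 * (ε * x)) := by gcongr
    _ = 10 / 3 * (b * ε) * x := by ring
    _ ≤ 1 * x := by
        gcongr
        nlinarith
    _ = x := one_mul x

theorem exists_rand_graph_family {f : ℕ → ℕ}
    (hf : Tendsto (fun k : ℕ => Real.log (f k) / Real.log k) atTop (nhds 1))
    (A : RandUniform) (hA : ∀ n k hk, RandTrulyOnline (A n k hk)) :
    ∃ G : ∀ _ n : ℕ, ExtGraph (Fin n),
      (∀ (k n : ℕ) (hk : 0 < k), 0 < f k → f k < k → k < n →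
        ((k - f k - 1 : ℕ) : ℕ∞) ≤ (G k n).Delta ∧
        ENNReal.ofReal (1 / 5 * Real.log (f k)) ≤
          ratio (G k n) k (randCost (A n k hk (G k n))) ∧
        oblRatio (G k n) k ≤ ENNReal.ofReal
          (100 * (Real.log k - Real.log (f k) + Real.log (Real.log (f k))))) ∧
      ∀ B : ℝ≥0, ∀ᶠ k : ℕ in atTop, ∀ (hk : 0 < k) (n : ℕ), f k < k → k < n →
        B * oblRatio (G k n) k ≤ ratio (G k n) k (randCost (A n k hk (G k n))) := by
  have hex : ∀ k n : ℕ, ∃ G : ExtGraph (Fin n), ∀ hk : 0 < k, 0 < f k → f k < k → k < n →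
      ((k - f k - 1 : ℕ) : ℕ∞) ≤ G.Delta ∧
      ENNReal.ofReal (1 / 5 * Real.log (f k)) ≤ ratio G k (randCost (A n k hk G)) ∧
      oblRatio G k ≤ ENNReal.ofReal
        (100 * (Real.log k - Real.log (f k) + Real.log (Real.log (f k)))) := by
    intro k n
    by_cases h : 0 < k ∧ 0 < f k ∧ f k < k ∧ k < n
    · obtain ⟨G, hG⟩ := exists_rand_graph_of_pos h.2.1 h.2.2.1 h.2.2.2 (A n k h.1) (hA n k h.1)
      exact ⟨G, fun _ _ _ _ => hG⟩
    · exact ⟨completeExtGraph n, fun h1 h2 h3 h4 => absurd ⟨h1, h2, h3, h4⟩ h⟩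
  choose G hG using hex
  refine ⟨G, hG, fun B => ?_⟩
  have hB0 : (0 : ℝ) ≤ B := B.2
  -- The factor 500 is the quotient of the constants 100 and 1/5.
  filter_upwards [eventually_log_sub_log_le hf (b := 500 * B) (by positivity)]
    with k ⟨hfpos, hle⟩ hk n hfk hkn
  obtain ⟨-, h3, h4⟩ := hG k n hk hfpos hfk hkn
  refine le_trans ?_ h3
  calc (B : ℝ≥0∞) * oblRatio (G k n) k
      ≤ B * ENNReal.ofReal
        (100 * (Real.log k - Real.log (f k) + Real.log (Real.log (f k)))) := by gcongr
    _ = ENNReal.ofReal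
        (B * (100 * (Real.log k - Real.log (f k) + Real.log (Real.log (f k))))) := by
        rw [ENNReal.ofReal_mul hB0, ENNReal.ofReal_coe_nnreal]
    _ ≤ ENNReal.ofReal (1 / 5 * Real.log (f k)) := ENNReal.ofReal_le_ofReal (by nlinarith)

theorem le_of_ofReal_le {x y : ℝ} {b₁ b₂ : ℝ≥0} {r : ℝ≥0∞} (hy : 0 ≤ y)
    (h : ENNReal.ofReal x ≤ b₁ * r + b₂) (hr : r ≤ ENNReal.ofReal y) : x ≤ b₁ * y + b₂ := by
  have h1 : ENNReal.ofReal x ≤ ENNReal.ofReal (b₁ * y + b₂) := by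
    refine h.trans ?_
    rw [ENNReal.ofReal_add (by positivity) (NNReal.coe_nonneg b₂),
      ENNReal.ofReal_mul (NNReal.coe_nonneg b₁),
      ENNReal.ofReal_coe_nnreal, ENNReal.ofReal_coe_nnreal]
    gcongr
  exact (ENNReal.ofReal_le_ofReal_iff (by positivity)).1 h1

theorem eventually_mul_log_add_lt (a b : ℝ) (ha : 0 ≤ a) :
    ∀ᶠ x : ℝ in atTop, a * Real.log x + b < x := by
  filter_upwards [Real.isLittleO_log_id_atTop.def (show (0 : ℝ) < (2 * (a + 1))⁻¹ by positivity),
    eventually_gt_atTop 0, eventually_gt_atTop (2 * b)] with x h1 h2 h3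
  have h4 : Real.log x ≤ (2 * (a + 1))⁻¹ * x := by
    refine (le_abs_self _).trans ?_
    simpa [abs_of_pos h2] using h1
  rw [inv_mul_eq_div, le_div_iff₀ (by positivity)] at h4
  rcases le_total 0 (Real.log x) with h5 | h5
  · nlinarith
  · nlinarith

theorem isLittleO_sqrt_add_one :
    (fun k : ℕ => ((Nat.sqrt k + 1 : ℕ) : ℝ)) =o[atTop] (fun k : ℕ => (k : ℝ)) := by
  refine IsLittleO.of_bound fun c hc => ?_
  filter_upwards [tendsto_natCast_atTop_atTop.eventually_ge_atTop (2 / c),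
    tendsto_natCast_atTop_atTop.eventually_ge_atTop ((2 / c) ^ 2),
    eventually_ge_atTop 1] with k h1 h2 h3
  have hs : (Nat.sqrt k : ℝ) ^ 2 ≤ k := by exact_mod_cast Nat.sqrt_le' k
  have hs1 : (1 : ℝ) ≤ Nat.sqrt k := by
    exact_mod_cast Nat.sqrt_pos.2 h3
  have hk0 : (0 : ℝ) ≤ k := Nat.cast_nonneg k
  rw [Real.norm_of_nonneg (Nat.cast_nonneg _), Real.norm_of_nonneg hk0]
  push_cast
  have h4 : (2 : ℝ) * Nat.sqrt k ≤ c * k := by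
    have h5 : (2 / c * Nat.sqrt k) ^ 2 ≤ (k : ℝ) ^ 2 := by
      rw [mul_pow, sq (k : ℝ)]
      gcongr
    have h6 := abs_le_of_sq_le_sq' h5 hk0 |>.2
    rw [div_mul_eq_mul_div, div_le_iff₀ hc] at h6
    linarith
  linarith

/-- For `k = j ^ 2` and `f = j` the ratio `j` is compared with a multiple of `log (j ^ 2) = 2 * log
j`, and `Δ ≥ k - √k`. -/
theorem not_veryStronglyCompetitive {𝒞 : ∀ n : ℕ, ℕ → Set (ExtGraph (Fin n))}
    (h𝒞 : ∀ (n k : ℕ) (G : ExtGraph (Fin n)),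
      (k : ℕ∞) ≤ G.Delta + (Nat.sqrt k + 1 : ℕ) → G ∈ 𝒞 n k)
    (A : DetUniform) (hA : ∀ n k hk, TrulyOnline (A n k hk)) :
    ¬ VeryStronglyCompetitive A 𝒞 := by
  rintro ⟨b₁, b₂, h⟩
  have hev := (tendsto_natCast_atTop_atTop (R := ℝ)).eventually
    (eventually_mul_log_add_lt (b₁ * 200) b₂ (by positivity))
  obtain ⟨j, hj, hj2⟩ := (hev.and (eventually_ge_atTop 2)).exists
  have hjk : j < j * j := by nlinarith
  have hk : 0 < j * j := by omega
  obtain ⟨G, h1, h2, h3⟩ := exists_det_graph (by omega) hjk (Nat.lt_succ_self _)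
    (A (j * j + 1) (j * j) hk) (hA _ _ _)
  have hmem : G ∈ 𝒞 (j * j + 1) (j * j) := by
    refine h𝒞 _ _ _ ?_
    rw [Nat.sqrt_eq]
    refine le_trans ?_ (add_le_add_left h1 _)
    exact_mod_cast (by omega : j * j ≤ (j * j - j + 1) + (j + 1))
  have h4 := h2.trans (h _ _ hk G hmem)
  rw [← ENNReal.ofReal_natCast] at h4
  have hlog : 0 ≤ Real.log (j * j : ℕ) := Real.log_natCast_nonneg _
  have h5 := le_of_ofReal_le (by positivity) h4 ((detRatioInf_le _ _).trans h3)
  rw [Nat.cast_mul, Real.log_mul (by positivity) (by positivity)] at h5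
  linarith

/-- Again `k = j ^ 2` and `f = j`; now `log j` is compared with `log (log j)`. The bound `Δ ≥ k - j
- 1` is why one is added to the square root. -/
theorem not_randVeryStronglyCompetitive {𝒞 : ∀ n : ℕ, ℕ → Set (ExtGraph (Fin n))}
    (h𝒞 : ∀ (n k : ℕ) (G : ExtGraph (Fin n)),
      (k : ℕ∞) ≤ G.Delta + (Nat.sqrt k + 1 : ℕ) → G ∈ 𝒞 n k)
    (A : RandUniform) (hA : ∀ n k hk, RandTrulyOnline (A n k hk)) :
    ¬ RandVeryStronglyCompetitive A 𝒞 := by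
  rintro ⟨b₁, b₂, h⟩
  have hev := (Real.tendsto_log_atTop.comp (tendsto_natCast_atTop_atTop (R := ℝ))).eventually
    (eventually_mul_log_add_lt (5 * (b₁ * 60)) (5 * b₂) (by positivity))
  obtain ⟨j, hj, hj2⟩ := (hev.and (eventually_ge_atTop 64)).exists
  have hjk : j < j * j := by nlinarith
  have hk : 0 < j * j := by omega
  obtain ⟨G, h1, h2, h3⟩ := exists_rand_graph hj2 hjk (Nat.lt_succ_self _)
    (A (j * j + 1) (j * j) hk) (hA _ _ _)
  have hmem : G ∈ 𝒞 (j * j + 1) (j * j) := by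
    refine h𝒞 _ _ _ ?_
    rw [Nat.sqrt_eq]
    refine le_trans ?_ (add_le_add_left h1 _)
    exact_mod_cast (by omega : j * j ≤ (j * j - j - 1) + (j + 1))
  have h4 := h2.trans (h _ _ hk G hmem)
  have h5 := le_of_ofReal_le (by linarith [one_le_log_log hj2]) h4 ((oblRatioInf_le _ _).trans h3)
  simp only [Function.comp_apply] at hj
  linarith

end Asymptotics

end Paging

theorem mainTheorem5 :
    ∃ c C : ℝ, 0 < c ∧ 0 < C ∧
    -- (1) deterministic algorithms
    (∀ f k n : ℕ, 0 < f → f < k → k < n →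
      ∀ A : Paging.ExtGraph (Fin n) → Paging.DetAlg (Fin n) k, Paging.TrulyOnline A →
      ∃ G : Paging.ExtGraph (Fin n),
        ((k - f + 1 : ℕ) : ℕ∞) ≤ G.Delta ∧
        (f : ℝ≥0∞) ≤ Paging.ratio G k (Paging.detCost (A G)) ∧
        Paging.detRatio G k ≤ ENNReal.ofReal (C * Real.log k)) ∧
    -- (1), in particular: `f = ω(log k)`
    (∀ f : ℕ → ℕ, (fun k : ℕ => Real.log k) =o[atTop] (fun k : ℕ => (f k : ℝ)) →
      ∀ A : Paging.DetUniform, (∀ n k hk, Paging.TrulyOnline (A n k hk)) →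
      ∃ G : ∀ k n : ℕ, Paging.ExtGraph (Fin n),
        (∀ (k n : ℕ) (hk : 0 < k), 0 < f k → f k < k → k < n →
          ((k - f k + 1 : ℕ) : ℕ∞) ≤ (G k n).Delta ∧
          (f k : ℝ≥0∞) ≤ Paging.ratio (G k n) k (Paging.detCost (A n k hk (G k n))) ∧
          Paging.detRatio (G k n) k ≤ ENNReal.ofReal (C * Real.log k)) ∧
        ∀ B : ℝ≥0, ∀ᶠ k : ℕ in atTop, ∀ (hk : 0 < k) (n : ℕ), f k < k → k < n →
          B * Paging.detRatio (G k n) k ≤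
            Paging.ratio (G k n) k (Paging.detCost (A n k hk (G k n)))) ∧
    -- (2) randomized algorithms (for `f = 1`, `log (log f)` is read as `0`)
    (∀ f k n : ℕ, 0 < f → f < k → k < n →
      ∀ A : Paging.ExtGraph (Fin n) → Paging.RandAlg (Fin n) k, Paging.RandTrulyOnline A →
      ∃ G : Paging.ExtGraph (Fin n),
        ((k - f - 1 : ℕ) : ℕ∞) ≤ G.Delta ∧
        ENNReal.ofReal (c * Real.log f) ≤ Paging.ratio G k (Paging.randCost (A G)) ∧
        Paging.oblRatio G k ≤
          ENNReal.ofReal (C * (Real.log k - Real.log f + Real.log (Real.log f)))) ∧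
    -- (2), in particular: `f = k ^ (1 - o(1))`
    (∀ f : ℕ → ℕ, Tendsto (fun k : ℕ => Real.log (f k) / Real.log k) atTop (nhds 1) →
      ∀ A : Paging.RandUniform, (∀ n k hk, Paging.RandTrulyOnline (A n k hk)) →
      ∃ G : ∀ k n : ℕ, Paging.ExtGraph (Fin n),
        (∀ (k n : ℕ) (hk : 0 < k), 0 < f k → f k < k → k < n →
          ((k - f k - 1 : ℕ) : ℕ∞) ≤ (G k n).Delta ∧
          ENNReal.ofReal (c * Real.log (f k)) ≤
            Paging.ratio (G k n) k (Paging.randCost (A n k hk (G k n))) ∧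
          Paging.oblRatio (G k n) k ≤ ENNReal.ofReal
            (C * (Real.log k - Real.log (f k) + Real.log (Real.log (f k))))) ∧
        ∀ B : ℝ≥0, ∀ᶠ k : ℕ in atTop, ∀ (hk : 0 < k) (n : ℕ), f k < k → k < n →
          B * Paging.oblRatio (G k n) k ≤
            Paging.ratio (G k n) k (Paging.randCost (A n k hk (G k n)))) ∧
    -- consequence: a class of all graphs with `Δ(G) ≥ k - o(k)` is too large
    (∃ g : ℕ → ℕ, (fun k : ℕ => (g k : ℝ)) =o[atTop] (fun k : ℕ => (k : ℝ)) ∧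
      ∀ 𝒞 : ∀ n : ℕ, ℕ → Set (Paging.ExtGraph (Fin n)),
        (∀ (n k : ℕ) (G : Paging.ExtGraph (Fin n)), (k : ℕ∞) ≤ G.Delta + g k → G ∈ 𝒞 n k) →
        (∀ A : Paging.DetUniform, (∀ n k hk, Paging.TrulyOnline (A n k hk)) →
          ¬ Paging.VeryStronglyCompetitive A 𝒞) ∧
        (∀ A : Paging.RandUniform, (∀ n k hk, Paging.RandTrulyOnline (A n k hk)) →
          ¬ Paging.RandVeryStronglyCompetitive A 𝒞)) := by
  refine ⟨1 / 5, 100, by norm_num, by norm_num, ?_, ?_, ?_, ?_, ?_⟩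
  · exact fun f k n hf hfk hkn A hA => Paging.exists_det_graph hf hfk hkn A hA
  · exact fun f hf A hA => Paging.exists_det_graph_family hf A hA
  · exact fun f k n hf hfk hkn A hA => Paging.exists_rand_graph_of_pos hf hfk hkn A hA
  · exact fun f hf A hA => Paging.exists_rand_graph_family hf A hA
  · exact ⟨fun k => Nat.sqrt k + 1, Paging.isLittleO_sqrt_add_one, fun 𝒞 h𝒞 =>
      ⟨fun A hA => Paging.not_veryStronglyCompetitive h𝒞 A hA,
        fun A hA => Paging.not_randVeryStronglyCompetitive h𝒞 A hA⟩⟩
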